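/- **Model.** A server multicasts status updates $j=0,1,2,\dots$ to $N$ devices. Let $1\le K\le N$, $\lambda>0$, $c>0$ and $c<T_D\le\infty$. The service times $T_{n,j}$ are i.i.d. with density $\lambda e^{-\lambda(t-c)}$ for $t>c$. For each $j$ let $T_N(K)$ be the $K$-th smallest of $T_{1,j},\dots,T_{N,j}$. The transmission of update $j$ is terminated at time $\min\{T_D,T_N(K)\}$ after its generation, and update $j+1$ is generated at that moment; update $0$ is generated at time $0$. Device $n$ receives update $j$ (event $\mathcal C_S$) if $T_{n,j}\le\min\{T_D,T_N(K)\}$, at time $T_{n,j}$ after its generation, and otherwise fails to receive it (event $\mathcal C_F$). Let $\Delta_n(t)=t-u_n(t)$, where $u_n(t)$ is the generation time of the most recent update received by device $n$ as of time $t$ (with an arbitrary initial age $\ge 0$ before the first reception). A cycle of device $n$ runs from the termination of one update received by device $n$ to the termination of the next one. Let $Y$ be its length, $A$ the area under $\Delta_n$ over it, $W$ the sum of the inter-generation times of the updates in the cycle that device $n$ fails to receive, and $\hat T$ the service time at device $n$ of the update it receives in the cycle. Let $X^S$ ($X^F$) be the inter-generation time following an update that device $n$ receives (fails to receive). **Theorem.**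 For every device $n$ the time average of the age exists almost surely and $$\bar\Delta_n=\lim_{\mathcal T\to\infty}\frac1{\mathcal T}\int_0^{\mathcal T}\Delta_n(t)\,dt=\frac{E[A]}{E[Y]}=\frac{E[W^2]+2(E[\hat T]+E[X^S])E[W]+2E[X^S]E[\hat T]+E[(X^S)^2]}{2E[W]+2E[X^S]},$$ where all the moments are finite and are given as follows. For $1\le h\le N$ put $B_{h,j}=h\binom Nh\binom{h-1}j(-1)^j$, $U_{h,j}=N-h+1+j$, $V_{h,j}=e^{-\lambda U_{h,j}(T_D-c)}$, $\mathcal Z_h=\sum_{i=0}^{h-1}B_{h,i}V_{h,i}/U_{h,i}$. Then $\mathcal Z_h=P(T_D<T_N(h))$ and $$p:=P(\mathcal C_S)=\frac1N\sum_{h=1}^K(1-\mathcal Z_h)>0,\qquad p_{S,1}:=P(T_N(K)<T_D\mid\mathcal C_S)=\frac{K(1-\mathcal Z_K)}{Np},$$ $$p_{F,2}:=P(T_D<T_N(K)\mid\mathcal C_F)=\frac{(N-K)\mathcal Z_K+\sum_{h=1}^K\mathcal Z_h}{Ne^{-\lambda(T_D-c)}+(N-K)-\sum_{h=K+1}^N\mathcal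 Z_h}.$$ The first and second moments of $T_N(K)$, conditional on $\mathcal C_S\cap\{T_N(K)<T_D\}$ and likewise (if $K<N$) on $\mathcal C_F\cap\{T_N(K)<T_D\}$, are $$m_1=\frac1{1-\mathcal Z_K}\sum_{j=0}^{K-1}\frac{B_{K,j}}{\lambda U_{K,j}^2}\bigl[1+c\lambda U_{K,j}-(1+T_D\lambda U_{K,j})V_{K,j}\bigr],$$ $$m_2=\frac1{1-\mathcal Z_K}\sum_{j=0}^{K-1}\frac{B_{K,j}}{\lambda^2U_{K,j}^3}\bigl[(1+c\lambda U_{K,j})^2+1-((1+T_D\lambda U_{K,j})^2+1)V_{K,j}\bigr].$$ For $r=1,2$, $$E[(X^F)^r]=(1-p_{F,2})m_r+p_{F,2}T_D^r,\qquad E[(X^S)^r]=p_{S,1}m_r+(1-p_{S,1})T_D^r .$$ With $E[M]=1/p$ and $E[M^2]=(2-p)/p^2$, $$E[W]=(E[M]-1)E[X^F],$$ $$E[W^2]=E[W]^2+E[X^F]^2\bigl(E[M^2]-E[M]^2\bigr)+\bigl(E[(X^F)^2]-E[X^F]^2\bigr)(E[M]-1),$$ $$E[\hat T]=\sum_{h=1}^K\sum_{j=0}^{h-1}B_{h,j}\,\frac{c\lambda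 U_{h,j}+1-V_{h,j}(\lambda U_{h,j}T_D+1)}{Np\,\lambda U_{h,j}^2}.$$ For $T_D=\infty$, read $V_{h,j}$, $e^{-\lambda(T_D-c)}$ and all products of powers of $T_D$ with $V_{h,j}$, $p_{F,2}$ or $1-p_{S,1}$ as $0$. If moreover $K=N$, then $P(\mathcal C_F)=0$, $p=1$ and $W=0$ almost surely; the statements about $p_{F,2}$ and $X^F$ are then void, and $E[W]=E[W^2]=0$. The cases $K=N$ (broadcast), $T_D=\infty$ (no deadline) and $N=K=1$ (unicast) are included. -/

import Mathlib

open MeasureTheory Filter Topology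

noncomputable section

namespace MulticastAoI

/-! ### The transmission process

A realization of the service times is a family `x : Fin N → ℕ → ℝ`, where `x n j` is the time needed
to deliver status update `j` to device `n`. The status updates are numbered `0, 1, 2, …` in the order
of their generation, and update `0` is generated at time `0`. The deadline is an extended real number
`TD`; the value `⊤` means that there is no deadline. -/

/-- The shifted exponential distribution, with density `lam * exp (-lam * (t - c))` for `t > c`. -/
def shiftedExp (lam c : ℝ) : Measure ℝ :=
  volume.withDensity fun t =>
    ENNReal.ofReal (if c < t then lam * Real.exp (-lam * (t - c)) else 0)

/-- The `K`-th smallest of the numbers `y 0, …, y (N - 1)` (for `1 ≤ K ≤ N`): the first time at which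
at least `K` of the devices have received the update. -/
def orderStat {N : ℕ} (K : ℕ) (y : Fin N → ℝ) : ℝ :=
  sInf {t : ℝ | K ≤ (Finset.univ.filter fun m => y m ≤ t).card}

/-- The time between generation and termination of an update with service times `y`: the minimum of
the deadline and the `K`-th smallest service time. -/
def duration {N : ℕ} (K : ℕ) (TD : EReal) (y : Fin N → ℝ) : ℝ :=
  (min TD ((orderStat K y : ℝ) : EReal)).toReal

/-- Device `n` receives an update with service times `y`: its service time does not exceed the minimum
of the deadline and the `K`-th smallest service time. -/
def Received {N : ℕ} (K : ℕ) (TD : EReal) (n : Fin N) (y : Fin N → ℝ) : Prop :=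
  ((y n : ℝ) : EReal) ≤ min TD ((orderStat K y : ℝ) : EReal)

/-- The inter-generation time of the updates `j` and `j + 1`. -/
def interGen {N : ℕ} (K : ℕ) (TD : EReal) (x : Fin N → ℕ → ℝ) (j : ℕ) : ℝ :=
  duration K TD fun m => x m j

/-- The generation time of update `j`: update `0` is generated at time `0`, and each further update is
generated when the transmission of its predecessor is terminated. -/
def genTime {N : ℕ} (K : ℕ) (TD : EReal) (x : Fin N → ℕ → ℝ) (j : ℕ) : ℝ :=
  ∑ i ∈ Finset.range j, interGen K TD x i

/-- The generation time of the most recent update received by device `n` as of time `t`; before the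
first reception it is `-a`, where `a` is the initial age. -/
def lastGen {N : ℕ} (K : ℕ) (TD : EReal) (a : ℝ) (n : Fin N) (x : Fin N → ℕ → ℝ) (t : ℝ) : ℝ :=
  sSup ({-a} ∪ {s : ℝ | ∃ j : ℕ, (Received K TD n fun m => x m j) ∧
    genTime K TD x j + x n j ≤ t ∧ s = genTime K TD x j})

/-- The instantaneous age of information of device `n` at time `t`. -/
def age {N : ℕ} (K : ℕ) (TD : EReal) (a : ℝ) (n : Fin N) (x : Fin N → ℕ → ℝ) (t : ℝ) : ℝ :=
  t - lastGen K TD a n x t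

/-! ### The cycles of a device

Cycle `q` of device `n` starts at the termination of the `q`-th update and ends at the termination of
the `(q + 1)`-th update received by that device (counted from `0`). -/

/-- The number `j` of the `q`-th update (counted from `0`) that device `n` receives. -/
def receivedIdx {N : ℕ} (K : ℕ) (TD : EReal) (n : Fin N) (x : Fin N → ℕ → ℝ) (q : ℕ) : ℕ :=
  Nat.nth (fun j => Received K TD n fun m => x m j) q

/-- The termination time of the `q`-th update received by device `n`. -/
def termTime {N : ℕ} (K : ℕ) (TD : EReal) (n : Fin N) (x : Fin N → ℕ → ℝ) (q : ℕ) : ℝ :=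
  genTime K TD x (receivedIdx K TD n x q + 1)

/-- `Y`: the length of cycle `q`. -/
def cycleLength {N : ℕ} (K : ℕ) (TD : EReal) (n : Fin N) (x : Fin N → ℕ → ℝ) (q : ℕ) : ℝ :=
  termTime K TD n x (q + 1) - termTime K TD n x q

/-- `A`: the area under the age curve of device `n` over cycle `q`. -/
def cycleArea {N : ℕ} (K : ℕ) (TD : EReal) (a : ℝ) (n : Fin N) (x : Fin N → ℕ → ℝ) (q : ℕ) : ℝ :=
  ∫ t in (termTime K TD n x q)..(termTime K TD n x (q + 1)), age K TD a n x t

/-- `X^S`: the inter-generation time that follows the `q`-th update received by device `n`. -/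
def successGap {N : ℕ} (K : ℕ) (TD : EReal) (n : Fin N) (x : Fin N → ℕ → ℝ) (q : ℕ) : ℝ :=
  interGen K TD x (receivedIdx K TD n x q)

/-- `W`: the sum of the inter-generation times of all updates in cycle `q` that device `n` fails to
receive. -/
def failureSum {N : ℕ} (K : ℕ) (TD : EReal) (n : Fin N) (x : Fin N → ℕ → ℝ) (q : ℕ) : ℝ :=
  ∑ i ∈ Finset.Ioo (receivedIdx K TD n x q) (receivedIdx K TD n x (q + 1)), interGen K TD x i

/-- `T̂`: the service time at device `n` of the update that it receives in cycle `q`. -/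
def serviceTime {N : ℕ} (K : ℕ) (TD : EReal) (n : Fin N) (x : Fin N → ℕ → ℝ) (q : ℕ) : ℝ :=
  x n (receivedIdx K TD n x (q + 1))

/-! ### The closed-form expressions

For `TD = ⊤` the quantity `V` is `0`, and so are all products of `TD` with `V` and with the probability
that the deadline expires first; this is what `EReal.toReal ⊤ = 0` amounts to below. -/

/-- `B_{h,j}`. -/
def coeffB (N h j : ℕ) : ℝ := h * N.choose h * (h - 1).choose j * (-1) ^ j

/-- `U_{h,j}`. -/
def coeffU (N h j : ℕ) : ℝ := (N : ℝ) - h + 1 + j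

/-- `exp (-lam * u * (TD - c))`, which is `0` for `TD = ⊤`. -/
def decay (lam c : ℝ) (TD : EReal) (u : ℝ) : ℝ :=
  if TD = ⊤ then 0 else Real.exp (-lam * u * (TD.toReal - c))

/-- `V_{h,j}`. -/
def coeffV (N : ℕ) (lam c : ℝ) (TD : EReal) (h j : ℕ) : ℝ := decay lam c TD (coeffU N h j)

/-- `Z_h`. -/
def coeffZ (N : ℕ) (lam c : ℝ) (TD : EReal) (h : ℕ) : ℝ :=
  ∑ i ∈ Finset.range h, coeffB N h i * (coeffV N lam c TD h i / coeffU N h i)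

/-- `P(C_S)`. -/
def probS (N K : ℕ) (lam c : ℝ) (TD : EReal) : ℝ :=
  1 / N * ∑ h ∈ Finset.Icc 1 K, (1 - coeffZ N lam c TD h)

/-- `P(C_{S,1})`. -/
def probS1 (N K : ℕ) (lam c : ℝ) (TD : EReal) : ℝ :=
  K * (1 - coeffZ N lam c TD K) / (N * probS N K lam c TD)

/-- `P(C_{F,2})`. -/
def probF2 (N K : ℕ) (lam c : ℝ) (TD : EReal) : ℝ :=
  (((N : ℝ) - K) * coeffZ N lam c TD K + ∑ h ∈ Finset.Icc 1 K, coeffZ N lam c TD h) /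
    (N * decay lam c TD 1 + ((N : ℝ) - K) - ∑ h ∈ Finset.Icc (K + 1) N, coeffZ N lam c TD h)

/-- The conditional first moment of the `K`-th smallest service time. -/
def condMoment1 (N K : ℕ) (lam c : ℝ) (TD : EReal) : ℝ :=
  1 / (1 - coeffZ N lam c TD K) * ∑ j ∈ Finset.range K,
    coeffB N K j / (lam * coeffU N K j ^ 2) *
      (1 + c * lam * coeffU N K j
        - (1 + TD.toReal * lam * coeffU N K j) * coeffV N lam c TD K j)

/-- The conditional second moment of the `K`-th smallest service time. -/
def condMoment2 (N K : ℕ) (lam c : ℝ) (TD : EReal) : ℝ :=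
  1 / (1 - coeffZ N lam c TD K) * ∑ j ∈ Finset.range K,
    coeffB N K j / (lam ^ 2 * coeffU N K j ^ 3) *
      ((1 + c * lam * coeffU N K j) ^ 2 + 1
        - ((1 + TD.toReal * lam * coeffU N K j) ^ 2 + 1) * coeffV N lam c TD K j)

/-- `E[X^F]`. -/
def meanXF (N K : ℕ) (lam c : ℝ) (TD : EReal) : ℝ :=
  (1 - probF2 N K lam c TD) * condMoment1 N K lam c TD + probF2 N K lam c TD * TD.toReal

/-- `E[(X^F)²]`. -/
def meanXFsq (N K : ℕ) (lam c : ℝ) (TD : EReal) : ℝ :=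
  (1 - probF2 N K lam c TD) * condMoment2 N K lam c TD + probF2 N K lam c TD * TD.toReal ^ 2

/-- `E[X^S]`. -/
def meanXS (N K : ℕ) (lam c : ℝ) (TD : EReal) : ℝ :=
  probS1 N K lam c TD * condMoment1 N K lam c TD + (1 - probS1 N K lam c TD) * TD.toReal

/-- `E[(X^S)²]`. -/
def meanXSsq (N K : ℕ) (lam c : ℝ) (TD : EReal) : ℝ :=
  probS1 N K lam c TD * condMoment2 N K lam c TD + (1 - probS1 N K lam c TD) * TD.toReal ^ 2

/-- `E[M]`, the mean of the geometric number of updates in a cycle. -/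
def meanM (N K : ℕ) (lam c : ℝ) (TD : EReal) : ℝ := 1 / probS N K lam c TD

/-- `E[M²]`. -/
def meanMsq (N K : ℕ) (lam c : ℝ) (TD : EReal) : ℝ :=
  (2 - probS N K lam c TD) / probS N K lam c TD ^ 2

/-- `E[W]`. -/
def meanW (N K : ℕ) (lam c : ℝ) (TD : EReal) : ℝ :=
  (meanM N K lam c TD - 1) * meanXF N K lam c TD

/-- `Var[W]`. -/
def varW (N K : ℕ) (lam c : ℝ) (TD : EReal) : ℝ :=
  meanXF N K lam c TD ^ 2 * (meanMsq N K lam c TD - meanM N K lam c TD ^ 2)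
    + (meanXFsq N K lam c TD - meanXF N K lam c TD ^ 2) * (meanM N K lam c TD - 1)

/-- `E[W²]`. -/
def meanWsq (N K : ℕ) (lam c : ℝ) (TD : EReal) : ℝ :=
  meanW N K lam c TD ^ 2 + varW N K lam c TD

/-- `E[T̂]`. -/
def meanT (N K : ℕ) (lam c : ℝ) (TD : EReal) : ℝ :=
  ∑ h ∈ Finset.Icc 1 K, ∑ j ∈ Finset.range h,
    coeffB N h j * (c * lam * coeffU N h j + 1
        - coeffV N lam c TD h j * (lam * coeffU N h j * TD.toReal + 1)) /
      (N * probS N K lam c TD * lam * coeffU N h j ^ 2)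

/-- The average age as a function of `w = E[W]`, `w2 = E[W²]`, `s = E[X^S]`, `s2 = E[(X^S)²]` and
`τ = E[T̂]`. -/
def ageOfMoments (w w2 s s2 τ : ℝ) : ℝ :=
  (w2 + 2 * (τ + s) * w + 2 * s * τ + s2) / (2 * w + 2 * s)

/-- The closed form of the average age. -/
def averageAge (N K : ℕ) (lam c : ℝ) (TD : EReal) : ℝ :=
  ageOfMoments (meanW N K lam c TD) (meanWsq N K lam c TD) (meanXS N K lam c TD)
    (meanXSsq N K lam c TD) (meanT N K lam c TD)

end MulticastAoI

end

noncomputable section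

namespace MulticastAoI

/-! ### Order statistics -/

/-! Every reception by device `n` regenerates the transmission process. The service time vectors of
successive updates are i.i.d.; cutting their sequence after each vector in `receivedSet` produces
blocks, each made of a run of failures followed by one success. By `map_preSum_firstVal_regen` the
total duration of the failures, the successful vector and the remaining sequence are independent;
the success has the single-update law conditioned on reception, and the remainder has the original
law. Along a path, `cycleArea_eq` splits a cycle at its delivery instant and finds the area X(W + T)
+ W²/2 + WT + X'²/2, where X belongs to the success before the cycle and X', T to the success that
ends it. The squares of T cancel and X' is never multiplied by T, so only the listed moments enter
and independence factorises every product. The area involves two consecutive blocks, so neighbouring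
cycles are dependent, but cycles at distance at least two are independent. `strong_law_blocks`
therefore applies the strong law to even and odd cycles separately, and `tendsto_timeAverage` passes
from cycle ends to all times because the age is nonnegative. The moments of W come from a first-step
recursion (`failStep`): its iterates have bounded moments, Fatou's lemma gives W a finite second
moment, and the recursion then determines the first two moments (`moments_preSum`). For a single
update there are two ingredients. The tail of an order statistic is a binomial tail, which
`binomial_tail_eq` turns into a combination of exponentials, so that truncated moments are
elementary integrals. By exchangeability (`integral_le_orderStat`), an expectation on the event that
device `n` is among the `K` fastest is 1/N times the sum over the orders 1, …, K; in particular, on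
the event that the deadline is not reached, reception only contributes a factor K/N. -/

theorem succ_le_card_filter_le_iff {N : ℕ} (y : Fin N → ℝ) (i : Fin N) (t : ℝ) :
    (i : ℕ) + 1 ≤ (Finset.univ.filter fun m => y m ≤ t).card ↔ y (Tuple.sort y i) ≤ t := by
  have hcard : (Finset.univ.filter fun m => y m ≤ t).card
      = (Finset.univ.filter fun m => (y ∘ Tuple.sort y) m ≤ t).card := by
    refine (Finset.card_bij (fun m _ => Tuple.sort y m) ?_ ?_ ?_).symm
    · intro m hm; simpa using hm
    · intro m _ m' _ h; exact (Tuple.sort y).injective h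
    · intro m hm
      exact ⟨(Tuple.sort y).symm m, by simpa using hm, by simp⟩
  have := Tuple.lt_card_le_iff_apply_le_of_monotone (f := y ∘ Tuple.sort y) (a := t) (j := i)
    (Tuple.monotone_sort y)
  rw [hcard, Nat.succ_le_iff]
  exact this

/-- The defining set is a closed half-line whose endpoint is a sorted value; orders count from 1 and
`Fin N` from 0. -/
theorem orderStat_succ {N : ℕ} (y : Fin N → ℝ) (i : Fin N) :
    orderStat ((i : ℕ) + 1) y = y (Tuple.sort y i) := by
  have : {t : ℝ | (i : ℕ) + 1 ≤ (Finset.univ.filter fun m => y m ≤ t).card}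
      = Set.Ici (y (Tuple.sort y i)) := by
    ext t
    exact succ_le_card_filter_le_iff y i t
  rw [orderStat, this, csInf_Ici]

theorem exists_fin_succ_eq {N h : ℕ} (h1 : 1 ≤ h) (hN : h ≤ N) : ∃ i : Fin N, h = (i : ℕ) + 1 :=
  ⟨⟨h - 1, by omega⟩, by simp; omega⟩

/-- The bounds on `h` matter: for `h = 0` the defining set is all of ℝ, for `h > N` it is empty, and
in both cases `sInf` returns the default 0. -/
theorem orderStat_le_iff {N h : ℕ} (h1 : 1 ≤ h) (hN : h ≤ N) (y : Fin N → ℝ) (t : ℝ) :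
    orderStat h y ≤ t ↔ h ≤ (Finset.univ.filter fun m => y m ≤ t).card := by
  obtain ⟨i, rfl⟩ := exists_fin_succ_eq h1 hN
  rw [orderStat_succ, succ_le_card_filter_le_iff]

theorem exists_orderStat_eq {N h : ℕ} (h1 : 1 ≤ h) (hN : h ≤ N) (y : Fin N → ℝ) :
    ∃ m, orderStat h y = y m := by
  obtain ⟨i, rfl⟩ := exists_fin_succ_eq h1 hN
  exact ⟨_, orderStat_succ y i⟩

theorem orderStat_mono {N h k : ℕ} (h1 : 1 ≤ h) (hk : h ≤ k) (hN : k ≤ N) (y : Fin N → ℝ) :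
    orderStat h y ≤ orderStat k y :=
  (orderStat_le_iff h1 (hk.trans hN) y _).2
    (hk.trans ((orderStat_le_iff (h1.trans hk) hN y _).1 le_rfl))

theorem orderStat_comp_perm {N : ℕ} (h : ℕ) (y : Fin N → ℝ) (σ : Equiv.Perm (Fin N)) :
    orderStat h (fun m => y (σ m)) = orderStat h y := by
  unfold orderStat
  congr 1
  ext t
  have : (Finset.univ.filter fun m => y (σ m) ≤ t).card
      = (Finset.univ.filter fun m => y m ≤ t).card := by
    refine Finset.card_bij (fun m _ => σ m) ?_ ?_ ?_
    · intro m hm; simpa using hm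
    · intro m _ m' _ h; exact σ.injective h
    · intro m hm
      exact ⟨σ.symm m, by simpa using hm, by simp⟩
  simp only [Set.mem_ofPred_eq, this]

theorem measurable_orderStat {N h : ℕ} (h1 : 1 ≤ h) (hN : h ≤ N) :
    Measurable (orderStat h : (Fin N → ℝ) → ℝ) := by
  refine measurable_of_Iic fun t => ?_
  have : (orderStat h : (Fin N → ℝ) → ℝ) ⁻¹' Set.Iic t
      = {y | (h : ℝ) ≤ ∑ m : Fin N, Set.indicator (Set.Iic t) (fun _ => (1 : ℝ)) (y m)} := by
    ext y
    simp only [Set.mem_preimage, Set.mem_Iic, Set.mem_ofPred_eq]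
    rw [orderStat_le_iff h1 hN, Finset.card_filter, ← Nat.cast_le (α := ℝ)]
    simp [Set.indicator_apply]
  rw [this]
  refine measurableSet_le measurable_const (Finset.measurable_sum _ fun m _ => ?_)
  exact (measurable_const.indicator measurableSet_Iic).comp (measurable_pi_apply m)

/-- If the service times are distinct, those that do not exceed the `K`-th smallest one are the
order statistics of orders `1, …, K`. -/
theorem sum_le_orderStat {N K : ℕ} (h1 : 1 ≤ K) (hN : K ≤ N) {y : Fin N → ℝ}
    (hy : Function.Injective y) (g : ℝ → ℝ) :
    ∑ m, (if y m ≤ orderStat K y then g (y m) else 0)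
      = ∑ h ∈ Finset.Icc 1 K, g (orderStat h y) := by
  obtain ⟨k, rfl⟩ := exists_fin_succ_eq h1 hN
  -- Without ties the sorted sequence is strictly increasing, so comparing values amounts to
  -- comparing ranks. Ties at the `K`-th value could let more than `K` devices through.
  have hs : StrictMono (y ∘ Tuple.sort y) :=
    (Tuple.monotone_sort y).strictMono_of_injective (hy.comp (Tuple.sort y).injective)
  rw [← Equiv.sum_comp (Tuple.sort y), orderStat_succ]
  have : ∀ i, (if y (Tuple.sort y i) ≤ y (Tuple.sort y k) then g (y (Tuple.sort y i)) else 0)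
      = if (i : ℕ) < k + 1 then g (orderStat ((i : ℕ) + 1) y) else 0 := by
    intro i
    rw [orderStat_succ]
    have : y (Tuple.sort y i) ≤ y (Tuple.sort y k) ↔ (i : ℕ) < k + 1 := by
      rw [Nat.lt_succ_iff]; exact hs.le_iff_le
    simp only [this]
  rw [Finset.sum_congr rfl fun i _ => this i,
    Fin.sum_univ_eq_sum_range (fun i => if i < (k : ℕ) + 1 then g (orderStat (i + 1) y) else 0) N,
    ← Finset.sum_filter]
  have h2 : Finset.filter (fun i => i < (k : ℕ) + 1) (Finset.range N) = Finset.range (k + 1) := by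
    ext i; simp; omega
  rw [h2, Finset.range_eq_Ico, Finset.sum_Ico_add' (fun i => g (orderStat i y)) 0 (k + 1) 1]
  rfl

theorem sum_orderStat {N : ℕ} (y : Fin N → ℝ) (g : ℝ → ℝ) :
    ∑ h ∈ Finset.Icc 1 N, g (orderStat h y) = ∑ m, g (y m) := by
  rw [← Equiv.sum_comp (Tuple.sort y)]
  simp only [← orderStat_succ]
  rw [Fin.sum_univ_eq_sum_range (fun i => g (orderStat (i + 1) y)) N, Finset.range_eq_Ico,
    Finset.sum_Ico_add' (fun i => g (orderStat i y)) 0 N 1]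
  rw [zero_add]
  rfl

/-! ### The transmission of a single update -/

theorem received_iff {N K : ℕ} {TD : EReal} {n : Fin N} {y : Fin N → ℝ} :
    Received K TD n y ↔ ((y n : ℝ) : EReal) ≤ TD ∧ y n ≤ orderStat K y := by
  simp [Received, EReal.coe_le_coe_iff]

theorem measurableSet_received {N K : ℕ} (h1 : 1 ≤ K) (hN : K ≤ N) (TD : EReal) (n : Fin N) :
    MeasurableSet {y : Fin N → ℝ | Received K TD n y} := by
  simp only [received_iff]
  exact (measurableSet_le (measurable_coe_real_ereal.comp (measurable_pi_apply n))
    measurable_const).inter (measurableSet_le (measurable_pi_apply n) (measurable_orderStat h1 hN))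

theorem measurable_duration {N K : ℕ} (h1 : 1 ≤ K) (hN : K ≤ N) (TD : EReal) :
    Measurable (duration K TD : (Fin N → ℝ) → ℝ) :=
  (measurable_const.min
    (measurable_coe_real_ereal.comp (measurable_orderStat h1 hN))).ereal_toReal

theorem duration_of_lt {N K : ℕ} {TD : EReal} {y : Fin N → ℝ}
    (h : ((orderStat K y : ℝ) : EReal) < TD) : duration K TD y = orderStat K y := by
  simp [duration, min_eq_right h.le]

theorem duration_of_le {N K : ℕ} {TD : EReal} {y : Fin N → ℝ}
    (h : TD ≤ ((orderStat K y : ℝ) : EReal)) : duration K TD y = TD.toReal := by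
  simp [duration, min_eq_left h]

/-- The minimum is at most a real number and exceeds `⊥`, so `toReal` loses nothing in `duration`,
even without a deadline. -/
theorem coe_duration {N K : ℕ} {TD : EReal} (hTD : ⊥ < TD) (y : Fin N → ℝ) :
    ((duration K TD y : ℝ) : EReal) = min TD ((orderStat K y : ℝ) : EReal) := by
  refine EReal.coe_toReal ?_ ?_
  · exact ne_of_lt ((min_le_right _ _).trans_lt (EReal.coe_lt_top _))
  · exact ne_of_gt (lt_min hTD (EReal.bot_lt_coe _))

theorem received_iff_le_duration {N K : ℕ} {TD : EReal} (hTD : ⊥ < TD) {n : Fin N}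
    {y : Fin N → ℝ} : Received K TD n y ↔ y n ≤ duration K TD y := by
  rw [← EReal.coe_le_coe_iff, coe_duration hTD]; rfl

theorem lt_orderStat {N K : ℕ} (h1 : 1 ≤ K) (hN : K ≤ N) {c : ℝ} {y : Fin N → ℝ}
    (hy : ∀ m, c < y m) : c < orderStat K y := by
  obtain ⟨m, hm⟩ := exists_orderStat_eq h1 hN y
  rw [hm]; exact hy m

theorem lt_duration {N K : ℕ} (h1 : 1 ≤ K) (hN : K ≤ N) {c : ℝ} {TD : EReal}
    (hTD : (c : EReal) < TD) {y : Fin N → ℝ} (hy : ∀ m, c < y m) : c < duration K TD y := by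
  rw [← EReal.coe_lt_coe_iff, coe_duration (bot_le.trans_lt hTD)]
  exact lt_min hTD (EReal.coe_lt_coe_iff.2 (lt_orderStat h1 hN hy))

theorem duration_le_orderStat {N K : ℕ} {TD : EReal} (hTD : ⊥ < TD) (y : Fin N → ℝ) :
    duration K TD y ≤ orderStat K y := by
  rw [← EReal.coe_le_coe_iff, coe_duration hTD]
  exact min_le_right _ _

/-! ### Tails of binomial distributions -/

theorem coeffU_pos {N h : ℕ} (hN : h ≤ N) (j : ℕ) : 0 < coeffU N h j := by
  have : (h : ℝ) ≤ N := by exact_mod_cast hN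
  have : (0 : ℝ) ≤ j := j.cast_nonneg
  unfold coeffU; linarith

theorem coeffU_eq {N h : ℕ} (hN : h ≤ N) (j : ℕ) : coeffU N h j = ((N - h + 1 + j : ℕ) : ℝ) := by
  unfold coeffU; push_cast [Nat.cast_sub hN]; ring

theorem sum_coeffB_mul_pow {N h : ℕ} (h1 : 1 ≤ h) (x : ℝ) :
    ∑ j ∈ Finset.range h, coeffB N h j * x ^ j = h * N.choose h * (1 - x) ^ (h - 1) := by
  have : (1 - x) ^ (h - 1) = ∑ j ∈ Finset.range h, ((h - 1).choose j : ℝ) * (-1) ^ j * x ^ j := by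
    rw [sub_eq_neg_add, add_pow, Nat.sub_add_cancel h1]
    refine Finset.sum_congr rfl fun j _ => ?_
    rw [neg_pow x]; simp; ring
  rw [this, Finset.mul_sum]
  exact Finset.sum_congr rfl fun j _ => by unfold coeffB; ring

/-- Differentiating the binomial terms gives a telescoping sum, of which only the last contribution
survives; hence the induction on `h`. -/
theorem hasDerivAt_binomial_tail {N h : ℕ} (hN : h ≤ N) (x : ℝ) :
    HasDerivAt (fun x : ℝ => ∑ i ∈ Finset.range h, (N.choose i : ℝ) * ((1 - x) ^ i * x ^ (N - i)))
      (h * N.choose h * x ^ (N - h) * (1 - x) ^ (h - 1)) x := by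
  induction h with
  | zero => simpa using hasDerivAt_const x (0 : ℝ)
  | succ h ih =>
    simp only [Finset.sum_range_succ]
    have h0 := (((hasDerivAt_const x (1 : ℝ)).sub (hasDerivAt_id x)).pow h).mul
      ((hasDerivAt_id x).pow (N - h))
    refine ((ih (by omega)).add (h0.const_mul (N.choose h : ℝ))).congr_deriv ?_
    -- This is the identity that cancels neighbouring terms of the telescoping sum.
    have hc : ((h : ℝ) + 1) * N.choose (h + 1) = (N - h : ℕ) * N.choose h := by
      have := Nat.choose_succ_right_eq N h
      have h2 : (N.choose (h + 1) * (h + 1) : ℝ) = N.choose h * (N - h : ℕ) := by exact_mod_cast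
          this
      linarith
    have e : N - (h + 1) = N - h - 1 := by omega
    simp only [Pi.pow_apply, Pi.sub_apply, id, e, Nat.add_sub_cancel]
    push_cast
    rw [hc]
    ring

/-- The lower tail of a binomial distribution as a polynomial in the failure probability. -/
theorem binomial_tail_eq {N h : ℕ} (h1 : 1 ≤ h) (hN : h ≤ N) (x : ℝ) :
    ∑ i ∈ Finset.range h, (N.choose i : ℝ) * ((1 - x) ^ i * x ^ (N - i))
      = ∑ j ∈ Finset.range h, coeffB N h j / coeffU N h j * x ^ (N - h + 1 + j) := by
  have hR : ∀ x : ℝ, HasDerivAt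
      (fun x : ℝ => ∑ j ∈ Finset.range h, coeffB N h j / coeffU N h j * x ^ (N - h + 1 + j))
      (h * N.choose h * x ^ (N - h) * (1 - x) ^ (h - 1)) x := by
    intro x
    have := HasDerivAt.fun_sum (u := Finset.range h) fun j _ =>
      ((hasDerivAt_id x).pow (N - h + 1 + j)).const_mul (coeffB N h j / coeffU N h j)
    refine this.congr_deriv ?_
    have : (h * N.choose h * x ^ (N - h) * (1 - x) ^ (h - 1) : ℝ)
        = x ^ (N - h) * (h * N.choose h * (1 - x) ^ (h - 1)) := by ring
    rw [this, ← sum_coeffB_mul_pow h1, Finset.mul_sum]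
    refine Finset.sum_congr rfl fun j _ => ?_
    have hU := (coeffU_pos hN j).ne'
    have e : N - h + 1 + j - 1 = N - h + j := by omega
    rw [← coeffU_eq hN, e, pow_add]
    simp only [id]
    field_simp
  -- Both sides have the same derivative, once `(1 - x) ^ (h - 1)` is expanded, and both vanish at 0
  -- since only positive powers of `x` occur.
  have hd : ∀ x : ℝ, HasDerivAt _ _ x := fun x => (hasDerivAt_binomial_tail hN x).sub (hR x)
  have hconst := is_const_of_deriv_eq_zero (fun x => (hd x).differentiableAt)
    (fun x => by rw [(hd x).deriv, sub_self]) x 0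
  have hz : ∀ i ∈ Finset.range h, (N.choose i : ℝ) * ((1 - 0) ^ i * 0 ^ (N - i)) = 0 := by
    intro i hi
    have : N - i ≠ 0 := by have := Finset.mem_range.1 hi; omega
    simp [zero_pow this]
  have hz' : ∀ j ∈ Finset.range h, coeffB N h j / coeffU N h j * (0 : ℝ) ^ (N - h + 1 + j) = 0 := by
    intro j _
    simp
  simp only [Pi.sub_apply] at hconst
  rw [Finset.sum_eq_zero hz, Finset.sum_eq_zero hz', sub_zero] at hconst
  linarith

/-! ### Distributions on a half-line with a smooth tail -/

section Tail

variable {c : ℝ} {g G : ℝ → ℝ}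

/-- Since `g` is nonnegative beyond `c`, convergence of the primitive `-G` at infinity already
forces integrability; nothing else has to be checked about `g`. -/
theorem integrableOn_of_tail (hG : ∀ t, HasDerivAt G (-g t) t) (hg : ∀ t, c < t → 0 ≤ g t)
    (hlim : Tendsto G atTop (𝓝 0)) : IntegrableOn g (Set.Ioi c) := by
  refine integrableOn_Ioi_deriv_of_nonneg' (g := fun t => -G t) (l := 0)
    (fun t _ => by simpa only [neg_neg] using (hG t).fun_neg) (fun t ht => hg t ht) (by simpa
        using hlim.neg)

theorem integral_Ioi_of_tail (hG : ∀ t, HasDerivAt G (-g t) t) (hg : ∀ t, c < t → 0 ≤ g t)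
    (hlim : Tendsto G atTop (𝓝 0)) {t : ℝ} (ht : c ≤ t) : ∫ s in Set.Ioi t, g s = G t := by
  have := integral_Ioi_of_hasDerivAt_of_nonneg' (a := t) (g := fun t => -G t) (g' := g) (l := 0)
    (fun t _ => by simpa only [neg_neg] using (hG t).fun_neg) (fun s hs => hg s (ht.trans_lt hs))
    (by simpa using hlim.neg)
  simpa using this

theorem integral_truncated_of_tail (hG : ∀ t, HasDerivAt G (-g t) t) (hg : ∀ t, c < t → 0 ≤ g t)
    (hlim : Tendsto G atTop (𝓝 0)) {TD : EReal} (hTD : (c : EReal) < TD) :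
    ∫ s in Set.Ioi c ∩ {s | ((s : ℝ) : EReal) < TD}, g s
      = G c - if TD = ⊤ then 0 else G TD.toReal := by
  induction TD with
  | bot => simp at hTD
  | top => simpa [EReal.coe_lt_top] using integral_Ioi_of_tail hG hg hlim le_rfl
  | coe D =>
    have hcD : c < D := by exact_mod_cast hTD
    have h1 : Set.Ioi c ∩ {s | ((s : ℝ) : EReal) < (D : EReal)} = Set.Ioi c \ Set.Ici D := by
      ext s; simp
    have hint := integrableOn_of_tail hG hg hlim
    rw [h1, setIntegral_sdiff measurableSet_Ici hint (Set.Ici_subset_Ioi.2 hcD),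
      integral_Ici_eq_integral_Ioi, integral_Ioi_of_tail hG hg hlim le_rfl,
      integral_Ioi_of_tail hG hg hlim hcD.le]
    simp

theorem lintegral_Ioi_of_tail (hG : ∀ t, HasDerivAt G (-g t) t) (hg : ∀ t, c < t → 0 ≤ g t)
    (hlim : Tendsto G atTop (𝓝 0)) {t : ℝ} (ht : c ≤ t) :
    (volume.withDensity fun s => ENNReal.ofReal (if c < s then g s else 0)) (Set.Ioi t)
      = ENNReal.ofReal (G t) := by
  rw [withDensity_apply _ measurableSet_Ioi,
    setLIntegral_congr_fun (g := fun s => ENNReal.ofReal (g s)) measurableSet_Ioi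
      (fun s hs => by simp [ht.trans_lt hs]),
    ← ofReal_integral_eq_lintegral_ofReal, integral_Ioi_of_tail hG hg hlim ht]
  · exact (integrableOn_of_tail hG hg hlim).mono_set (Set.Ioi_subset_Ioi ht)
  · exact (ae_restrict_iff' measurableSet_Ioi).2 (ae_of_all _ fun s hs => hg s (ht.trans_lt hs))

theorem withDensity_Iic_eq_zero (c : ℝ) (g : ℝ → ℝ) :
    (volume.withDensity fun s => ENNReal.ofReal (if c < s then g s else 0)) (Set.Iic c) = 0 := by
  rw [withDensity_apply _ measurableSet_Iic,
    setLIntegral_congr_fun (g := fun _ => 0) measurableSet_Iic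
      (fun s hs => by simp [not_lt.2 (Set.mem_Iic.1 hs)])]
  simp

theorem isProbabilityMeasure_of_tail (hG : ∀ t, HasDerivAt G (-g t) t)
    (hg : ∀ t, c < t → 0 ≤ g t) (hlim : Tendsto G atTop (𝓝 0)) (hc : G c = 1) :
    IsProbabilityMeasure
      (volume.withDensity fun s => ENNReal.ofReal (if c < s then g s else 0)) := by
  constructor
  rw [← Set.Iic_union_Ioi (a := c), measure_union (Set.Iic_disjoint_Ioi le_rfl) measurableSet_Ioi,
    withDensity_Iic_eq_zero, lintegral_Ioi_of_tail hG hg hlim le_rfl, hc]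
  simp

/-- A probability measure with a smooth tail has minus the derivative of the tail as density. -/
theorem eq_withDensity_of_tail (hG : ∀ t, HasDerivAt G (-g t) t) (hg : ∀ t, c < t → 0 ≤ g t)
    (hlim : Tendsto G atTop (𝓝 0)) (hc : G c = 1) (ν : Measure ℝ) [IsProbabilityMeasure ν]
    (hν : ∀ t, c ≤ t → ν (Set.Ioi t) = ENNReal.ofReal (G t)) :
    ν = volume.withDensity fun s => ENNReal.ofReal (if c < s then g s else 0) := by
  have := isProbabilityMeasure_of_tail hG hg hlim hc
  have key : ∀ t, ν (Set.Ioi t)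
      = (volume.withDensity fun s => ENNReal.ofReal (if c < s then g s else 0)) (Set.Ioi t) := by
    intro t
    rcases le_total c t with ht | ht
    · rw [hν t ht, lintegral_Ioi_of_tail hG hg hlim ht]
    -- Below `c` the tail `G` says nothing, but both measures already put full mass on `(c, ∞)`.
    · have h1 : ∀ ν' : Measure ℝ, IsProbabilityMeasure ν' → ν' (Set.Ioi c) = 1 →
          ν' (Set.Ioi t) = 1 := fun ν' _ h =>
        le_antisymm prob_le_one (h ▸ measure_mono (Set.Ioi_subset_Ioi ht))
      rw [h1 ν inferInstance (by rw [hν c le_rfl, hc, ENNReal.ofReal_one]),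
        h1 _ this (by rw [lintegral_Ioi_of_tail hG hg hlim le_rfl, hc, ENNReal.ofReal_one])]
  refine Measure.ext_of_Iic _ _ fun t => ?_
  rw [← Set.compl_Ioi, prob_compl_eq_one_sub measurableSet_Ioi,
    prob_compl_eq_one_sub measurableSet_Ioi, key]

theorem setIntegral_withDensity_half_line (hgm : Measurable g) (hg : ∀ t, c < t → 0 ≤ g t)
    (f : ℝ → ℝ) {s : Set ℝ} (hs : MeasurableSet s) :
    ∫ t in s, f t ∂(volume.withDensity fun s => ENNReal.ofReal (if c < s then g s else 0))
      = ∫ t in Set.Ioi c ∩ s, g t * f t := by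
  have hm : Measurable fun t => ENNReal.ofReal (if c < t then g t else 0) :=
    (Measurable.ite measurableSet_Ioi hgm measurable_const).ennreal_ofReal
  rw [setIntegral_withDensity_eq_setIntegral_toReal_smul hm (ae_of_all _ (by simp)) _ hs,
    Set.inter_comm, ← setIntegral_indicator measurableSet_Ioi]
  refine integral_congr_ae (ae_of_all _ fun t => ?_)
  by_cases h : c < t
  · simp [h, hg t h]
  · simp [h]

theorem integrable_withDensity_half_line (hgm : Measurable g) (hg : ∀ t, c < t → 0 ≤ g t)
    {f : ℝ → ℝ} (hf : IntegrableOn (fun t => g t * f t) (Set.Ioi c)) :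
    Integrable f (volume.withDensity fun s => ENNReal.ofReal (if c < s then g s else 0)) := by
  have hm : Measurable fun t => ENNReal.ofReal (if c < t then g t else 0) :=
    (Measurable.ite measurableSet_Ioi hgm measurable_const).ennreal_ofReal
  rw [integrable_withDensity_iff_integrable_smul' hm (ae_of_all _ (by simp))]
  refine (integrable_indicator_iff measurableSet_Ioi).2 hf |>.congr (ae_of_all _ fun t => ?_)
  by_cases h : c < t
  · simp [h, hg t h]
  · simp [h]

end Tail

/-! ### The shifted exponential distribution -/

theorem tendsto_pow_mul_exp_neg_mul {a : ℝ} (ha : 0 < a) (c : ℝ) (k : ℕ) :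
    Tendsto (fun t : ℝ => t ^ k * Real.exp (-a * (t - c))) atTop (𝓝 0) := by
  have h := (Real.tendsto_pow_mul_exp_neg_atTop_nhds_zero k).comp
    (tendsto_id.const_mul_atTop ha)
  have h2 := h.mul_const (Real.exp (a * c) / a ^ k)
  rw [zero_mul] at h2
  refine h2.congr fun t => ?_
  have : Real.exp (-a * (t - c)) = Real.exp (-(a * t)) * Real.exp (a * c) := by
    rw [← Real.exp_add]; congr 1; ring
  simp only [Function.comp, id, this, mul_pow]
  field_simp

theorem hasDerivAt_exp_neg_mul (a c t : ℝ) :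
    HasDerivAt (fun t : ℝ => Real.exp (-a * (t - c))) (-a * Real.exp (-a * (t - c))) t := by
  have := (((hasDerivAt_id t).sub_const c).const_mul (-a)).exp
  simpa [mul_comm] using this

section

variable {lam c : ℝ}

theorem shiftedExp_Ioi (hlam : 0 < lam) {t : ℝ} (ht : c ≤ t) :
    shiftedExp lam c (Set.Ioi t) = ENNReal.ofReal (Real.exp (-lam * (t - c))) :=
  lintegral_Ioi_of_tail (g := fun t => lam * Real.exp (-lam * (t - c)))
    (G := fun t => Real.exp (-lam * (t - c)))
    (fun t => by simpa using hasDerivAt_exp_neg_mul lam c t)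
    (fun t _ => by positivity) (by simpa using tendsto_pow_mul_exp_neg_mul hlam c 0) ht

theorem isProbabilityMeasure_shiftedExp (hlam : 0 < lam) :
    IsProbabilityMeasure (shiftedExp lam c) :=
  isProbabilityMeasure_of_tail (G := fun t => Real.exp (-lam * (t - c)))
    
    (fun t => by simpa using hasDerivAt_exp_neg_mul lam c t)
    (fun t _ => by positivity) (by simpa using tendsto_pow_mul_exp_neg_mul hlam c 0) (by simp)

instance nullSingletonClass_shiftedExp : NullSingletonClass (shiftedExp lam c) := by
  unfold shiftedExp; infer_instance

theorem shiftedExp_Iic_eq_zero : shiftedExp lam c (Set.Iic c) = 0 :=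
  withDensity_Iic_eq_zero c _

theorem shiftedExp_Iic (hlam : 0 < lam) {t : ℝ} (ht : c ≤ t) :
    shiftedExp lam c (Set.Iic t) = ENNReal.ofReal (1 - Real.exp (-lam * (t - c))) := by
  have := isProbabilityMeasure_shiftedExp (c := c) hlam
  rw [← Set.compl_Ioi, prob_compl_eq_one_sub measurableSet_Ioi, shiftedExp_Ioi hlam ht,
    ENNReal.ofReal_sub _ (Real.exp_nonneg _), ENNReal.ofReal_one]

end

/-! ### The distribution of the order statistics -/

/-- The joint distribution of the service times of one update at the devices. -/
def serviceLaw (N : ℕ) (lam c : ℝ) : Measure (Fin N → ℝ) :=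
  Measure.pi fun _ => shiftedExp lam c

/-- The tail of the distribution of the `h`-th smallest of `N` service times. -/
def orderTail (N : ℕ) (lam c : ℝ) (h : ℕ) (t : ℝ) : ℝ :=
  ∑ j ∈ Finset.range h, coeffB N h j / coeffU N h j * Real.exp (-(lam * coeffU N h j) * (t - c))

/-- The density of the `h`-th smallest of `N` service times on `(c, ∞)`. -/
def orderDensity (N : ℕ) (lam c : ℝ) (h : ℕ) (t : ℝ) : ℝ :=
  ∑ j ∈ Finset.range h, coeffB N h j * lam * Real.exp (-(lam * coeffU N h j) * (t - c))

section

variable {N h : ℕ} {lam c : ℝ}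

theorem exp_coeffU (hN : h ≤ N) (j : ℕ) (t : ℝ) :
    Real.exp (-(lam * coeffU N h j) * (t - c))
      = Real.exp (-lam * (t - c)) ^ (N - h + 1 + j) := by
  rw [← Real.exp_nat_mul, ← coeffU_eq hN]; congr 1; ring

theorem hasDerivAt_orderTail (hN : h ≤ N) (t : ℝ) :
    HasDerivAt (orderTail N lam c h) (-orderDensity N lam c h t) t := by
  have := HasDerivAt.fun_sum (u := Finset.range h) fun j _ =>
    (hasDerivAt_exp_neg_mul (lam * coeffU N h j) c t).const_mul (coeffB N h j / coeffU N h j)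
  refine this.congr_deriv ?_
  rw [orderDensity, ← Finset.sum_neg_distrib]
  refine Finset.sum_congr rfl fun j _ => ?_
  have := (coeffU_pos hN j).ne'
  field_simp

theorem orderDensity_nonneg (h1 : 1 ≤ h) (hN : h ≤ N) (hlam : 0 < lam) {t : ℝ} (ht : c < t) :
    0 ≤ orderDensity N lam c h t := by
  have hx : Real.exp (-lam * (t - c)) ≤ 1 := by
    rw [Real.exp_le_one_iff]; nlinarith
  have : orderDensity N lam c h t = lam * Real.exp (-lam * (t - c)) ^ (N - h + 1) *
      (h * N.choose h * (1 - Real.exp (-lam * (t - c))) ^ (h - 1)) := by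
    rw [← sum_coeffB_mul_pow h1, Finset.mul_sum, orderDensity]
    refine Finset.sum_congr rfl fun j _ => ?_
    rw [exp_coeffU hN, pow_add]; ring
  rw [this]
  have : 0 ≤ 1 - Real.exp (-lam * (t - c)) := by linarith
  positivity

theorem measurable_orderDensity : Measurable (orderDensity N lam c h) := by
  unfold orderDensity; fun_prop

theorem tendsto_orderTail (hN : h ≤ N) (hlam : 0 < lam) :
    Tendsto (orderTail N lam c h) atTop (𝓝 0) := by
  have := tendsto_finsetSum (Finset.range h) fun j _ =>
    (tendsto_pow_mul_exp_neg_mul (mul_pos hlam (coeffU_pos hN j)) c 0).const_mul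
      (coeffB N h j / coeffU N h j)
  simp only [mul_zero, Finset.sum_const_zero, pow_zero, one_mul] at this
  exact this

/-- The binomial form is the one that counting devices produces; the exponential form in `orderTail`
is the one that can be integrated term by term. -/
theorem orderTail_eq_binomial (h1 : 1 ≤ h) (hN : h ≤ N) (t : ℝ) :
    orderTail N lam c h t = ∑ i ∈ Finset.range h,
      (N.choose i : ℝ) * ((1 - Real.exp (-lam * (t - c))) ^ i
        * Real.exp (-lam * (t - c)) ^ (N - i)) := by
  rw [binomial_tail_eq h1 hN, orderTail]
  exact Finset.sum_congr rfl fun j _ => by rw [exp_coeffU hN]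

/-- At `t = c` the failure probability is 1, so in the binomial form only the term `i = 0` survives.
-/
theorem orderTail_self (h1 : 1 ≤ h) (hN : h ≤ N) : orderTail N lam c h c = 1 := by
  rw [orderTail_eq_binomial h1 hN]
  obtain ⟨k, rfl⟩ := Nat.exists_eq_add_of_le' h1
  rw [Finset.sum_range_succ']
  simp

theorem isProbabilityMeasure_serviceLaw (hlam : 0 < lam) :
    IsProbabilityMeasure (serviceLaw N lam c) := by
  have := isProbabilityMeasure_shiftedExp (c := c) hlam
  unfold serviceLaw; infer_instance

/-- Prescribing exactly which devices have finished by time `t` describes a box, whose product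
measure is a product of one-dimensional masses. -/
theorem serviceLaw_filter_eq (hlam : 0 < lam) {t : ℝ} (ht : c ≤ t) (A : Finset (Fin N)) :
    serviceLaw N lam c {y | (Finset.univ.filter fun m => y m ≤ t) = A}
      = ENNReal.ofReal ((1 - Real.exp (-lam * (t - c))) ^ A.card
        * Real.exp (-lam * (t - c)) ^ (N - A.card)) := by
  have := isProbabilityMeasure_shiftedExp (c := c) hlam
  have hset : {y : Fin N → ℝ | (Finset.univ.filter fun m => y m ≤ t) = A}
      = Set.univ.pi fun m => if m ∈ A then Set.Iic t else Set.Ioi t := by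
    ext y
    simp only [Set.mem_ofPred_eq, Finset.ext_iff, Finset.mem_filter, Finset.mem_univ, true_and,
      Set.mem_pi, Set.mem_univ, true_implies]
    refine forall_congr' fun m => ?_
    by_cases hm : m ∈ A <;> simp [hm]
  have hx : Real.exp (-lam * (t - c)) ≤ 1 := by
    rw [Real.exp_le_one_iff]; nlinarith
  have hx' : 0 ≤ 1 - Real.exp (-lam * (t - c)) := by linarith
  rw [hset, serviceLaw, Measure.pi_pi]
  have : ∀ m : Fin N, shiftedExp lam c (if m ∈ A then Set.Iic t else Set.Ioi t)
      = if m ∈ A then ENNReal.ofReal (1 - Real.exp (-lam * (t - c)))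
        else ENNReal.ofReal (Real.exp (-lam * (t - c))) := by
    intro m
    split_ifs
    · exact shiftedExp_Iic hlam ht
    · exact shiftedExp_Ioi hlam ht
  simp only [this]
  rw [Finset.prod_ite, Finset.prod_const, Finset.prod_const,
    Finset.filter_mem_eq_inter, Finset.univ_inter, Finset.filter_notMem_eq_sdiff,
    ← Finset.compl_eq_univ_sdiff, Finset.card_compl, Fintype.card_fin,
    ENNReal.ofReal_mul (by positivity), ENNReal.ofReal_pow hx',
    ENNReal.ofReal_pow (Real.exp_nonneg _)]

/-- The `h`-th smallest value exceeds `t` exactly when fewer than `h` devices have finished; the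
event splits disjointly over the set `A` of finished devices. -/
theorem serviceLaw_orderStat_gt (h1 : 1 ≤ h) (hN : h ≤ N) (hlam : 0 < lam) {t : ℝ}
    (ht : c ≤ t) :
    serviceLaw N lam c {y | t < orderStat h y} = ENNReal.ofReal (orderTail N lam c h t) := by
  have hx : Real.exp (-lam * (t - c)) ≤ 1 := by
    rw [Real.exp_le_one_iff]; nlinarith
  have hx' : 0 ≤ 1 - Real.exp (-lam * (t - c)) := by linarith
  have hset : {y : Fin N → ℝ | t < orderStat h y}
      = ⋃ A ∈ (Finset.univ.filter fun A : Finset (Fin N) => A.card < h),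
          {y | (Finset.univ.filter fun m => y m ≤ t) = A} := by
    ext y
    simp only [Set.mem_ofPred_eq, Set.mem_iUnion, Finset.mem_filter, Finset.mem_univ, true_and,
      exists_prop]
    rw [← not_le, orderStat_le_iff h1 hN, not_le]
    simp
  have hmeas : ∀ A : Finset (Fin N),
      MeasurableSet {y : Fin N → ℝ | (Finset.univ.filter fun m => y m ≤ t) = A} := by
    intro A
    simp only [Finset.ext_iff, Finset.mem_filter, Finset.mem_univ, true_and]
    rw [Set.ofPred_forall]
    refine MeasurableSet.iInter fun m => ?_
    by_cases hm : m ∈ A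
    · simpa [hm] using measurableSet_le (measurable_pi_apply m) measurable_const
    · simpa [hm] using measurableSet_lt measurable_const (measurable_pi_apply m)
  rw [hset, measure_biUnion_finset _ fun A _ => hmeas A]
  · simp only [serviceLaw_filter_eq hlam ht]
    rw [← ENNReal.ofReal_sum_of_nonneg fun A _ => by positivity]
    congr 1
    -- The mass of a box depends only on the cardinality of `A`; grouping by cardinality creates the
    -- binomial coefficients.
    have := Finset.sum_powerset_apply_card (fun i => if i < h then
      (1 - Real.exp (-lam * (t - c))) ^ i * Real.exp (-lam * (t - c)) ^ (N - i) else 0)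
      (x := (Finset.univ : Finset (Fin N)))
    rw [Finset.powerset_univ] at this
    rw [Finset.sum_filter, this, orderTail_eq_binomial h1 hN, Finset.card_univ, Fintype.card_fin]
    simp only [nsmul_eq_mul, mul_ite, mul_zero]
    rw [← Finset.sum_filter]
    refine Finset.sum_congr ?_ fun _ _ => rfl
    ext i; simp; omega
  · intro A _ A' _ hAA'
    refine Set.disjoint_left.2 fun y hy hy' => hAA' ?_
    exact hy.symm.trans hy'

/-- The distribution of the `h`-th smallest service time. -/
theorem map_orderStat (h1 : 1 ≤ h) (hN : h ≤ N) (hlam : 0 < lam) :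
    (serviceLaw N lam c).map (orderStat h)
      = volume.withDensity fun s =>
          ENNReal.ofReal (if c < s then orderDensity N lam c h s else 0) := by
  have := isProbabilityMeasure_serviceLaw (N := N) (c := c) hlam
  have hm := measurable_orderStat h1 hN
  have := Measure.isProbabilityMeasure_map (μ := serviceLaw N lam c) hm.aemeasurable
  refine eq_withDensity_of_tail (G := orderTail N lam c h) (hasDerivAt_orderTail hN)
    (fun t => orderDensity_nonneg h1 hN hlam) (tendsto_orderTail hN hlam) (orderTail_self h1 hN)
    _ fun t ht => ?_
  rw [Measure.map_apply hm measurableSet_Ioi, ← serviceLaw_orderStat_gt h1 hN hlam ht]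
  rfl

/-! ### Truncated moments of the order statistics -/

theorem integrableOn_pow_mul_exp {a : ℝ} (ha : 0 < a) (c : ℝ) (k : ℕ) :
    IntegrableOn (fun t : ℝ => t ^ k * Real.exp (-a * (t - c))) (Set.Ioi c) := by
  refine integrable_of_isBigO_exp_neg (b := a / 2) (by positivity) (by fun_prop) ?_
  -- Half of the exponent absorbs the power and the other half gives the integrable bound; the
  -- centre becomes `2 * c` because the bounding exponential is left uncentred.
  have h := tendsto_pow_mul_exp_neg_mul (half_pos ha) (2 * c) k
  refine Asymptotics.IsBigO.of_bound 1 ?_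
  filter_upwards [h.norm.eventually_lt_const (u := 1) (by simp)] with t ht
  have : t ^ k * Real.exp (-a * (t - c))
      = (t ^ k * Real.exp (-(a / 2) * (t - 2 * c))) * Real.exp (-(a / 2) * t) := by
    rw [mul_assoc, ← Real.exp_add]; congr 2; ring
  rw [this, norm_mul]
  exact mul_le_mul_of_nonneg_right ht.le (norm_nonneg _)

theorem decay_eq (lam c : ℝ) (TD : EReal) (u : ℝ) : decay lam c TD u
    = if TD = ⊤ then 0 else Real.exp (-(lam * u) * (TD.toReal - c)) := by
  unfold decay; congr 2; ring

theorem integral_pow_one_mul_exp {u : ℝ} (hlam : 0 < lam) (hu : 0 < u) (hc : 0 < c) {TD : EReal}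
    (hTD : (c : EReal) < TD) :
    ∫ t in Set.Ioi c ∩ {t | ((t : ℝ) : EReal) < TD}, t ^ 1 * Real.exp (-(lam * u) * (t - c))
      = (1 + c * lam * u - (1 + TD.toReal * lam * u) * decay lam c TD u) / (lam * u) ^ 2 := by
  have ha := mul_pos hlam hu
  set a := lam * u with had
  -- The primitive comes from one integration by parts.
  have hG : ∀ t : ℝ, HasDerivAt (fun t : ℝ => (1 + t * a) / a ^ 2 * Real.exp (-a * (t - c)))
      (-(t ^ 1 * Real.exp (-a * (t - c)))) t := by
    intro t
    have h1 : HasDerivAt (fun t : ℝ => (1 + t * a) / a ^ 2) (a / a ^ 2) t := by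
      simpa using (((hasDerivAt_id t).mul_const a).const_add 1).div_const (a ^ 2)
    refine (h1.mul (hasDerivAt_exp_neg_mul a c t)).congr_deriv ?_
    field_simp
    ring
  have hlim : Tendsto (fun t : ℝ => (1 + t * a) / a ^ 2 * Real.exp (-a * (t - c))) atTop (𝓝 0) := by
    have := ((tendsto_pow_mul_exp_neg_mul ha c 0).add
      ((tendsto_pow_mul_exp_neg_mul ha c 1).const_mul a)).const_mul (1 / a ^ 2)
    simp only [mul_zero, add_zero] at this
    exact this.congr fun t => by ring
  -- Positivity of `c` makes the integrand nonnegative on `(c, ∞)`, as the tail lemma requires.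
  rw [integral_truncated_of_tail hG (fun t ht => by have := hc.trans ht; positivity) hlim hTD,
    decay_eq]
  split_ifs
  · simp [had]; ring
  · simp [← had]; rw [mul_assoc, mul_assoc, ← had]; ring

theorem integral_pow_two_mul_exp {u : ℝ} (hlam : 0 < lam) (hu : 0 < u) (hc : 0 < c) {TD : EReal}
    (hTD : (c : EReal) < TD) :
    ∫ t in Set.Ioi c ∩ {t | ((t : ℝ) : EReal) < TD}, t ^ 2 * Real.exp (-(lam * u) * (t - c))
      = ((1 + c * lam * u) ^ 2 + 1 - ((1 + TD.toReal * lam * u) ^ 2 + 1) * decay lam c TD u)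
        / (lam * u) ^ 3 := by
  have ha := mul_pos hlam hu
  set a := lam * u with had
  -- Two integrations by parts give `t²/a + 2t/a² + 2/a³`, which is the fraction below.
  have hG : ∀ t : ℝ, HasDerivAt
      (fun t : ℝ => ((1 + t * a) ^ 2 + 1) / a ^ 3 * Real.exp (-a * (t - c)))
      (-(t ^ 2 * Real.exp (-a * (t - c)))) t := by
    intro t
    have h1 : HasDerivAt (fun t : ℝ => ((1 + t * a) ^ 2 + 1) / a ^ 3)
        (2 * (1 + t * a) * a / a ^ 3) t := by
      simpa using (((((hasDerivAt_id t).mul_const a).const_add 1).pow 2).add_const 1).div_const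
        (a ^ 3)
    refine (h1.mul (hasDerivAt_exp_neg_mul a c t)).congr_deriv ?_
    field_simp
    ring
  have hlim : Tendsto (fun t : ℝ => ((1 + t * a) ^ 2 + 1) / a ^ 3 * Real.exp (-a * (t - c)))
      atTop (𝓝 0) := by
    have := ((((tendsto_pow_mul_exp_neg_mul ha c 0).const_mul 2).add
      ((tendsto_pow_mul_exp_neg_mul ha c 1).const_mul (2 * a))).add
      ((tendsto_pow_mul_exp_neg_mul ha c 2).const_mul (a ^ 2))).const_mul (1 / a ^ 3)
    simp only [mul_zero, add_zero] at this
    exact this.congr fun t => by ring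
  rw [integral_truncated_of_tail hG (fun t ht => by have := hc.trans ht; positivity) hlim hTD,
    decay_eq]
  split_ifs
  · simp [had]; ring
  · simp [← had]; rw [mul_assoc, mul_assoc, ← had]; ring

theorem integrableOn_orderDensity_mul_pow (hN : h ≤ N) (hlam : 0 < lam) (k : ℕ) :
    IntegrableOn (fun t => orderDensity N lam c h t * t ^ k) (Set.Ioi c) := by
  have := integrable_finsetSum (Finset.range h) fun j _ =>
    (integrableOn_pow_mul_exp (mul_pos hlam (coeffU_pos hN j)) c k).const_mul (coeffB N h j * lam)
  refine this.congr (ae_of_all _ fun t => ?_)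
  simp only [orderDensity, Finset.sum_mul]
  exact Finset.sum_congr rfl fun j _ => by ring

theorem integrable_orderStat_pow (h1 : 1 ≤ h) (hN : h ≤ N) (hlam : 0 < lam) (k : ℕ) :
    Integrable (fun y => orderStat h y ^ k) (serviceLaw N lam c) := by
  have hm := measurable_orderStat h1 hN
  have : Integrable (fun t : ℝ => t ^ k) ((serviceLaw N lam c).map (orderStat h)) := by
    rw [map_orderStat h1 hN hlam]
    exact integrable_withDensity_half_line measurable_orderDensity
      (fun t => orderDensity_nonneg h1 hN hlam) (integrableOn_orderDensity_mul_pow hN hlam k)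
  exact this.comp_measurable hm

theorem memLp_orderStat (h1 : 1 ≤ h) (hN : h ≤ N) (hlam : 0 < lam) :
    MemLp (orderStat h) 2 (serviceLaw N lam c) :=
  (memLp_two_iff_integrable_sq (measurable_orderStat h1 hN).aestronglyMeasurable).2
    (integrable_orderStat_pow h1 hN hlam 2)

theorem measurableSet_coe_lt (TD : EReal) : MeasurableSet {t : ℝ | ((t : ℝ) : EReal) < TD} :=
  measurableSet_lt measurable_coe_real_ereal measurable_const

/-- After passing to the image law, the density is a finite combination of exponentials and the
moment splits into integrals with a single exponential. -/
theorem setIntegral_orderStat_pow (h1 : 1 ≤ h) (hN : h ≤ N) (hlam : 0 < lam) (k : ℕ)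
    (TD : EReal) :
    ∫ y in {y | ((orderStat h y : ℝ) : EReal) < TD}, orderStat h y ^ k ∂(serviceLaw N lam c)
      = ∑ j ∈ Finset.range h, coeffB N h j * lam *
        ∫ t in Set.Ioi c ∩ {t | ((t : ℝ) : EReal) < TD},
          t ^ k * Real.exp (-(lam * coeffU N h j) * (t - c)) := by
  have hm := measurable_orderStat h1 hN
  have hs := measurableSet_coe_lt TD
  have h3 := setIntegral_map (μ := serviceLaw N lam c) hs (g := orderStat h)
    (f := fun t : ℝ => t ^ k) (by fun_prop) hm.aemeasurable
  rw [map_orderStat h1 hN hlam, setIntegral_withDensity_half_line measurable_orderDensity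
      (fun t => orderDensity_nonneg h1 hN hlam) _ hs] at h3
  refine h3.symm.trans ?_
  simp only [← integral_const_mul]
  rw [← integral_finsetSum]
  · refine integral_congr_ae (ae_of_all _ fun t => ?_)
    simp only [orderDensity, Finset.sum_mul]
    exact Finset.sum_congr rfl fun j _ => by ring
  · intro j _
    exact ((integrableOn_pow_mul_exp (mul_pos hlam (coeffU_pos hN j)) c k).mono_set
      Set.inter_subset_left).const_mul _

theorem setIntegral_orderStat (h1 : 1 ≤ h) (hN : h ≤ N) (hlam : 0 < lam) (hc : 0 < c)
    {TD : EReal} (hTD : (c : EReal) < TD) :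
    ∫ y in {y | ((orderStat h y : ℝ) : EReal) < TD}, orderStat h y ∂(serviceLaw N lam c)
      = ∑ j ∈ Finset.range h, coeffB N h j / (lam * coeffU N h j ^ 2) *
      (1 + c * lam * coeffU N h j
        - (1 + TD.toReal * lam * coeffU N h j) * coeffV N lam c TD h j) := by
  have := setIntegral_orderStat_pow (c := c) h1 hN hlam 1 TD
  simp only [pow_one] at this
  rw [this]
  refine Finset.sum_congr rfl fun j _ => ?_
  have hU := coeffU_pos hN j
  have h2 := integral_pow_one_mul_exp hlam hU hc hTD
  simp only [pow_one] at h2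
  rw [h2, coeffV]
  field_simp

theorem setIntegral_orderStat_sq (h1 : 1 ≤ h) (hN : h ≤ N) (hlam : 0 < lam) (hc : 0 < c)
    {TD : EReal} (hTD : (c : EReal) < TD) :
    ∫ y in {y | ((orderStat h y : ℝ) : EReal) < TD}, orderStat h y ^ 2 ∂(serviceLaw N lam c)
      = ∑ j ∈ Finset.range h, coeffB N h j / (lam ^ 2 * coeffU N h j ^ 3) *
      ((1 + c * lam * coeffU N h j) ^ 2 + 1
        - ((1 + TD.toReal * lam * coeffU N h j) ^ 2 + 1) * coeffV N lam c TD h j) := by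
  rw [setIntegral_orderStat_pow (c := c) h1 hN hlam 2 TD]
  refine Finset.sum_congr rfl fun j _ => ?_
  have hU := coeffU_pos hN j
  rw [integral_pow_two_mul_exp hlam hU hc hTD, coeffV]
  field_simp

theorem serviceLaw_real_lt_orderStat (h1 : 1 ≤ h) (hN : h ≤ N) (hlam : 0 < lam)
    {TD : EReal} (hTD : (c : EReal) < TD) :
    (serviceLaw N lam c).real {y | TD < ((orderStat h y : ℝ) : EReal)} = coeffZ N lam c TD h := by
  induction TD with
  | bot => simp at hTD
  | top => simp [coeffZ, coeffV, decay]
  | coe D =>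
    have hcD : c ≤ D := le_of_lt (by exact_mod_cast hTD)
    -- For a finite deadline `coeffZ` is the exponential form of the tail, evaluated at the
    -- deadline.
    have hZ : coeffZ N lam c D h = orderTail N lam c h D := by
      unfold coeffZ orderTail coeffV
      refine Finset.sum_congr rfl fun j _ => ?_
      rw [decay_eq]; simp; ring
    simp only [EReal.coe_lt_coe_iff]
    have h3 := serviceLaw_orderStat_gt h1 hN hlam hcD
    have h0 : 0 ≤ orderTail N lam c h D := by
      rw [← integral_Ioi_of_tail (hasDerivAt_orderTail hN)
        (fun t => orderDensity_nonneg h1 hN hlam) (tendsto_orderTail hN hlam) hcD]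
      exact setIntegral_nonneg measurableSet_Ioi fun t ht =>
        orderDensity_nonneg h1 hN hlam (hcD.trans_lt ht)
    rw [measureReal_def, h3, hZ, ENNReal.toReal_ofReal h0]

/-- The law has a density, hence no atom at a finite deadline. Strict and weak comparisons with the
deadline therefore become interchangeable. -/
theorem serviceLaw_orderStat_eq (h1 : 1 ≤ h) (hN : h ≤ N) (hlam : 0 < lam) (TD : EReal) :
    serviceLaw N lam c {y | ((orderStat h y : ℝ) : EReal) = TD} = 0 := by
  induction TD with
  | bot => simp
  | top => simp
  | coe D =>
    have : {y : Fin N → ℝ | ((orderStat h y : ℝ) : EReal) = (D : EReal)}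
        = orderStat h ⁻¹' {D} := by ext y; simp
    rw [this, ← Measure.map_apply (measurable_orderStat h1 hN) (measurableSet_singleton D),
      map_orderStat h1 hN hlam]
    simp

end

section

variable {N K : ℕ} {lam c : ℝ} {TD : EReal}

/-! ### Exchangeability of the devices -/

theorem measurePreserving_swap (hlam : 0 < lam) (n m : Fin N) :
    MeasurePreserving (MeasurableEquiv.piCongrLeft (fun _ : Fin N => ℝ) (Equiv.swap n m))
      (serviceLaw N lam c) (serviceLaw N lam c) := by
  have := isProbabilityMeasure_shiftedExp (c := c) hlam
  exact measurePreserving_piCongrLeft (fun _ : Fin N => shiftedExp lam c) (Equiv.swap n m)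

/-- A transposition is its own inverse, so the direction of the reindexing does not matter. -/
theorem piCongrLeft_swap_apply (n m : Fin N) (y : Fin N → ℝ) (i : Fin N) :
    MeasurableEquiv.piCongrLeft (fun _ : Fin N => ℝ) (Equiv.swap n m) y i
      = y (Equiv.swap n m i) := by
  have := Equiv.piCongrLeft_apply_apply (fun _ : Fin N => ℝ) (Equiv.swap n m) y (Equiv.swap n m i)
  rw [MeasurableEquiv.coe_piCongrLeft]
  simpa using this

theorem ae_lt_apply (hlam : 0 < lam) (N : ℕ) :
    ∀ᵐ y ∂(serviceLaw N lam c), ∀ m, c < y m := by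
  have := isProbabilityMeasure_shiftedExp (c := c) hlam
  rw [ae_all_iff]
  intro m
  have h : ∀ᵐ t ∂(shiftedExp lam c), c < t := by
    rw [ae_iff]
    simpa [Set.Iic] using shiftedExp_Iic_eq_zero (lam := lam) (c := c)
  exact (measurePreserving_eval (fun _ : Fin N => shiftedExp lam c) m).quasiMeasurePreserving.ae h

/-- Two distinct coordinates are independent with an atomless law, and the diagonal is null for the
product of such laws because each of its sections is a single point. -/
theorem ae_injective (hlam : 0 < lam) (N : ℕ) :
    ∀ᵐ y ∂(serviceLaw N lam c), Function.Injective y := by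
  have := isProbabilityMeasure_shiftedExp (c := c) hlam
  have h : ∀ m m' : Fin N, m ≠ m' → ∀ᵐ y ∂(serviceLaw N lam c), y m ≠ y m' := by
    intro m m' hm
    have hind := (ProbabilityTheory.iIndepFun_pi (μ := fun _ : Fin N => shiftedExp lam c)
      (X := fun _ t => t) fun _ => aemeasurable_id).indepFun hm
    rw [ProbabilityTheory.indepFun_iff_map_prod_eq_prod_map_map
      (measurable_pi_apply m).aemeasurable (measurable_pi_apply m').aemeasurable]
      at hind
    have he : ∀ i : Fin N, (Measure.pi fun _ : Fin N => shiftedExp lam c).map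
        (fun y => y i) = shiftedExp lam c := fun i =>
      (measurePreserving_eval (fun _ : Fin N => shiftedExp lam c) i).map_eq
    rw [he, he] at hind
    have hd : MeasurableSet {p : ℝ × ℝ | p.1 = p.2} := measurableSet_eq_fun measurable_fst
        measurable_snd
    have h0 : ((shiftedExp lam c).prod (shiftedExp lam c)) {p : ℝ × ℝ | p.1 = p.2} = 0 := by
      rw [Measure.measure_prod_null hd]
      refine ae_of_all _ fun x => ?_
      have : Prod.mk x ⁻¹' {p : ℝ × ℝ | p.1 = p.2} = {x} := by ext t; simp [eq_comm]
      simp [this]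
    rw [← hind, Measure.map_apply (by fun_prop) hd] at h0
    rw [ae_iff]
    simpa [serviceLaw] using h0
  have h2 : ∀ᵐ y ∂(serviceLaw N lam c), ∀ m m' : Fin N, m ≠ m' → y m ≠ y m' := by
    rw [ae_all_iff]; intro m
    rw [ae_all_iff]; intro m'
    by_cases hm : m = m'
    · simp [hm]
    · filter_upwards [h m m' hm] with y hy _ using hy
  filter_upwards [h2] with y hy m m' hmm'
  by_contra hne
  exact hy m m' hne hmm'

/-- By exchangeability, the service time of a device that is among the `K` fastest ones is
distributed like an order statistic with a random order. -/
theorem integral_le_orderStat (h1 : 1 ≤ K) (hN : K ≤ N) (hlam : 0 < lam) {g : ℝ → ℝ → ℝ}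
    (hgm : Measurable (Function.uncurry g))
    (hint : ∀ h, 1 ≤ h → h ≤ K →
      Integrable (fun y => g (orderStat h y) (orderStat K y)) (serviceLaw N lam c)) (n : Fin N) :
    Integrable (fun y => if y n ≤ orderStat K y then g (y n) (orderStat K y) else 0)
      (serviceLaw N lam c) ∧
    ∫ y, (if y n ≤ orderStat K y then g (y n) (orderStat K y) else 0) ∂(serviceLaw N lam c)
      = 1 / N * ∑ h ∈ Finset.Icc 1 K,
          ∫ y, g (orderStat h y) (orderStat K y) ∂(serviceLaw N lam c) := by
  have hoK := measurable_orderStat h1 hN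
  have hmeas : ∀ m : Fin N, Measurable fun y : Fin N → ℝ =>
      if y m ≤ orderStat K y then g (y m) (orderStat K y) else 0 := fun m =>
    Measurable.ite (measurableSet_le (measurable_pi_apply m) hoK)
      (hgm.comp ((measurable_pi_apply m).prodMk hoK)) measurable_const
  have hI : ∀ m : Fin N, Integrable
      (fun y => if y m ≤ orderStat K y then g (y m) (orderStat K y) else 0)
      (serviceLaw N lam c) := by
    intro m
    have hs := integrable_finsetSum (Finset.Icc 1 K) fun h hh =>
      (hint h (Finset.mem_Icc.1 hh).1 (Finset.mem_Icc.1 hh).2).norm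
    refine hs.mono' (hmeas m).aestronglyMeasurable ?_
    filter_upwards [ae_injective hlam N] with y hy
    -- The sum over the orders equals a sum of nonnegative terms over the devices, and the term of
    -- device `m` is one of them.
    rw [← sum_le_orderStat h1 hN hy fun t => ‖g t (orderStat K y)‖]
    have := Finset.single_le_sum (f := fun m =>
      if y m ≤ orderStat K y then ‖g (y m) (orderStat K y)‖ else 0)
      (fun i _ => by positivity) (Finset.mem_univ m)
    refine le_trans (le_of_eq ?_) this
    split_ifs <;> simp
  -- Exchanging devices `n` and `m` preserves the joint law and leaves every order statistic
  -- unchanged.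
  have hsymm : ∀ m : Fin N,
      ∫ y, (if y m ≤ orderStat K y then g (y m) (orderStat K y) else 0) ∂(serviceLaw N lam c)
      = ∫ y, (if y n ≤ orderStat K y then g (y n) (orderStat K y) else 0) ∂(serviceLaw N lam c) :=
          by
    intro m
    rw [← (measurePreserving_swap hlam n m).integral_comp']
    refine integral_congr_ae (ae_of_all _ fun y => ?_)
    have : MeasurableEquiv.piCongrLeft (fun _ : Fin N => ℝ) (Equiv.swap n m) y
        = fun i => y (Equiv.swap n m i) := funext (piCongrLeft_swap_apply n m y)
    simp [this, orderStat_comp_perm]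
  refine ⟨hI n, ?_⟩
  have hsum : ∑ m : Fin N,
      ∫ y, (if y m ≤ orderStat K y then g (y m) (orderStat K y) else 0) ∂(serviceLaw N lam c)
      = ∑ h ∈ Finset.Icc 1 K,
          ∫ y, g (orderStat h y) (orderStat K y) ∂(serviceLaw N lam c) := by
    rw [← integral_finsetSum _ fun m _ => hI m, ← integral_finsetSum _ fun h hh =>
      hint h (Finset.mem_Icc.1 hh).1 (Finset.mem_Icc.1 hh).2]
    refine integral_congr_ae ?_
    filter_upwards [ae_injective hlam N] with y hy
    exact sum_le_orderStat h1 hN hy fun t => g t (orderStat K y)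
  have hNpos : (0 : ℝ) < N := by exact_mod_cast lt_of_lt_of_le h1 hN
  rw [← hsum]
  simp only [hsymm, Finset.sum_const, Finset.card_univ, Fintype.card_fin, nsmul_eq_mul]
  field_simp

/-! ### The transmission of a single update: probabilities and moments -/

theorem measurableSet_lt_orderStat {h : ℕ} (h1 : 1 ≤ h) (hN : h ≤ N) (TD : EReal) :
    MeasurableSet {y : Fin N → ℝ | TD < ((orderStat h y : ℝ) : EReal)} :=
  measurableSet_lt measurable_const (measurable_coe_real_ereal.comp (measurable_orderStat h1 hN))

theorem measurableSet_orderStat_lt {h : ℕ} (h1 : 1 ≤ h) (hN : h ≤ N) (TD : EReal) :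
    MeasurableSet {y : Fin N → ℝ | ((orderStat h y : ℝ) : EReal) < TD} :=
  measurableSet_lt (measurable_coe_real_ereal.comp (measurable_orderStat h1 hN)) measurable_const

theorem measurableSet_orderStat_le {h : ℕ} (h1 : 1 ≤ h) (hN : h ≤ N) (TD : EReal) :
    MeasurableSet {y : Fin N → ℝ | ((orderStat h y : ℝ) : EReal) ≤ TD} :=
  measurableSet_le (measurable_coe_real_ereal.comp (measurable_orderStat h1 hN)) measurable_const

theorem measurableSet_received_lt (h1 : 1 ≤ K) (hN : K ≤ N) (TD : EReal) (n : Fin N) :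
    MeasurableSet {y | Received K TD n y ∧ ((orderStat K y : ℝ) : EReal) < TD} :=
  (measurableSet_received h1 hN TD n).inter (measurableSet_orderStat_lt h1 hN TD)

theorem measurableSet_received_gt (h1 : 1 ≤ K) (hN : K ≤ N) (TD : EReal) (n : Fin N) :
    MeasurableSet {y | Received K TD n y ∧ TD < ((orderStat K y : ℝ) : EReal)} :=
  (measurableSet_received h1 hN TD n).inter (measurableSet_lt_orderStat h1 hN TD)

theorem received_lt_subset (TD : EReal) (n : Fin N) :
    {y | Received K TD n y ∧ ((orderStat K y : ℝ) : EReal) < TD}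
      ⊆ {y | ((orderStat K y : ℝ) : EReal) < TD} := fun _ hy => hy.2

theorem received_gt_subset (TD : EReal) (n : Fin N) :
    {y | Received K TD n y ∧ TD < ((orderStat K y : ℝ) : EReal)}
      ⊆ {y | TD < ((orderStat K y : ℝ) : EReal)} := fun _ hy => hy.2

theorem real_orderStat_le {h : ℕ} (h1 : 1 ≤ h) (hN : h ≤ N) (hlam : 0 < lam)
    (hTD : (c : EReal) < TD) :
    (serviceLaw N lam c).real {y | ((orderStat h y : ℝ) : EReal) ≤ TD}
      = 1 - coeffZ N lam c TD h := by
  have := isProbabilityMeasure_serviceLaw (N := N) (c := c) hlam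
  rw [← serviceLaw_real_lt_orderStat h1 hN hlam hTD,
    ← probReal_compl_eq_one_sub (measurableSet_lt_orderStat h1 hN TD)]
  congr 1; ext y; simp

theorem orderStat_lt_ae_eq_le {h : ℕ} (h1 : 1 ≤ h) (hN : h ≤ N) (hlam : 0 < lam) (TD : EReal) :
    {y : Fin N → ℝ | ((orderStat h y : ℝ) : EReal) < TD} =ᵐ[serviceLaw N lam c]
      {y : Fin N → ℝ | ((orderStat h y : ℝ) : EReal) ≤ TD} := by
  have h0 := serviceLaw_orderStat_eq (c := c) h1 hN hlam TD
  have : ∀ᵐ y ∂(serviceLaw N lam c), ((orderStat h y : ℝ) : EReal) ≠ TD := by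
    rw [ae_iff]; simpa using h0
  filter_upwards [this] with y hy
  exact propext (⟨fun h => le_of_lt h, fun h => lt_of_le_of_ne h hy⟩ :
    ((orderStat h y : ℝ) : EReal) < TD ↔ ((orderStat h y : ℝ) : EReal) ≤ TD)

theorem real_orderStat_lt {h : ℕ} (h1 : 1 ≤ h) (hN : h ≤ N) (hlam : 0 < lam)
    (hTD : (c : EReal) < TD) :
    (serviceLaw N lam c).real {y | ((orderStat h y : ℝ) : EReal) < TD}
      = 1 - coeffZ N lam c TD h := by
  rw [measureReal_congr (orderStat_lt_ae_eq_le h1 hN hlam TD), real_orderStat_le h1 hN hlam hTD]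

/-- For a finite deadline, all devices finish in time with positive probability, and then so does
the `h`-th fastest. -/
theorem one_sub_coeffZ_pos {h : ℕ} (h1 : 1 ≤ h) (hN : h ≤ N) (hlam : 0 < lam)
    (hTD : (c : EReal) < TD) : 0 < 1 - coeffZ N lam c TD h := by
  have := isProbabilityMeasure_serviceLaw (N := N) (c := c) hlam
  rw [← real_orderStat_le h1 hN hlam hTD]
  induction TD with
  | bot => simp at hTD
  | top => simp
  | coe D =>
    have hcD : c < D := by exact_mod_cast hTD
    have hx : Real.exp (-lam * (D - c)) < 1 := by
      rw [Real.exp_lt_one_iff]; nlinarith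
    have h2 := serviceLaw_filter_eq hlam hcD.le (Finset.univ : Finset (Fin N))
    have hsub : {y : Fin N → ℝ | (Finset.univ.filter fun m => y m ≤ D) = Finset.univ}
        ⊆ {y | ((orderStat h y : ℝ) : EReal) ≤ (D : EReal)} := by
      intro y hy
      simp only [Set.mem_ofPred_eq, EReal.coe_le_coe_iff] at hy ⊢
      rw [orderStat_le_iff h1 hN, hy]
      simpa using hN
    rw [measureReal_def, ENNReal.toReal_pos_iff]
    refine ⟨lt_of_lt_of_le ?_ (measure_mono hsub), measure_lt_top _ _⟩
    rw [h2, ENNReal.ofReal_pos]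
    have : 0 < 1 - Real.exp (-lam * (D - c)) := by linarith
    positivity

theorem integrable_bounded_indicator (hlam : 0 < lam) {s : Set (Fin N → ℝ)}
    (hs : MeasurableSet s) : Integrable (s.indicator fun _ => (1 : ℝ)) (serviceLaw N lam c) := by
  have := isProbabilityMeasure_serviceLaw (N := N) (c := c) hlam
  exact (integrable_const 1).indicator hs

/-- Given that the deadline is not reached, the time when the update is terminated does not depend
on whether device `n` is among the devices that receive the update. -/
theorem setIntegral_received_lt (h1 : 1 ≤ K) (hN : K ≤ N) (hlam : 0 < lam) (n : Fin N)
    {f : ℝ → ℝ} (hf : Measurable f)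
    (hint : Integrable (fun y => f (orderStat K y)) (serviceLaw N lam c)) :
    ∫ y in {y | Received K TD n y ∧ ((orderStat K y : ℝ) : EReal) < TD}, f (orderStat K y)
        ∂(serviceLaw N lam c)
      = K / N * ∫ y in {y | ((orderStat K y : ℝ) : EReal) < TD}, f (orderStat K y)
          ∂(serviceLaw N lam c) := by
  have hS := measurableSet_orderStat_lt h1 hN TD
  -- The integrand ignores the service time of the device, so all `K` terms of the exchangeability
  -- formula coincide and produce the factor `K / N`.
  have hm : Measurable (Function.uncurry fun _ v : ℝ => if ((v : ℝ) : EReal) < TD then f v else 0)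
      :=
    (Measurable.ite (measurableSet_coe_lt TD) hf measurable_const).comp measurable_snd
  have key := (integral_le_orderStat (c := c) h1 hN hlam hm (fun h _ _ => by
    refine (hint.indicator hS).congr (ae_of_all _ fun y => ?_)
    simp [Set.indicator_apply]) n).2
  have hR := measurableSet_received_lt h1 hN TD n
  rw [← integral_indicator hR, ← integral_indicator hS]
  refine Eq.trans (integral_congr_ae (ae_of_all _ fun y => ?_)) (key.trans ?_)
  · simp only [Set.indicator_apply, Set.mem_ofPred_eq, received_iff]
    by_cases hy : y n ≤ orderStat K y
    · by_cases ht : ((orderStat K y : ℝ) : EReal) < TD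
      · have : ((y n : ℝ) : EReal) ≤ TD := (EReal.coe_le_coe_iff.2 hy).trans ht.le
        simp [hy, ht, this]
      · simp [hy, ht]
    · simp [hy]
  · simp only [Finset.sum_const, Nat.card_Icc, nsmul_eq_mul, Nat.add_sub_cancel,
      Set.indicator_apply, Set.mem_ofPred_eq]
    ring

/-- Exchangeability is applied to the indicator that the device's own service time meets the
deadline; each order `h ≤ K` then contributes the probability that the `h`-th fastest device is in
time. -/
theorem real_received (h1 : 1 ≤ K) (hN : K ≤ N) (hlam : 0 < lam) (hTD : (c : EReal) < TD)
    (n : Fin N) :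
    (serviceLaw N lam c).real {y | Received K TD n y} = probS N K lam c TD := by
  have := isProbabilityMeasure_serviceLaw (N := N) (c := c) hlam
  have hm : Measurable (Function.uncurry fun u _ : ℝ =>
      if ((u : ℝ) : EReal) ≤ TD then (1 : ℝ) else 0) :=
    (Measurable.ite (measurableSet_le measurable_coe_real_ereal measurable_const) measurable_const
      measurable_const).comp measurable_fst
  have key := (integral_le_orderStat (c := c) h1 hN hlam hm (fun h hh1 hhK => by
    refine (integrable_bounded_indicator hlam
      (measurableSet_orderStat_le hh1 (hhK.trans hN) TD)).congr (ae_of_all _ fun y => ?_)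
    simp [Set.indicator_apply]) n).2
  rw [← integral_indicator_one (measurableSet_received h1 hN TD n), probS]
  refine Eq.trans (integral_congr_ae (ae_of_all _ fun y => ?_)) (key.trans ?_)
  · simp only [Set.indicator_apply, Set.mem_ofPred_eq, received_iff, Pi.one_apply]
    by_cases hy : y n ≤ orderStat K y <;> simp [hy]
  · congr 1
    refine Finset.sum_congr rfl fun h hh => ?_
    have hh1 := (Finset.mem_Icc.1 hh).1
    have hhN := (Finset.mem_Icc.1 hh).2.trans hN
    rw [← real_orderStat_le hh1 hhN hlam hTD,
      ← integral_indicator_one (measurableSet_orderStat_le hh1 hhN TD)]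
    refine integral_congr_ae (ae_of_all _ fun y => ?_)
    simp [Set.indicator_apply]

theorem probS_pos (h1 : 1 ≤ K) (hN : K ≤ N) (hlam : 0 < lam) (hTD : (c : EReal) < TD) :
    0 < probS N K lam c TD := by
  have : (0 : ℝ) < N := by exact_mod_cast lt_of_lt_of_le h1 hN
  unfold probS
  have : 0 < ∑ h ∈ Finset.Icc 1 K, (1 - coeffZ N lam c TD h) :=
    Finset.sum_pos (fun h hh => one_sub_coeffZ_pos (Finset.mem_Icc.1 hh).1
      ((Finset.mem_Icc.1 hh).2.trans hN) hlam hTD) ⟨1, by simpa using h1⟩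
  positivity

/-- Exchangeability now carries the service time itself, so the truncated means of the order
statistics `1, …, K` are averaged. -/
theorem setIntegral_received_apply (h1 : 1 ≤ K) (hN : K ≤ N) (hlam : 0 < lam) (hc : 0 < c)
    (hTD : (c : EReal) < TD) (n : Fin N) :
    IntegrableOn (fun y => y n) {y | Received K TD n y} (serviceLaw N lam c) ∧
    ∫ y in {y | Received K TD n y}, y n ∂(serviceLaw N lam c)
      = probS N K lam c TD * meanT N K lam c TD := by
  have hm : Measurable (Function.uncurry fun u _ : ℝ =>
      if ((u : ℝ) : EReal) ≤ TD then u else 0) :=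
    (Measurable.ite (measurableSet_le measurable_coe_real_ereal measurable_const) measurable_id
      measurable_const).comp measurable_fst
  have key := integral_le_orderStat (c := c) h1 hN hlam hm (fun h hh1 hhK => by
    have hint := integrable_orderStat_pow (c := c) hh1 (hhK.trans hN) hlam 1
    simp only [pow_one] at hint
    refine (hint.indicator (measurableSet_orderStat_le hh1 (hhK.trans hN) TD)).congr
      (ae_of_all _ fun y => ?_)
    simp [Set.indicator_apply]) n
  have heq : ∀ y : Fin N → ℝ, {y | Received K TD n y}.indicator (fun y => y n) y
      = if y n ≤ orderStat K y then (if ((y n : ℝ) : EReal) ≤ TD then y n else 0) else 0 := by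
    intro y
    simp only [Set.indicator_apply, Set.mem_ofPred_eq, received_iff]
    by_cases hy : y n ≤ orderStat K y <;> simp [hy]
  have hR := measurableSet_received h1 hN TD n
  refine ⟨(integrable_indicator_iff hR).1 (key.1.congr (ae_of_all _ fun y => (heq y).symm)), ?_⟩
  rw [← integral_indicator hR]
  refine Eq.trans (integral_congr_ae (ae_of_all _ heq)) (key.2.trans ?_)
  have hp := probS_pos h1 hN hlam hTD
  have hNpos : (0 : ℝ) < N := by exact_mod_cast lt_of_lt_of_le h1 hN
  rw [meanT, Finset.mul_sum, Finset.mul_sum]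
  refine Finset.sum_congr rfl fun h hh => ?_
  have hh1 := (Finset.mem_Icc.1 hh).1
  have hhN := (Finset.mem_Icc.1 hh).2.trans hN
  have h2 : ∫ y, (if ((orderStat h y : ℝ) : EReal) ≤ TD then orderStat h y else 0)
      ∂(serviceLaw N lam c) = ∫ y in {y | ((orderStat h y : ℝ) : EReal) < TD}, orderStat h y
      ∂(serviceLaw N lam c) := by
    rw [setIntegral_congr_set (orderStat_lt_ae_eq_le hh1 hhN hlam TD),
      ← integral_indicator (measurableSet_orderStat_le hh1 hhN TD)]
    refine integral_congr_ae (ae_of_all _ fun y => ?_)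
    simp [Set.indicator_apply]
  rw [h2, setIntegral_orderStat hh1 hhN hlam hc hTD, Finset.mul_sum, Finset.mul_sum]
  refine Finset.sum_congr rfl fun j _ => ?_
  have := coeffU_pos hhN j
  field_simp
  ring

theorem real_received_lt (h1 : 1 ≤ K) (hN : K ≤ N) (hlam : 0 < lam) (hTD : (c : EReal) < TD)
    (n : Fin N) :
    (serviceLaw N lam c).real {y | Received K TD n y ∧ ((orderStat K y : ℝ) : EReal) < TD}
      = K / N * (1 - coeffZ N lam c TD K) := by
  have := isProbabilityMeasure_serviceLaw (N := N) (c := c) hlam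
  have := setIntegral_received_lt (c := c) (TD := TD) h1 hN hlam n (f := fun _ => 1)
    measurable_const (integrable_const _)
  simpa [real_orderStat_lt h1 hN hlam hTD] using this

/-- For each order `h ≤ K`, the event that the deadline falls between the `h`-th and the `K`-th
smallest value is a difference of nested tail events. -/
theorem real_received_gt (h1 : 1 ≤ K) (hN : K ≤ N) (hlam : 0 < lam) (hTD : (c : EReal) < TD)
    (n : Fin N) :
    (serviceLaw N lam c).real {y | Received K TD n y ∧ TD < ((orderStat K y : ℝ) : EReal)}
      = 1 / N * ∑ h ∈ Finset.Icc 1 K, (coeffZ N lam c TD K - coeffZ N lam c TD h) := by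
  have := isProbabilityMeasure_serviceLaw (N := N) (c := c) hlam
  have hm : Measurable (Function.uncurry fun u v : ℝ =>
      if ((u : ℝ) : EReal) ≤ TD ∧ TD < ((v : ℝ) : EReal) then (1 : ℝ) else 0) :=
    Measurable.ite ((measurableSet_le (measurable_coe_real_ereal.comp measurable_fst)
      measurable_const).inter (measurableSet_lt measurable_const
        (measurable_coe_real_ereal.comp measurable_snd))) measurable_const measurable_const
  have hS : ∀ h, 1 ≤ h → h ≤ K → MeasurableSet {y : Fin N → ℝ |
      ((orderStat h y : ℝ) : EReal) ≤ TD ∧ TD < ((orderStat K y : ℝ) : EReal)} := fun h hh1 hhK =>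
    (measurableSet_orderStat_le hh1 (hhK.trans hN) TD).inter (measurableSet_lt_orderStat h1 hN TD)
  have key := (integral_le_orderStat (c := c) h1 hN hlam hm (fun h hh1 hhK => by
    refine (integrable_bounded_indicator hlam (hS h hh1 hhK)).congr (ae_of_all _ fun y => ?_)
    simp [Set.indicator_apply]) n).2
  have hR := measurableSet_received_gt h1 hN TD n
  rw [← integral_indicator_one hR]
  refine Eq.trans (integral_congr_ae (ae_of_all _ fun y => ?_)) (key.trans ?_)
  · simp only [Set.indicator_apply, Set.mem_ofPred_eq, received_iff, Pi.one_apply]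
    by_cases hy : y n ≤ orderStat K y <;> simp [hy]
  · congr 1
    refine Finset.sum_congr rfl fun h hh => ?_
    have hh1 := (Finset.mem_Icc.1 hh).1
    have hhK := (Finset.mem_Icc.1 hh).2
    rw [← serviceLaw_real_lt_orderStat h1 hN hlam hTD,
      ← serviceLaw_real_lt_orderStat hh1 (hhK.trans hN) hlam hTD,
      ← measureReal_sdiff (s₁ := {y | TD < ((orderStat K y : ℝ) : EReal)})
        (s₂ := {y | TD < ((orderStat h y : ℝ) : EReal)}) (fun y hy => lt_of_lt_of_le hy
        (EReal.coe_le_coe_iff.2 (orderStat_mono hh1 hhK hN y)))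
        (measurableSet_lt_orderStat hh1 (hhK.trans hN) TD),
      ← integral_indicator_one ((measurableSet_lt_orderStat h1 hN TD).diff
        (measurableSet_lt_orderStat hh1 (hhK.trans hN) TD))]
    refine integral_congr_ae (ae_of_all _ fun y => ?_)
    simp [Set.indicator_apply, and_comm]

theorem real_not_received_gt (h1 : 1 ≤ K) (hN : K ≤ N) (hlam : 0 < lam) (hTD : (c : EReal) < TD)
    (n : Fin N) :
    (serviceLaw N lam c).real {y | ¬ Received K TD n y ∧ TD < ((orderStat K y : ℝ) : EReal)}
      = (((N : ℝ) - K) * coeffZ N lam c TD K + ∑ h ∈ Finset.Icc 1 K, coeffZ N lam c TD h) / N := by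
  have := isProbabilityMeasure_serviceLaw (N := N) (c := c) hlam
  have hNpos : (0 : ℝ) < N := by exact_mod_cast lt_of_lt_of_le h1 hN
  have hset : {y | ¬ Received K TD n y ∧ TD < ((orderStat K y : ℝ) : EReal)}
      = {y | TD < ((orderStat K y : ℝ) : EReal)}
        \ {y | Received K TD n y ∧ TD < ((orderStat K y : ℝ) : EReal)} := by
    ext y; simp only [Set.mem_ofPred_eq, Set.mem_sdiff]; tauto
  rw [hset, measureReal_sdiff (received_gt_subset TD n) (measurableSet_received_gt h1 hN TD n),
      serviceLaw_real_lt_orderStat h1 hN hlam hTD,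
    real_received_gt h1 hN hlam hTD, Finset.sum_sub_distrib]
  simp only [Finset.sum_const, Nat.card_Icc, nsmul_eq_mul, Nat.add_sub_cancel]
  field_simp
  ring

theorem real_not_received (h1 : 1 ≤ K) (hN : K ≤ N) (hlam : 0 < lam) (hTD : (c : EReal) < TD)
    (n : Fin N) :
    (serviceLaw N lam c).real {y | ¬ Received K TD n y} = 1 - probS N K lam c TD := by
  have := isProbabilityMeasure_serviceLaw (N := N) (c := c) hlam
  rw [← real_received h1 hN hlam hTD n,
    ← probReal_compl_eq_one_sub (measurableSet_received h1 hN TD n)]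
  rfl

/-- The expected number of devices that miss the deadline is counted in two ways, by order and by
device. -/
theorem sum_coeffZ (hlam : 0 < lam) (hTD : (c : EReal) < TD) :
    ∑ h ∈ Finset.Icc 1 N, coeffZ N lam c TD h = N * decay lam c TD 1 := by
  have := isProbabilityMeasure_serviceLaw (N := N) (c := c) hlam
  have := isProbabilityMeasure_shiftedExp (c := c) hlam
  have hd : ∀ m : Fin N, (serviceLaw N lam c).real {y | TD < ((y m : ℝ) : EReal)}
      = decay lam c TD 1 := by
    intro m
    have hs : MeasurableSet {t : ℝ | TD < ((t : ℝ) : EReal)} :=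
      measurableSet_lt measurable_const measurable_coe_real_ereal
    have h2 := (measurePreserving_eval (fun _ : Fin N => shiftedExp lam c) m).measureReal_preimage
      hs.nullMeasurableSet
    refine h2.trans ?_
    induction TD with
    | bot => simp at hTD
    | top => simp [decay]
    | coe D =>
      have hcD : c ≤ D := le_of_lt (by exact_mod_cast hTD)
      have := shiftedExp_Ioi hlam hcD
      simp only [EReal.coe_lt_coe_iff]
      change (shiftedExp lam c).real (Set.Ioi D) = _
      rw [measureReal_def, this, ENNReal.toReal_ofReal (Real.exp_nonneg _), decay_eq]
      simp
  have h3 : ∑ m : Fin N, (serviceLaw N lam c).real {y | TD < ((y m : ℝ) : EReal)}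
      = ∑ h ∈ Finset.Icc 1 N, coeffZ N lam c TD h := by
    have hms : ∀ m : Fin N, MeasurableSet {y : Fin N → ℝ | TD < ((y m : ℝ) : EReal)} := fun m =>
      measurableSet_lt measurable_const (measurable_coe_real_ereal.comp (measurable_pi_apply m))
    have hmo : ∀ h ∈ Finset.Icc 1 N,
        MeasurableSet {y : Fin N → ℝ | TD < ((orderStat h y : ℝ) : EReal)} := fun h hh =>
      measurableSet_lt_orderStat (Finset.mem_Icc.1 hh).1 (Finset.mem_Icc.1 hh).2 TD
    have hims : ∀ m : Fin N, Integrable (Set.indicator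
        {y : Fin N → ℝ | TD < ((y m : ℝ) : EReal)} (1 : (Fin N → ℝ) → ℝ)) (serviceLaw N lam c) :=
      fun m => integrable_bounded_indicator hlam (hms m)
    have himo : ∀ h ∈ Finset.Icc 1 N, Integrable (Set.indicator
        {y : Fin N → ℝ | TD < ((orderStat h y : ℝ) : EReal)} (1 : (Fin N → ℝ) → ℝ))
        (serviceLaw N lam c) :=
      fun h hh => integrable_bounded_indicator hlam (hmo h hh)
    rw [Finset.sum_congr rfl fun h hh => (serviceLaw_real_lt_orderStat (Finset.mem_Icc.1 hh).1
      (Finset.mem_Icc.1 hh).2 hlam hTD).symm,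
      Finset.sum_congr rfl fun m _ => (integral_indicator_one (hms m)).symm,
      Finset.sum_congr rfl fun h hh => (integral_indicator_one (hmo h hh)).symm,
      ← integral_finsetSum _ fun m _ => hims m,
      ← integral_finsetSum _ himo]
    refine integral_congr_ae (ae_of_all _ fun y => ?_)
    have := sum_orderStat y fun t => if TD < ((t : ℝ) : EReal) then (1 : ℝ) else 0
    simpa [Set.indicator_apply] using this.symm
  rw [← h3]
  simp [hd]

/-- By `sum_coeffZ` the denominator of `probF2` is N times the failure probability. The product form
needs that probability to be nonzero, since otherwise `probF2` is a division by zero. -/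
theorem one_sub_probS_mul_probF2 (h1 : 1 ≤ K) (hN : K ≤ N) (hlam : 0 < lam)
    (hTD : (c : EReal) < TD) (hp : 1 - probS N K lam c TD ≠ 0) (n : Fin N) :
    (1 - probS N K lam c TD) * probF2 N K lam c TD
      = (serviceLaw N lam c).real
          {y | ¬ Received K TD n y ∧ TD < ((orderStat K y : ℝ) : EReal)} := by
  have hNpos : (0 : ℝ) < N := by exact_mod_cast lt_of_lt_of_le h1 hN
  have hden : N * decay lam c TD 1 + ((N : ℝ) - K)
      - ∑ h ∈ Finset.Icc (K + 1) N, coeffZ N lam c TD h = N * (1 - probS N K lam c TD) := by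
    have hsplit : ∑ h ∈ Finset.Icc 1 N, coeffZ N lam c TD h
        = ∑ h ∈ Finset.Icc 1 K, coeffZ N lam c TD h
          + ∑ h ∈ Finset.Icc (K + 1) N, coeffZ N lam c TD h := by
      rw [← Finset.sum_union]
      · congr 1; ext h; simp; omega
      · refine Finset.disjoint_left.2 fun h hh hh' => ?_
        have := (Finset.mem_Icc.1 hh).2
        have := (Finset.mem_Icc.1 hh').1
        omega
    rw [← sum_coeffZ hlam hTD, hsplit, probS, Finset.sum_sub_distrib]
    simp only [Finset.sum_const, Nat.card_Icc, nsmul_eq_mul, Nat.add_sub_cancel]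
    field_simp
    ring
  rw [real_not_received_gt h1 hN hlam hTD, probF2, hden]
  field_simp

/-- If `K < N`, some device is left out even when the deadline is not reached, which gives the bound
`(N - K) / N` times a positive probability. If `K = N` and the deadline is finite, with positive
probability no device meets it. -/
theorem one_sub_probS_pos (h1 : 1 ≤ K) (hN : K ≤ N) (hlam : 0 < lam)
    (hTD : (c : EReal) < TD) (h : K < N ∨ TD ≠ ⊤) : 0 < 1 - probS N K lam c TD := by
  have := isProbabilityMeasure_serviceLaw (N := N) (c := c) hlam
  have hNpos : (0 : ℝ) < N := by exact_mod_cast lt_of_lt_of_le h1 hN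
  by_cases hKN : K < N
  · have hKN' : (K : ℝ) < N := by exact_mod_cast hKN
    have hS := measurableSet_orderStat_lt h1 hN TD
    have n : Fin N := ⟨0, by omega⟩
    have h2 : (serviceLaw N lam c).real ({y | ((orderStat K y : ℝ) : EReal) < TD}
        \ {y | Received K TD n y ∧ ((orderStat K y : ℝ) : EReal) < TD})
        ≤ (serviceLaw N lam c).real {y | ¬ Received K TD n y} :=
      measureReal_mono fun y hy => fun hr => hy.2 ⟨hr, hy.1⟩
    rw [measureReal_sdiff (received_lt_subset TD n) (measurableSet_received_lt h1 hN TD n),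
      real_orderStat_lt h1 hN hlam hTD, real_received_lt h1 hN hlam hTD,
      real_not_received h1 hN hlam hTD] at h2
    refine lt_of_lt_of_le ?_ h2
    have h3 := one_sub_coeffZ_pos h1 hN hlam hTD
    have : (1 - coeffZ N lam c TD K) - K / N * (1 - coeffZ N lam c TD K)
        = (N - K) / N * (1 - coeffZ N lam c TD K) := by field_simp
    rw [this]
    have : (0 : ℝ) < N - K := by linarith
    positivity
  · replace h := h.resolve_left hKN
    have n : Fin N := ⟨0, by omega⟩
    rw [← real_not_received h1 hN hlam hTD n]
    induction TD with
    | bot => simp at hTD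
    | top => simp at h
    | coe D =>
      have hcD : c < D := by exact_mod_cast hTD
      have h2 := serviceLaw_filter_eq hlam hcD.le (∅ : Finset (Fin N))
      have hsub : {y : Fin N → ℝ | (Finset.univ.filter fun m => y m ≤ D) = ∅}
          ⊆ {y | ¬ Received K D n y} := by
        intro y hy hr
        have := EReal.coe_le_coe_iff.1 (received_iff.1 hr).1
        have hmem : n ∈ Finset.univ.filter fun m => y m ≤ D := by simpa using this
        rw [hy] at hmem
        simp at hmem
      rw [measureReal_def, ENNReal.toReal_pos_iff]
      refine ⟨lt_of_lt_of_le ?_ (measure_mono hsub), measure_lt_top _ _⟩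
      rw [h2, ENNReal.ofReal_pos]
      simp; positivity

theorem setIntegral_not_received_lt (h1 : 1 ≤ K) (hN : K ≤ N) (hlam : 0 < lam) (n : Fin N)
    {f : ℝ → ℝ} (hf : Measurable f)
    (hint : Integrable (fun y => f (orderStat K y)) (serviceLaw N lam c)) :
    ∫ y in {y | ¬ Received K TD n y ∧ ((orderStat K y : ℝ) : EReal) < TD}, f (orderStat K y)
        ∂(serviceLaw N lam c)
      = (N - K) / N * ∫ y in {y | ((orderStat K y : ℝ) : EReal) < TD}, f (orderStat K y)
          ∂(serviceLaw N lam c) := by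
  have hNpos : (0 : ℝ) < N := by exact_mod_cast lt_of_lt_of_le h1 hN
  have hS := measurableSet_orderStat_lt h1 hN TD
  have hset : {y | ¬ Received K TD n y ∧ ((orderStat K y : ℝ) : EReal) < TD}
      = {y | ((orderStat K y : ℝ) : EReal) < TD}
        \ {y | Received K TD n y ∧ ((orderStat K y : ℝ) : EReal) < TD} := by
    ext y; simp only [Set.mem_ofPred_eq, Set.mem_sdiff]; tauto
  rw [hset, setIntegral_sdiff (measurableSet_received_lt h1 hN TD n) hint.integrableOn
    (received_lt_subset TD n), setIntegral_received_lt h1 hN hlam n hf hint]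
  field_simp

theorem real_not_received_lt (h1 : 1 ≤ K) (hN : K ≤ N) (hlam : 0 < lam) (hTD : (c : EReal) < TD)
    (n : Fin N) :
    (serviceLaw N lam c).real {y | ¬ Received K TD n y ∧ ((orderStat K y : ℝ) : EReal) < TD}
      = (N - K) / N * (1 - coeffZ N lam c TD K) := by
  have := isProbabilityMeasure_serviceLaw (N := N) (c := c) hlam
  have := setIntegral_not_received_lt (c := c) (TD := TD) h1 hN hlam n (f := fun _ => 1)
    measurable_const (integrable_const _)
  simpa [real_orderStat_lt h1 hN hlam hTD] using this

/-- The duration lies between 0 and the `K`-th order statistic, which has a second moment. -/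
theorem memLp_duration (h1 : 1 ≤ K) (hN : K ≤ N) (hlam : 0 < lam) (hc : 0 < c)
    (hTD : (c : EReal) < TD) : MemLp (duration K TD) 2 (serviceLaw N lam c) := by
  refine (memLp_orderStat h1 hN hlam).mono (measurable_duration h1 hN TD).aestronglyMeasurable ?_
  filter_upwards [ae_lt_apply hlam N] with y hy
  have h2 := lt_duration h1 hN hTD hy
  rw [Real.norm_of_nonneg (hc.trans h2).le,
    Real.norm_of_nonneg (hc.trans (lt_orderStat h1 hN hy)).le]
  exact duration_le_orderStat (bot_le.trans_lt hTD) y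

/-- Splitting an expectation over a set according to whether the deadline is reached. -/
theorem setIntegral_duration (h1 : 1 ≤ K) (hN : K ≤ N) (hlam : 0 < lam)
    {s : Set (Fin N → ℝ)} (hs : MeasurableSet s) (f : ℝ → ℝ)
    (hint : Integrable (fun y => f (duration K TD y)) (serviceLaw N lam c)) :
    ∫ y in s, f (duration K TD y) ∂(serviceLaw N lam c)
      = ∫ y in s ∩ {y | ((orderStat K y : ℝ) : EReal) < TD}, f (orderStat K y) ∂(serviceLaw N lam c)
        + ((serviceLaw N lam c).real s - (serviceLaw N lam c).real
            (s ∩ {y | ((orderStat K y : ℝ) : EReal) < TD})) * f TD.toReal := by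
  have := isProbabilityMeasure_serviceLaw (N := N) (c := c) hlam
  have hS := measurableSet_orderStat_lt h1 hN TD
  rw [← integral_inter_add_sdiff (s := s) hS hint.integrableOn]
  congr 1
  · exact setIntegral_congr_fun (hs.inter hS) fun y hy => by
      rw [duration_of_lt hy.2]
  -- Here the duration is the constant deadline. For `TD = ⊤` this part of `s` is empty, so the
  -- default value of `toReal` is harmless.
  · rw [setIntegral_congr_fun (g := fun _ => f TD.toReal) (hs.diff hS) fun y hy => by
        rw [duration_of_le (not_lt.1 hy.2)], setIntegral_const, smul_eq_mul]
    congr 1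
    have := measureReal_sdiff_add_inter (μ := serviceLaw N lam c) (s := s) hS
    linarith

theorem integrable_duration_pow (h1 : 1 ≤ K) (hN : K ≤ N) (hlam : 0 < lam) (hc : 0 < c)
    (hTD : (c : EReal) < TD) :
    Integrable (duration K TD) (serviceLaw N lam c) ∧
      Integrable (fun y => duration K TD y ^ 2) (serviceLaw N lam c) := by
  have := isProbabilityMeasure_serviceLaw (N := N) (c := c) hlam
  have h := memLp_duration h1 hN hlam hc hTD
  exact ⟨h.integrable one_le_two, h.integrable_sq⟩

theorem one_sub_coeffZ_mul_condMoment1 (h1 : 1 ≤ K) (hN : K ≤ N) (hlam : 0 < lam) (hc : 0 < c)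
    (hTD : (c : EReal) < TD) :
    (1 - coeffZ N lam c TD K) * condMoment1 N K lam c TD
      = ∫ y in {y | ((orderStat K y : ℝ) : EReal) < TD}, orderStat K y ∂(serviceLaw N lam c) := by
  have := (one_sub_coeffZ_pos h1 hN hlam hTD).ne'
  rw [setIntegral_orderStat h1 hN hlam hc hTD, condMoment1, ← mul_assoc,
    mul_one_div_cancel this, one_mul]

theorem one_sub_coeffZ_mul_condMoment2 (h1 : 1 ≤ K) (hN : K ≤ N) (hlam : 0 < lam) (hc : 0 < c)
    (hTD : (c : EReal) < TD) :
    (1 - coeffZ N lam c TD K) * condMoment2 N K lam c TD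
      = ∫ y in {y | ((orderStat K y : ℝ) : EReal) < TD}, orderStat K y ^ 2
          ∂(serviceLaw N lam c) := by
  have := (one_sub_coeffZ_pos h1 hN hlam hTD).ne'
  rw [setIntegral_orderStat_sq h1 hN hlam hc hTD, condMoment2, ← mul_assoc,
    mul_one_div_cancel this, one_mul]

theorem setIntegral_received_duration (h1 : 1 ≤ K) (hN : K ≤ N) (hlam : 0 < lam) (hc : 0 < c)
    (hTD : (c : EReal) < TD) (n : Fin N) :
    ∫ y in {y | Received K TD n y}, duration K TD y ∂(serviceLaw N lam c)
        = probS N K lam c TD * meanXS N K lam c TD ∧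
    ∫ y in {y | Received K TD n y}, duration K TD y ^ 2 ∂(serviceLaw N lam c)
        = probS N K lam c TD * meanXSsq N K lam c TD := by
  have hR := measurableSet_received h1 hN TD n
  have hp := (probS_pos h1 hN hlam hTD).ne'
  have hNpos : (0 : ℝ) < N := by exact_mod_cast lt_of_lt_of_le h1 hN
  obtain ⟨i1, i2⟩ := integrable_duration_pow h1 hN hlam hc hTD
  have j1 := integrable_orderStat_pow (c := c) h1 hN hlam 1
  have j2 := integrable_orderStat_pow (c := c) h1 hN hlam 2
  simp only [pow_one] at j1
  have e1 := setIntegral_duration h1 hN hlam hR (fun t => t) i1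
  have e2 := setIntegral_duration h1 hN hlam hR (fun t => t ^ 2) i2
  have hset : {y | Received K TD n y} ∩ {y | ((orderStat K y : ℝ) : EReal) < TD}
      = {y | Received K TD n y ∧ ((orderStat K y : ℝ) : EReal) < TD} := rfl
  have f1 := setIntegral_received_lt (c := c) (TD := TD) h1 hN hlam n (f := fun t => t)
    measurable_id j1
  have f2 := setIntegral_received_lt (c := c) (TD := TD) h1 hN hlam n (f := fun t => t ^ 2)
    (by fun_prop) j2
  rw [hset, real_received h1 hN hlam hTD, real_received_lt h1 hN hlam hTD] at e1 e2
  rw [e1, f1, e2, f2, ← one_sub_coeffZ_mul_condMoment1 h1 hN hlam hc hTD,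
    ← one_sub_coeffZ_mul_condMoment2 h1 hN hlam hc hTD]
  simp only [meanXS, meanXSsq, probS1]
  constructor <;> field_simp

theorem setIntegral_not_received_duration (h1 : 1 ≤ K) (hN : K ≤ N) (hlam : 0 < lam) (hc : 0 < c)
    (hTD : (c : EReal) < TD) (n : Fin N) :
    ∫ y in {y | ¬ Received K TD n y}, duration K TD y ∂(serviceLaw N lam c)
        = (1 - probS N K lam c TD) * meanXF N K lam c TD ∧
    ∫ y in {y | ¬ Received K TD n y}, duration K TD y ^ 2 ∂(serviceLaw N lam c)
        = (1 - probS N K lam c TD) * meanXFsq N K lam c TD := by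
  have hprob := isProbabilityMeasure_serviceLaw (N := N) (c := c) hlam
  have hF : MeasurableSet {y | ¬ Received K TD n y} := (measurableSet_received h1 hN TD n).compl
  -- If failures have probability zero, both sides vanish whatever value `probF2` takes.
  by_cases hp : 1 - probS N K lam c TD = 0
  · have h0 : serviceLaw N lam c {y | ¬ Received K TD n y} = 0 := by
      have := real_not_received (c := c) h1 hN hlam hTD n
      rwa [hp, measureReal_eq_zero_iff] at this
    simp [hp, Measure.restrict_eq_zero.2 h0]
  have hNpos : (0 : ℝ) < N := by exact_mod_cast lt_of_lt_of_le h1 hN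
  obtain ⟨i1, i2⟩ := integrable_duration_pow h1 hN hlam hc hTD
  have j1 := integrable_orderStat_pow (c := c) h1 hN hlam 1
  have j2 := integrable_orderStat_pow (c := c) h1 hN hlam 2
  simp only [pow_one] at j1
  have e1 := setIntegral_duration h1 hN hlam hF (fun t => t) i1
  have e2 := setIntegral_duration h1 hN hlam hF (fun t => t ^ 2) i2
  have hset : {y | ¬ Received K TD n y} ∩ {y | ((orderStat K y : ℝ) : EReal) < TD}
      = {y | ¬ Received K TD n y ∧ ((orderStat K y : ℝ) : EReal) < TD} := rfl
  have f1 := setIntegral_not_received_lt (c := c) (TD := TD) h1 hN hlam n (f := fun t => t)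
    measurable_id j1
  have f2 := setIntegral_not_received_lt (c := c) (TD := TD) h1 hN hlam n (f := fun t => t ^ 2)
    (by fun_prop) j2
  have hq := one_sub_probS_mul_probF2 h1 hN hlam hTD hp n
  -- The failures not accounted for by an early `K`-th completion are those stopped by the deadline;
  -- equality of the two times carries no mass.
  have hq2 : (1 - probS N K lam c TD) - (N - K) / N * (1 - coeffZ N lam c TD K)
      = (1 - probS N K lam c TD) * probF2 N K lam c TD := by
    rw [hq, real_not_received_gt h1 hN hlam hTD, probS, Finset.sum_sub_distrib]
    simp only [Finset.sum_const, Nat.card_Icc, nsmul_eq_mul, Nat.add_sub_cancel]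
    field_simp
    ring
  rw [hset, real_not_received h1 hN hlam hTD, real_not_received_lt h1 hN hlam hTD, hq2] at e1 e2
  have hq3 : (N - K) / N * (1 - coeffZ N lam c TD K)
      = (1 - probS N K lam c TD) * (1 - probF2 N K lam c TD) := by linarith
  rw [e1, f1, e2, f2, ← one_sub_coeffZ_mul_condMoment1 h1 hN hlam hc hTD,
    ← one_sub_coeffZ_mul_condMoment2 h1 hN hlam hc hTD, ← mul_assoc, ← mul_assoc, hq3]
  simp only [meanXF, meanXFsq]
  constructor <;> ring

end

/-! ### Sequences of independent trials -/

section Renewal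

variable {E : Type*}

/-- The sequence that is left when the first `k` terms are dropped. -/
def shift (k : ℕ) (y : ℕ → E) : ℕ → E := fun j => y (k + j)

/-- The index of the first trial with outcome in `S`. -/
def firstIdx (S : Set E) (y : ℕ → E) : ℕ := Nat.nth (fun j => y j ∈ S) 0

/-- The outcome of the first trial with outcome in `S`. -/
def firstVal (S : Set E) (y : ℕ → E) : E := y (firstIdx S y)

/-- The trials that follow the first one with outcome in `S`. -/
def regen (S : Set E) (y : ℕ → E) : ℕ → E := shift (firstIdx S y + 1) y

/-- The sum of `d` over the trials that precede the first one with outcome in `S`. -/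
def preSum (S : Set E) (d : E → ℝ) (y : ℕ → E) : ℝ := ∑ i ∈ Finset.range (firstIdx S y), d (y i)

variable {S : Set E} {d : E → ℝ}

/-- Existence of a success is essential: without one, `Nat.nth` returns 0. -/
theorem firstIdx_eq_iff {y : ℕ → E} (hy : ∃ j, y j ∈ S) (k : ℕ) :
    firstIdx S y = k ↔ y k ∈ S ∧ ∀ i < k, y i ∉ S := by
  classical
  rw [firstIdx, Nat.nth_zero_of_exists hy, Nat.find_eq_iff]

theorem firstIdx_mem {y : ℕ → E} (hy : ∃ j, y j ∈ S) : y (firstIdx S y) ∈ S :=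
  ((firstIdx_eq_iff hy _).1 rfl).1

theorem notMem_of_lt_firstIdx {y : ℕ → E} (hy : ∃ j, y j ∈ S) {i : ℕ} (hi : i < firstIdx S y) :
    y i ∉ S :=
  ((firstIdx_eq_iff hy _).1 rfl).2 i hi

theorem infinite_shift {y : ℕ → E} (hy : {j : ℕ | y j ∈ S}.Infinite) (k : ℕ) :
    {j : ℕ | shift k y j ∈ S}.Infinite := by
  rw [← Nat.frequently_atTop_iff_infinite] at hy ⊢
  rw [frequently_atTop] at hy ⊢
  intro a
  obtain ⟨b, hb, hb'⟩ := hy (k + a)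
  exact ⟨b - k, by omega, by simpa [shift, Nat.add_sub_cancel' (by omega : k ≤ b)] using hb'⟩

theorem firstIdx_eq_succ {y : ℕ → E} (h0 : y 0 ∉ S) (hs : ∃ j, shift 1 y j ∈ S) :
    firstIdx S y = firstIdx S (shift 1 y) + 1 := by
  obtain ⟨j, hj⟩ := hs
  refine (firstIdx_eq_iff (y := y) ⟨1 + j, hj⟩ _).2
    ⟨by simpa [shift, add_comm] using firstIdx_mem ⟨j, hj⟩, fun i hi => ?_⟩
  rcases i with _ | i
  · exact h0
  · simpa [shift, add_comm] using notMem_of_lt_firstIdx ⟨j, hj⟩ (Nat.lt_of_succ_lt_succ hi)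

/-- One step of the recursion for `preSum`. -/
def failStep (S : Set E) (d : E → ℝ) (Z : (ℕ → E) → ℝ) (y : ℕ → E) : ℝ :=
  Sᶜ.indicator d (y 0) + Sᶜ.indicator 1 (y 0) * Z (shift 1 y)

/-- A success beyond index 0 is required so that the shifted sequence also contains one and its
first index is not a default value. -/
theorem preSum_eq_failStep {y : ℕ → E} (hy : ∃ j, y (j + 1) ∈ S) :
    preSum S d y = failStep S d (preSum S d) y := by
  obtain ⟨j, hj⟩ := hy
  have hy : ∃ j, y j ∈ S := ⟨_, hj⟩
  by_cases h0 : y 0 ∈ S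
  · have : firstIdx S y = 0 := (firstIdx_eq_iff hy 0).2 ⟨h0, by simp⟩
    simp [preSum, failStep, this, h0]
  · have hs : ∃ j, shift 1 y j ∈ S := ⟨j, by simpa [shift, add_comm] using hj⟩
    rw [preSum, firstIdx_eq_succ h0 hs, Finset.sum_range_succ']
    simp [preSum, failStep, h0, shift, add_comm]

theorem failStep_of_mem {Z : (ℕ → E) → ℝ} {y : ℕ → E} (h0 : y 0 ∈ S) : failStep S d Z y = 0 := by
  simp [failStep, h0]

/-- Started from 0, the recursion becomes exact once it has run past the first success. This
pointwise stabilisation feeds Fatou's lemma in `moments_preSum`. -/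
theorem iterate_failStep_eq (m : ℕ) {y : ℕ → E} (hy : {j : ℕ | y j ∈ S}.Infinite)
    (hm : firstIdx S y < m) : (failStep S d)^[m] 0 y = preSum S d y := by
  induction m generalizing y with
  | zero => omega
  | succ m ih =>
    have hs := infinite_shift hy 1
    have hex : ∃ j, y (j + 1) ∈ S := by
      obtain ⟨j, hj⟩ := hs.nonempty
      exact ⟨j, by simpa [shift, add_comm] using hj⟩
    rw [Function.iterate_succ_apply', preSum_eq_failStep hex]
    by_cases h0 : y 0 ∈ S
    · rw [failStep_of_mem h0, failStep_of_mem h0]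
    · have := firstIdx_eq_succ h0 hs.nonempty
      rw [failStep, failStep, ih hs (by omega)]

/-! ### Laws of i.i.d. sequences: shifts, independence of past and future, the first success. -/

variable [MeasurableSpace E]

/-- The law of a sequence of independent random variables with distribution `ρ`. -/
def seqLaw (ρ : Measure E) : Measure (ℕ → E) := Measure.infinitePi fun _ => ρ

variable (ρ : Measure E) [IsProbabilityMeasure ρ]

instance : IsProbabilityMeasure (seqLaw ρ) := by unfold seqLaw; infer_instance

theorem measurable_shift (k : ℕ) : Measurable (shift k : (ℕ → E) → ℕ → E) :=
  measurable_pi_lambda _ fun _ => measurable_pi_apply _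

theorem measurePreserving_shift (k : ℕ) : MeasurePreserving (shift k) (seqLaw ρ) (seqLaw ρ) :=
  ⟨measurable_shift k, Measure.map_infinitePi_infinitePi_of_inj (P := fun _ : ℕ => ρ)
    (f := fun j => k + j) (add_right_injective k)⟩

theorem measurePreserving_eval (j : ℕ) :
    MeasurePreserving (fun y : ℕ → E => y j) (seqLaw ρ) ρ :=
  measurePreserving_eval_infinitePi (fun _ => ρ) j

theorem iIndepFun_eval : ProbabilityTheory.iIndepFun (fun (j : ℕ) (y : ℕ → E) => y j) (seqLaw ρ) :=
  ProbabilityTheory.iIndepFun_infinitePi (X := fun _ e => e) fun _ => measurable_id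

/-- The two maps are measurable with respect to the σ-algebras generated by the coordinates below
`k` and by those from `k` on, which are disjoint index sets of an independent family. -/
theorem indepFun_prefix_shift (k : ℕ) :
    ProbabilityTheory.IndepFun (fun (y : ℕ → E) (i : Fin k) => y i) (shift k) (seqLaw ρ) := by
  have hdis : Disjoint (Set.Iio k) (Set.Ici k) :=
    Set.disjoint_left.2 fun i hi hi' => absurd (Set.mem_Ici.1 hi') (not_le.2 hi)
  have h := ProbabilityTheory.indep_iSup_of_disjoint
    (fun i => (measurable_pi_apply (X := fun _ : ℕ => E) i).comap_le)
    ((ProbabilityTheory.iIndepFun_iff_iIndep _ _ _).1 (iIndepFun_eval ρ)) hdis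
  have hle : ∀ (s : Set ℕ) (i : ℕ), i ∈ s →
      Measurable[⨆ j ∈ s, MeasurableSpace.comap (fun y : ℕ → E => y j) inferInstance]
        (fun y : ℕ → E => y i) := fun s i hi =>
    (comap_measurable _).mono (le_biSup
      (fun j => MeasurableSpace.comap (fun y : ℕ → E => y j) inferInstance) hi) le_rfl
  refine ProbabilityTheory.indep_of_indep_of_le_left
    (ProbabilityTheory.indep_of_indep_of_le_right h ?_) ?_
  · refine Measurable.comap_le ?_
    exact @measurable_pi_lambda _ _ _ (_) _ _ fun j => hle _ _ (Set.mem_Ici.2 (Nat.le_add_right k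
        j))
  · refine Measurable.comap_le ?_
    exact @measurable_pi_lambda _ _ _ (_) _ _ fun i => hle _ _ (Set.mem_Iio.2 i.isLt)

theorem map_head_tail : (seqLaw ρ).map (fun y => (y 0, shift 1 y)) = ρ.prod (seqLaw ρ) := by
  have h : ProbabilityTheory.IndepFun (fun y : ℕ → E => y 0) (shift 1) (seqLaw ρ) :=
    (indepFun_prefix_shift ρ 1).comp (φ := fun v : Fin 1 → E => v 0) (ψ := id)
      (measurable_pi_apply 0) measurable_id
  rw [(ProbabilityTheory.indepFun_iff_map_prod_eq_prod_map_map
    (measurable_pi_apply 0).aemeasurable (measurable_shift 1).aemeasurable).1 h,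
    (measurePreserving_shift ρ 1).map_eq, (measurePreserving_eval ρ 0).map_eq]

theorem measurePreserving_head_tail :
    MeasurePreserving (fun y : ℕ → E => (y 0, shift 1 y)) (seqLaw ρ) (ρ.prod (seqLaw ρ)) :=
  ⟨(measurable_pi_apply 0).prodMk (measurable_shift 1), map_head_tail ρ⟩

theorem measurableSet_avoid (hS : MeasurableSet S) (k : ℕ) :
    MeasurableSet {y : ℕ → E | y k ∈ S ∧ ∀ i < k, y i ∉ S} := by
  refine (measurable_pi_apply k hS).inter ?_
  have : {y : ℕ → E | ∀ i < k, y i ∉ S} = ⋂ i, ⋂ (_ : i < k), (fun y : ℕ → E => y i) ⁻¹' Sᶜ := by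
    ext y; simp
  change MeasurableSet {y : ℕ → E | ∀ i < k, y i ∉ S}
  rw [this]
  exact MeasurableSet.iInter fun i => MeasurableSet.iInter fun _ => measurable_pi_apply i hS.compl

theorem measurableSet_hit (hS : MeasurableSet S) : MeasurableSet {y : ℕ → E | ∃ j, y j ∈ S} := by
  have : {y : ℕ → E | ∃ j, y j ∈ S} = ⋃ j, (fun y : ℕ → E => y j) ⁻¹' S := by ext y; simp
  rw [this]
  exact MeasurableSet.iUnion fun j => measurable_pi_apply j hS

theorem measurable_firstIdx (hS : MeasurableSet S) : Measurable (firstIdx S : (ℕ → E) → ℕ) := by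
  refine measurable_to_countable' fun k => ?_
  -- Sequences without a success also land in the fibre over 0, by the default value; hence the
  -- second set of the union.
  have : (firstIdx S : (ℕ → E) → ℕ) ⁻¹' {k}
      = ({y | ∃ j, y j ∈ S} ∩ {y | y k ∈ S ∧ ∀ i < k, y i ∉ S})
        ∪ ({y | ∃ j, y j ∈ S}ᶜ ∩ {_y | k = 0}) := by
    ext y
    simp only [Set.mem_preimage, Set.mem_singleton_iff, Set.mem_union, Set.mem_inter_iff,
      Set.mem_compl_iff]
    by_cases hy : ∃ j, y j ∈ S
    · rw [firstIdx_eq_iff hy]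
      simp [hy]
    · have h0 : firstIdx S y = 0 := by
        rw [firstIdx, Nat.nth_zero]
        have : (Set.ofPred fun j => y j ∈ S) = ∅ := by
          ext j; simpa using fun h => hy ⟨j, h⟩
        rw [this, Nat.sInf_empty]
      simp [hy, h0, eq_comm]
  rw [this]
  exact ((measurableSet_hit hS).inter (measurableSet_avoid hS k)).union
    ((measurableSet_hit hS).compl.inter (MeasurableSet.const _))

theorem measurable_of_firstIdx {F : Type*} [MeasurableSpace F] (hS : MeasurableSet S)
    {f : ℕ → (ℕ → E) → F} (hf : ∀ k, Measurable (f k)) : Measurable fun y => f (firstIdx S y) y :=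
  (measurable_from_prod_countable_right (f := fun p : ℕ × (ℕ → E) => f p.1 p.2) hf).comp
    ((measurable_firstIdx hS).prodMk measurable_id)

theorem measurable_firstVal (hS : MeasurableSet S) : Measurable (firstVal S : (ℕ → E) → E) :=
  measurable_of_firstIdx hS (f := fun k y => y k) fun k => measurable_pi_apply k

theorem measurable_regen (hS : MeasurableSet S) : Measurable (regen S : (ℕ → E) → ℕ → E) :=
  measurable_of_firstIdx hS (f := fun k y => shift (k + 1) y) fun k => measurable_shift (k + 1)

theorem measurable_preSum (hS : MeasurableSet S) (hd : Measurable d) :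
    Measurable (preSum S d : (ℕ → E) → ℝ) :=
  measurable_of_firstIdx hS (f := fun k y => ∑ i ∈ Finset.range k, d (y i)) fun _ =>
    Finset.measurable_sum _ fun i _ => hd.comp (measurable_pi_apply i)

/-- This is the second Borel–Cantelli lemma: the events are independent with a constant positive
probability, whose sum diverges. -/
theorem ae_infinite (hS : MeasurableSet S) (hρ : ρ S ≠ 0) :
    ∀ᵐ y ∂(seqLaw ρ), {j : ℕ | y j ∈ S}.Infinite := by
  have hm : ∀ j : ℕ, MeasurableSet ((fun y : ℕ → E => y j) ⁻¹' S) := fun j =>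
    measurable_pi_apply j hS
  have hind : ProbabilityTheory.iIndepSet (fun j : ℕ => (fun y : ℕ → E => y j) ⁻¹' S)
      (seqLaw ρ) := by
    rw [ProbabilityTheory.iIndepSet_iff_meas_biInter hm]
    intro s
    exact (iIndepFun_eval ρ).measure_inter_preimage_eq_mul s fun _ _ => hS
  have hmeas : ∀ j : ℕ, seqLaw ρ ((fun y : ℕ → E => y j) ⁻¹' S) = ρ S := fun j =>
    (measurePreserving_eval ρ j).measure_preimage hS.nullMeasurableSet
  have h1 := ProbabilityTheory.measure_limsup_eq_one hm hind (by
    simp only [hmeas]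
    exact ENNReal.tsum_const_eq_top_of_ne_zero hρ)
  have h2 : ∀ᵐ y ∂(seqLaw ρ), y ∈ limsup (fun j : ℕ => (fun y : ℕ → E => y j) ⁻¹' S) atTop := by
    rw [← prob_compl_eq_zero_iff (MeasurableSet.measurableSet_limsup hm)] at h1
    exact h1
  filter_upwards [h2] with y hy
  rw [mem_limsup_iff_frequently_mem, Nat.frequently_atTop_iff_infinite] at hy
  exact hy

/-- Conditioning is normalised restriction; the form with the factor `ρ S` avoids dividing. -/
theorem prod_inter_fst (hρ : ρ S ≠ 0) {F : Type*} [MeasurableSpace F]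
    (ν : Measure F) [SFinite ν] {D : Set (E × F)} (hD : MeasurableSet D) :
    (ρ.prod ν) (D ∩ S ×ˢ Set.univ) = ρ S * ((ProbabilityTheory.cond ρ S).prod ν) D := by
  rw [ProbabilityTheory.cond, Measure.prod_smul_left, Measure.smul_apply, smul_eq_mul, ← mul_assoc,
    ENNReal.mul_inv_cancel hρ (measure_ne_top _ _), one_mul, ← Measure.restrict_apply hD,
    ← Measure.prod_restrict, Measure.restrict_univ]

/-- The three parts of a sequence of independent trials, before, at and after the first trial with
outcome in `S`, are independent. -/
theorem map_preSum_firstVal_regen (hS : MeasurableSet S) (hρ : ρ S ≠ 0) (hd : Measurable d) :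
    (seqLaw ρ).map (fun y => (preSum S d y, (firstVal S y, regen S y)))
      = ((seqLaw ρ).map (preSum S d)).prod ((ProbabilityTheory.cond ρ S).prod (seqLaw ρ)) := by
  have := ProbabilityTheory.cond_isProbabilityMeasure hρ
  have hW := measurable_preSum hS hd
  have hV := (measurable_firstVal hS).prodMk (measurable_regen hS)
  have := Measure.isProbabilityMeasure_map (μ := seqLaw ρ) hW.aemeasurable
  -- `a k B` is the probability that the first `k` trials fail with sum in `B`. Splitting by the
  -- value `k` of the first index gives events that separate into a part on the first `k` trials and
  -- a part on the rest.
  set a : ℕ → Set ℝ → ENNReal := fun k B =>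
    seqLaw ρ {y | (∀ i < k, y i ∉ S) ∧ ∑ i ∈ Finset.range k, d (y i) ∈ B} with ha
  have key : ∀ (B : Set ℝ) (D : Set (E × (ℕ → E))), MeasurableSet B → MeasurableSet D →
      seqLaw ρ {y | preSum S d y ∈ B ∧ (firstVal S y, regen S y) ∈ D}
        = (∑' k, a k B) * (ρ S * ((ProbabilityTheory.cond ρ S).prod (seqLaw ρ)) D) := by
    intro B D hB hD
    have hDm : MeasurableSet (D ∩ S ×ˢ (Set.univ : Set (ℕ → E))) :=
      hD.inter (hS.prod MeasurableSet.univ)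
    have hk : ∀ k, seqLaw ρ ({y | (∀ i < k, y i ∉ S) ∧ ∑ i ∈ Finset.range k, d (y i) ∈ B}
        ∩ {y | (y k, shift (k + 1) y) ∈ D ∩ S ×ˢ (Set.univ : Set (ℕ → E))})
        = a k B * (ρ S * ((ProbabilityTheory.cond ρ S).prod (seqLaw ρ)) D) := by
      intro k
      have hI := (indepFun_prefix_shift ρ k).measure_inter_preimage_eq_mul
        {v : Fin k → E | (∀ i, v i ∉ S) ∧ ∑ i, d (v i) ∈ B}
        ((fun z : ℕ → E => (z 0, shift 1 z)) ⁻¹' (D ∩ S ×ˢ (Set.univ : Set (ℕ → E))))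
        (by
          have h1 : MeasurableSet {v : Fin k → E | ∀ i, v i ∉ S} := by
            rw [Set.ofPred_forall]
            exact MeasurableSet.iInter fun i =>
              show MeasurableSet ((fun v : Fin k → E => v i) ⁻¹' Sᶜ) from
                measurable_pi_apply i hS.compl
          have h2 : Measurable fun v : Fin k → E => ∑ i, d (v i) :=
            Finset.measurable_sum _ fun i _ => hd.comp (measurable_pi_apply i)
          exact h1.inter (h2 hB))
        ((measurePreserving_head_tail ρ).measurable hDm)
      have e1 : (fun (y : ℕ → E) (i : Fin k) => y i) ⁻¹'
          {v : Fin k → E | (∀ i, v i ∉ S) ∧ ∑ i, d (v i) ∈ B}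
          = {y | (∀ i < k, y i ∉ S) ∧ ∑ i ∈ Finset.range k, d (y i) ∈ B} := by
        ext y
        simp only [Set.mem_preimage, Set.mem_ofPred_eq, Fin.forall_iff,
          Fin.sum_univ_eq_sum_range (fun i => d (y i)) k]
      have e2 : shift k ⁻¹' ((fun z : ℕ → E => (z 0, shift 1 z)) ⁻¹'
          (D ∩ S ×ˢ (Set.univ : Set (ℕ → E))))
          = {y : ℕ → E | (y k, shift (k + 1) y) ∈ D ∩ S ×ˢ (Set.univ : Set (ℕ → E))} := by
        ext y
        have : shift 1 (shift k y) = shift (k + 1) y := by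
          funext j; simp [shift, add_assoc]
        simp only [Set.mem_preimage, this]
        rfl
      rw [e1, e2] at hI
      rw [hI, ← e2, (measurePreserving_shift ρ k).measure_preimage
        ((measurePreserving_head_tail ρ).measurable hDm).nullMeasurableSet,
        (measurePreserving_head_tail ρ).measure_preimage hDm.nullMeasurableSet,
        prod_inter_fst ρ hρ _ hD]
    rw [← ENNReal.tsum_mul_right, ← tsum_congr hk, ← measure_iUnion]
    · refine measure_congr ?_
      filter_upwards [ae_infinite ρ hS hρ] with y hy
      have hex : ∃ j, y j ∈ S := hy.nonempty
      refine propext ?_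
      change (preSum S d y ∈ B ∧ (firstVal S y, regen S y) ∈ D) ↔ y ∈ ⋃ k, _
      simp only [Set.mem_iUnion, Set.mem_inter_iff, Set.mem_ofPred_eq, Set.mem_prod, Set.mem_univ,
        and_true]
      constructor
      · rintro ⟨h1, h2⟩
        exact ⟨firstIdx S y, ⟨fun i hi => notMem_of_lt_firstIdx hex hi, h1⟩, h2, firstIdx_mem hex⟩
      · rintro ⟨k, ⟨h1, h2⟩, h3, h4⟩
        have : firstIdx S y = k := (firstIdx_eq_iff hex k).2 ⟨h4, h1⟩
        subst this
        exact ⟨h2, h3⟩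
    · intro k l hkl
      refine Set.disjoint_left.2 fun y hy hy' => ?_
      rcases lt_or_gt_of_ne hkl with h | h
      · exact hy'.1.1 k h hy.2.2.1
      · exact hy.1.1 l h hy'.2.2.1
    · intro k
      refine MeasurableSet.inter ?_ ?_
      · have h1 : MeasurableSet {y : ℕ → E | ∀ i < k, y i ∉ S} := by
          simp only [Set.ofPred_forall]
          exact MeasurableSet.iInter fun i => MeasurableSet.iInter fun _ =>
            show MeasurableSet ((fun y : ℕ → E => y i) ⁻¹' Sᶜ) from measurable_pi_apply i hS.compl
        have h2 : Measurable fun y : ℕ → E => ∑ i ∈ Finset.range k, d (y i) :=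
          Finset.measurable_sum _ fun i _ => hd.comp (measurable_pi_apply i)
        exact h1.inter (h2 hB)
      · exact ((measurable_pi_apply k).prodMk (measurable_shift (k + 1))) hDm
  refine (Measure.prod_eq fun B D hB hD => ?_).symm
  rw [Measure.map_apply (hW.prodMk hV) (hB.prod hD), Measure.map_apply hW hB]
  have e1 : (fun y => (preSum S d y, (firstVal S y, regen S y))) ⁻¹' (B ×ˢ D)
      = {y | preSum S d y ∈ B ∧ (firstVal S y, regen S y) ∈ D} := rfl
  -- Taking `D` to be everything identifies `(∑' k, a k B) * ρ S` with the law of `preSum`, so the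
  -- series never has to be evaluated.
  have e2 : preSum S d ⁻¹' B = {y | preSum S d y ∈ B ∧ (firstVal S y, regen S y) ∈ Set.univ} := by
    ext y; simp
  rw [e1, e2, key B D hB hD, key B Set.univ hB MeasurableSet.univ, measure_univ, mul_one, mul_assoc]

/-! ### The sum that precedes the first success -/

/-- The head and the tail of the sequence are independent, and the failure indicator is idempotent,
so squaring leaves exactly one factorising cross term. -/
theorem memLp_failStep (hS : MeasurableSet S) (hd : MemLp d 2 ρ) {Z : (ℕ → E) → ℝ}
    (hZ : MemLp Z 2 (seqLaw ρ)) :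
    MemLp (failStep S d Z) 2 (seqLaw ρ) ∧
    ∫ y, failStep S d Z y ∂(seqLaw ρ) = ∫ e in Sᶜ, d e ∂ρ + ρ.real Sᶜ * ∫ y, Z y ∂(seqLaw ρ) ∧
    ∫ y, failStep S d Z y ^ 2 ∂(seqLaw ρ) = ∫ e in Sᶜ, d e ^ 2 ∂ρ
      + 2 * (∫ e in Sᶜ, d e ∂ρ) * (∫ y, Z y ∂(seqLaw ρ))
      + ρ.real Sᶜ * ∫ y, Z y ^ 2 ∂(seqLaw ρ) := by
  have hmp := measurePreserving_head_tail ρ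
  have hi1 : Integrable (Sᶜ.indicator d) ρ := (hd.integrable one_le_two).indicator hS.compl
  have hi2 : Integrable (Sᶜ.indicator fun e => d e ^ 2) ρ := hd.integrable_sq.indicator hS.compl
  have hi0 : Integrable (Sᶜ.indicator (1 : E → ℝ)) ρ :=
    (integrable_const (1 : ℝ)).indicator hS.compl
  have hZ1 := hZ.integrable one_le_two
  have hZ2 := hZ.integrable_sq
  have hZ0 : Integrable (fun _ : ℕ → E => (1 : ℝ)) (seqLaw ρ) := integrable_const _
  have p1 := hi1.mul_prod hZ0
  have p2 := hi0.mul_prod hZ1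
  have q1 := hi2.mul_prod hZ0
  have q2 := hi1.mul_prod hZ1
  have q3 := hi0.mul_prod hZ2
  have hf1 : failStep S d Z = (fun z : E × (ℕ → E) => Sᶜ.indicator d z.1 * 1
      + Sᶜ.indicator 1 z.1 * Z z.2) ∘ fun y => (y 0, shift 1 y) := by
    funext y; simp [failStep]
  have hf2 : (fun y => failStep S d Z y ^ 2) = (fun z : E × (ℕ → E) =>
      (Sᶜ.indicator (fun e => d e ^ 2) z.1 * 1 + 2 * (Sᶜ.indicator d z.1 * Z z.2))
        + Sᶜ.indicator 1 z.1 * Z z.2 ^ 2) ∘ fun y => (y 0, shift 1 y) := by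
    funext y
    by_cases h : y 0 ∈ S <;> simp [failStep, h]; ring
  have hI1 : Integrable (fun z : E × (ℕ → E) => Sᶜ.indicator d z.1 * 1
      + Sᶜ.indicator 1 z.1 * Z z.2) (ρ.prod (seqLaw ρ)) := p1.add p2
  have hI0 : Integrable (fun z : E × (ℕ → E) => Sᶜ.indicator (fun e => d e ^ 2) z.1 * 1
      + 2 * (Sᶜ.indicator d z.1 * Z z.2)) (ρ.prod (seqLaw ρ)) := q1.add (q2.const_mul 2)
  have hI2 : Integrable (fun z : E × (ℕ → E) => (Sᶜ.indicator (fun e => d e ^ 2) z.1 * 1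
      + 2 * (Sᶜ.indicator d z.1 * Z z.2)) + Sᶜ.indicator 1 z.1 * Z z.2 ^ 2)
      (ρ.prod (seqLaw ρ)) := hI0.add q3
  have hint : ∀ {g : E × (ℕ → E) → ℝ}, Integrable g (ρ.prod (seqLaw ρ)) →
      ∫ y, (g ∘ fun y => (y 0, shift 1 y)) y ∂(seqLaw ρ) = ∫ z, g z ∂(ρ.prod (seqLaw ρ)) := by
    intro g hg
    rw [← hmp.map_eq] at hg ⊢
    rw [integral_map hmp.measurable.aemeasurable hg.aestronglyMeasurable]
    rfl
  refine ⟨?_, ?_, ?_⟩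
  · have hm : AEStronglyMeasurable (failStep S d Z) (seqLaw ρ) := by
      rw [hf1]
      exact hI1.aestronglyMeasurable.comp_measurePreserving hmp
    rw [memLp_two_iff_integrable_sq hm, hf2]
    exact hmp.integrable_comp_of_integrable hI2
  · rw [hf1, hint hI1, integral_add p1 p2,
      integral_prod_mul (Sᶜ.indicator d) fun _ => (1 : ℝ), integral_prod_mul (Sᶜ.indicator 1) Z,
      integral_indicator hS.compl, integral_indicator_one hS.compl]
    simp
  · rw [hf2, hint hI2, integral_add hI0 q3, integral_add q1 (q2.const_mul 2),
      integral_const_mul, integral_prod_mul (Sᶜ.indicator fun e => d e ^ 2) fun _ => (1 : ℝ),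
      integral_prod_mul (Sᶜ.indicator d) Z, integral_prod_mul (Sᶜ.indicator 1) fun y => Z y ^ 2,
      integral_indicator hS.compl, integral_indicator hS.compl, integral_indicator_one hS.compl]
    simp [mul_assoc]

/-- The moments of the sum over the trials that precede the first success. -/
theorem moments_preSum (hS : MeasurableSet S) (hρ : ρ S ≠ 0) (hdm : Measurable d)
    (hd : MemLp d 2 ρ) (hd0 : ∀ᵐ e ∂ρ, 0 ≤ d e) :
    MemLp (preSum S d) 2 (seqLaw ρ) ∧
    ρ.real S * ∫ y, preSum S d y ∂(seqLaw ρ) = ∫ e in Sᶜ, d e ∂ρ ∧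
    ρ.real S * ∫ y, preSum S d y ^ 2 ∂(seqLaw ρ) = ∫ e in Sᶜ, d e ^ 2 ∂ρ
      + 2 * (∫ e in Sᶜ, d e ∂ρ) * (∫ y, preSum S d y ∂(seqLaw ρ)) := by
  set a := ∫ e in Sᶜ, d e ∂ρ with ha
  set b := ∫ e in Sᶜ, d e ^ 2 ∂ρ with hb
  have ha0 : 0 ≤ a := integral_nonneg_of_ae (ae_restrict_of_ae hd0)
  have hb0 : 0 ≤ b := integral_nonneg fun e => sq_nonneg _
  set q := ρ.real Sᶜ with hq
  have hp : 0 < ρ.real S := ENNReal.toReal_pos hρ (measure_ne_top _ _)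
  have hpq : ρ.real S = 1 - q := by rw [hq, probReal_compl_eq_one_sub hS]; ring
  rw [hpq] at hp ⊢
  have hq0 : 0 ≤ q := measureReal_nonneg
  set Zm : ℕ → (ℕ → E) → ℝ := fun m => (failStep S d)^[m] 0 with hZm
  have hsucc : ∀ m, Zm (m + 1) = failStep S d (Zm m) := fun m =>
    Function.iterate_succ_apply' _ _ _
  -- `U` and `V` are the fixed points of the recursions for the first two moments. The maps are
  -- increasing because `a` and `q` are nonnegative, so iterates started from 0 stay below them.
  set U := a / (1 - q) with hU
  set V := (b + 2 * a * U) / (1 - q) with hV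
  have hUeq : a + q * U = U := by rw [hU]; field_simp; ring
  have hVeq : b + 2 * a * U + q * V = V := by rw [hV]; field_simp; ring
  have hU0 : 0 ≤ U := by positivity
  have hV0 : 0 ≤ V := by positivity
  have hbound : ∀ m, MemLp (Zm m) 2 (seqLaw ρ) ∧ ∫ y, Zm m y ∂(seqLaw ρ) ≤ U ∧
      ∫ y, Zm m y ^ 2 ∂(seqLaw ρ) ≤ V := by
    intro m
    induction m with
    | zero => simp [hZm, hU0, hV0]
    | succ m ih =>
      obtain ⟨i1, i2, i3⟩ := ih
      obtain ⟨j1, j2, j3⟩ := memLp_failStep ρ hS hd i1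
      rw [hsucc]
      refine ⟨j1, ?_, ?_⟩
      · rw [j2, ← hUeq]
        gcongr
      · rw [j3, ← hVeq]
        gcongr
  have hinf := ae_infinite ρ hS hρ
  have hW : AEStronglyMeasurable (preSum S d) (seqLaw ρ) :=
    (measurable_preSum hS hdm).aestronglyMeasurable
  have hL2 : MemLp (preSum S d) 2 (seqLaw ρ) := by
    rw [memLp_two_iff_integrable_sq hW]
    refine ⟨hW.pow 2, ?_⟩
    rw [hasFiniteIntegral_iff_ofReal (ae_of_all _ fun y => sq_nonneg _)]
    -- The iterates are eventually equal to `preSum`, so Fatou's lemma transfers the uniform bound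
    -- `V`.
    have hlim : ∀ᵐ y ∂(seqLaw ρ), ENNReal.ofReal (preSum S d y ^ 2)
        ≤ liminf (fun m => ENNReal.ofReal (Zm m y ^ 2)) atTop := by
      filter_upwards [hinf] with y hy
      refine le_of_eq (Tendsto.liminf_eq ?_).symm
      refine tendsto_const_nhds.congr' ?_
      filter_upwards [eventually_gt_atTop (firstIdx S y)] with m hm
      rw [hZm]
      simp only
      rw [iterate_failStep_eq m hy hm]
    refine lt_of_le_of_lt (lintegral_mono_ae hlim) ?_
    refine lt_of_le_of_lt (lintegral_liminf_le' fun m =>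
      ((hbound m).1.aestronglyMeasurable.aemeasurable.pow_const 2).ennreal_ofReal) ?_
    refine lt_of_le_of_lt (liminf_le_of_frequently_le'
      (Frequently.of_forall fun m => ?_) : _ ≤ ENNReal.ofReal V) ENNReal.ofReal_lt_top
    rw [← ofReal_integral_eq_lintegral_ofReal (hbound m).1.integrable_sq
      (ae_of_all _ fun y => sq_nonneg _)]
    exact ENNReal.ofReal_le_ofReal (hbound m).2.2
  -- With square integrability established, the fixed point equation may be integrated and solved
  -- for the moments.
  have heq : preSum S d =ᵐ[seqLaw ρ] failStep S d (preSum S d) := by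
    filter_upwards [hinf] with y hy
    obtain ⟨j, hj⟩ := (infinite_shift hy 1).nonempty
    exact preSum_eq_failStep ⟨j, by simpa [shift, add_comm] using hj⟩
  obtain ⟨-, j2, j3⟩ := memLp_failStep ρ hS hd hL2
  rw [← integral_congr_ae heq] at j2
  have e3 := integral_congr_ae (heq.fun_comp fun t => t ^ 2)
  simp only [Function.comp_def] at e3
  rw [← e3] at j3
  exact ⟨hL2, by linarith, by linarith⟩

end Renewal

/-! ### Cycles -/

section Cycles

theorem indepFun_comp_measurePreserving {Ω F G : Type*} [MeasurableSpace Ω] [MeasurableSpace F]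
    [MeasurableSpace G] {μ : Measure Ω} {T : Ω → Ω} (hT : MeasurePreserving T μ μ)
    {f : Ω → F} {g : Ω → G} (hf : Measurable f) (hg : Measurable g)
    (h : ProbabilityTheory.IndepFun f g μ) :
    ProbabilityTheory.IndepFun (f ∘ T) (g ∘ T) μ := by
  rw [ProbabilityTheory.indepFun_iff_measure_inter_preimage_eq_mul] at h ⊢
  intro A B hA hB
  have h1 := hT.measure_preimage (hf hA).nullMeasurableSet
  have h2 := hT.measure_preimage (hg hB).nullMeasurableSet
  have h3 := hT.measure_preimage ((hf hA).inter (hg hB)).nullMeasurableSet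
  rw [Set.preimage_comp, Set.preimage_comp, h1, h2, ← h A B hA hB, ← h3]
  rfl

variable {E : Type*} [MeasurableSpace E] (ρ : Measure E) [IsProbabilityMeasure ρ]
  {S : Set E} {d t : E → ℝ}

/-- The zero function is a dummy summand: only the marginal of the first success is extracted. -/
theorem measurePreserving_firstVal (hS : MeasurableSet S) (hρ : ρ S ≠ 0) :
    MeasurePreserving (firstVal S) (seqLaw ρ) (ProbabilityTheory.cond ρ S) := by
  have := ProbabilityTheory.cond_isProbabilityMeasure hρ
  have hd : Measurable fun _ : E => (0 : ℝ) := measurable_const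
  have hW := measurable_preSum hS hd
  have := Measure.isProbabilityMeasure_map (μ := seqLaw ρ) hW.aemeasurable
  refine ⟨measurable_firstVal hS, ?_⟩
  have h := congrArg (fun m => m.map fun z => z.2.1) (map_preSum_firstVal_regen ρ hS hρ hd)
  rw [Measure.map_map (by fun_prop)
    (hW.prodMk ((measurable_firstVal hS).prodMk (measurable_regen hS)))] at h
  refine h.trans ?_
  change Measure.map (Prod.fst ∘ Prod.snd) _ = _
  rw [← Measure.map_map measurable_fst measurable_snd]
  simp

theorem measurePreserving_regen (hS : MeasurableSet S) (hρ : ρ S ≠ 0) :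
    MeasurePreserving (regen S) (seqLaw ρ) (seqLaw ρ) := by
  have := ProbabilityTheory.cond_isProbabilityMeasure hρ
  have hd : Measurable fun _ : E => (0 : ℝ) := measurable_const
  have hW := measurable_preSum hS hd
  have := Measure.isProbabilityMeasure_map (μ := seqLaw ρ) hW.aemeasurable
  refine ⟨measurable_regen hS, ?_⟩
  have h := congrArg (fun m => m.map fun z => z.2.2) (map_preSum_firstVal_regen ρ hS hρ hd)
  rw [Measure.map_map (by fun_prop)
    (hW.prodMk ((measurable_firstVal hS).prodMk (measurable_regen hS)))] at h
  refine h.trans ?_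
  change Measure.map (Prod.snd ∘ Prod.snd) _ = _
  rw [← Measure.map_map measurable_snd measurable_snd]
  simp

/-- The data of the block of trials up to the first one with outcome in `S`. -/
def block (S : Set E) (d : E → ℝ) (y : ℕ → E) : ℝ × E := (preSum S d y, firstVal S y)

theorem measurable_block (hS : MeasurableSet S) (hd : Measurable d) : Measurable (block S d) :=
  (measurable_preSum hS hd).prodMk (measurable_firstVal hS)

theorem indepFun_preSum_firstVal (hS : MeasurableSet S) (hρ : ρ S ≠ 0) (hd : Measurable d) :
    ProbabilityTheory.IndepFun (preSum S d) (firstVal S) (seqLaw ρ) := by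
  have := ProbabilityTheory.cond_isProbabilityMeasure hρ
  have h : ProbabilityTheory.IndepFun (preSum S d) (fun y => (firstVal S y, regen S y))
      (seqLaw ρ) := by
    have hV := (measurable_firstVal hS).prodMk (measurable_regen hS)
    have hW := measurable_preSum hS hd
    have := Measure.isProbabilityMeasure_map (μ := seqLaw ρ) hW.aemeasurable
    rw [ProbabilityTheory.indepFun_iff_map_prod_eq_prod_map_map hW.aemeasurable hV.aemeasurable,
      map_preSum_firstVal_regen ρ hS hρ hd]
    congr 1
    have h2 := congrArg (fun m => m.map Prod.snd) (map_preSum_firstVal_regen ρ hS hρ hd)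
    rw [Measure.map_map measurable_snd (hW.prodMk hV)] at h2
    simp only [Measure.map_snd_prod, measure_univ, one_smul] at h2
    exact h2.symm
  exact h.comp measurable_id measurable_fst

theorem indepFun_block_regen (hS : MeasurableSet S) (hρ : ρ S ≠ 0) (hd : Measurable d) :
    ProbabilityTheory.IndepFun (block S d) (regen S) (seqLaw ρ) := by
  have := ProbabilityTheory.cond_isProbabilityMeasure hρ
  have hW := measurable_preSum hS hd
  have hB := measurable_block hS hd
  have := Measure.isProbabilityMeasure_map (μ := seqLaw ρ) hW.aemeasurable
  have hL : (seqLaw ρ).map (block S d)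
      = ((seqLaw ρ).map (preSum S d)).prod (ProbabilityTheory.cond ρ S) := by
    have := (ProbabilityTheory.indepFun_iff_map_prod_eq_prod_map_map hW.aemeasurable
      (measurable_firstVal hS).aemeasurable).1 (indepFun_preSum_firstVal ρ hS hρ hd)
    rw [(measurePreserving_firstVal ρ hS hρ).map_eq] at this
    exact this
  rw [ProbabilityTheory.indepFun_iff_map_prod_eq_prod_map_map hB.aemeasurable
    (measurable_regen hS).aemeasurable, (measurePreserving_regen ρ hS hρ).map_eq, hL]
  have h := congrArg (fun m => m.map MeasurableEquiv.prodAssoc.symm)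
    (map_preSum_firstVal_regen ρ hS hρ hd)
  rw [Measure.map_map (MeasurableEquiv.measurable _)
    (hW.prodMk ((measurable_firstVal hS).prodMk (measurable_regen hS))),
    ← Measure.prodAssoc_prod, Measure.map_map (MeasurableEquiv.measurable _)
      (MeasurableEquiv.measurable _), MeasurableEquiv.symm_comp_self, Measure.map_id] at h
  exact h

/-- The reward of a cycle sees two consecutive blocks; this makes it independent of everything after
them, hence of rewards at distance at least two. -/
theorem indepFun_block_pair (hS : MeasurableSet S) (hρ : ρ S ≠ 0) (hd : Measurable d) :
    ProbabilityTheory.IndepFun (fun y => (block S d y, block S d (regen S y)))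
      (regen S ∘ regen S) (seqLaw ρ) := by
  have hB := measurable_block hS hd
  have hR := measurable_regen hS
  have hmp := measurePreserving_regen ρ hS hρ
  have := Measure.isProbabilityMeasure_map (μ := seqLaw ρ) hB.aemeasurable
  have h1 := (ProbabilityTheory.indepFun_iff_map_prod_eq_prod_map_map hB.aemeasurable
    hR.aemeasurable).1 (indepFun_block_regen ρ hS hρ hd)
  rw [hmp.map_eq] at h1
  have hBR : ProbabilityTheory.IndepFun (block S d) (block S d ∘ regen S) (seqLaw ρ) :=
    (indepFun_block_regen ρ hS hρ hd).comp measurable_id hB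
  have h2 := (ProbabilityTheory.indepFun_iff_map_prod_eq_prod_map_map hB.aemeasurable
    (hB.comp hR).aemeasurable).1 hBR
  rw [← Measure.map_map hB hR, hmp.map_eq] at h2
  have h2' : (seqLaw ρ).map (fun y => (block S d y, block S d (regen S y)))
    = ((seqLaw ρ).map (block S d)).prod ((seqLaw ρ).map (block S d)) := h2
  have hpm : Measurable fun y => (block S d y, block S d (regen S y)) := hB.prodMk (hB.comp hR)
  rw [ProbabilityTheory.indepFun_iff_map_prod_eq_prod_map_map
    hpm.aemeasurable (hR.comp hR).aemeasurable, h2', (hmp.comp hmp).map_eq]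
  have h3 := congrArg (fun m => m.map (Prod.map id fun y => (block S d y, regen S y))) h1
  rw [Measure.map_map (measurable_id.prodMap (hB.prodMk hR)) (hB.prodMk hR),
    ← Measure.map_prod_map _ _ measurable_id (hB.prodMk hR), h1, Measure.map_id] at h3
  have h4 := congrArg (fun m => m.map MeasurableEquiv.prodAssoc.symm) h3
  rw [← Measure.prodAssoc_prod, Measure.map_map (MeasurableEquiv.measurable _)
      (MeasurableEquiv.measurable _), Measure.map_map (MeasurableEquiv.measurable _)
      ((measurable_id.prodMap (hB.prodMk hR)).comp (hB.prodMk hR)),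
    MeasurableEquiv.symm_comp_self, Measure.map_id] at h4
  exact h4

/-- The strong law of large numbers for a reward that depends on two consecutive blocks. -/
theorem strong_law_blocks (hS : MeasurableSet S) (hρ : ρ S ≠ 0) (hd : Measurable d)
    {ψ : (ℝ × E) × (ℝ × E) → ℝ} (hψ : Measurable ψ)
    (hint : Integrable (fun y => ψ (block S d y, block S d (regen S y))) (seqLaw ρ)) :
    ∀ᵐ y ∂(seqLaw ρ), Tendsto (fun k : ℕ => (∑ i ∈ Finset.range (2 * k),
        ψ (block S d ((regen S)^[i] y), block S d (regen S ((regen S)^[i] y)))) / k) atTop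
      (𝓝 (2 * ∫ y, ψ (block S d y, block S d (regen S y)) ∂(seqLaw ρ))) := by
  have hB := measurable_block hS hd
  have hR := measurable_regen hS
  have hmp := measurePreserving_regen ρ hS hρ
  set f : (ℕ → E) → ℝ := fun y => ψ (block S d y, block S d (regen S y)) with hf
  have hfm : Measurable f := hψ.comp (hB.prodMk (hB.comp hR))
  have hind2 : ∀ m, ProbabilityTheory.IndepFun f (f ∘ (regen S)^[m + 2]) (seqLaw ρ) := by
    intro m
    rw [Function.iterate_add]
    exact (indepFun_block_pair ρ hS hρ hd).comp (φ := ψ) (ψ := f ∘ (regen S)^[m]) hψ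
      (hfm.comp (hR.iterate m))
  have hlt : ∀ i j, i + 2 ≤ j →
      ProbabilityTheory.IndepFun (f ∘ (regen S)^[i]) (f ∘ (regen S)^[j]) (seqLaw ρ) := by
    intro i j hij
    obtain ⟨m, rfl⟩ := Nat.exists_eq_add_of_le hij
    have h := indepFun_comp_measurePreserving (hmp.iterate i) hfm (hfm.comp (hR.iterate (m + 2)))
      (hind2 m)
    have e : i + 2 + m = m + 2 + i := by omega
    rw [e, Function.iterate_add (regen S) (m + 2) i]
    exact h
  -- Indices of equal parity differ by at least two. Pairwise independence is all that the strong
  -- law requires.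
  have hpair : ∀ r, Pairwise (Function.onFun (fun g h => ProbabilityTheory.IndepFun g h (seqLaw ρ))
      fun k : ℕ => f ∘ (regen S)^[2 * k + r]) := by
    intro r i j hij
    rcases lt_or_gt_of_ne hij with h | h
    · exact hlt _ _ (by omega)
    · exact (hlt _ _ (by omega)).symm
  have hid : ∀ i j, ProbabilityTheory.IdentDistrib (f ∘ (regen S)^[i]) (f ∘ (regen S)^[j])
      (seqLaw ρ) (seqLaw ρ) := by
    intro i j
    refine ⟨(hfm.comp (hR.iterate i)).aemeasurable, (hfm.comp (hR.iterate j)).aemeasurable, ?_⟩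
    rw [← Measure.map_map hfm (hR.iterate i), ← Measure.map_map hfm (hR.iterate j),
      (hmp.iterate i).map_eq, (hmp.iterate j).map_eq]
  have hintr : ∀ r, Integrable (f ∘ (regen S)^[r]) (seqLaw ρ) := fun r =>
    (hid r 0).integrable_iff.2 hint
  have hE : ∀ r, ∫ y, (f ∘ (regen S)^[r]) y ∂(seqLaw ρ) = ∫ y, f y ∂(seqLaw ρ) := fun r =>
    (hid r 0).integral_eq
  have hlaw : ∀ r, ∀ᵐ y ∂(seqLaw ρ), Tendsto (fun k : ℕ =>
      (∑ i ∈ Finset.range k, (f ∘ (regen S)^[2 * i + r]) y) / k) atTop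
      (𝓝 (∫ y, f y ∂(seqLaw ρ))) := by
    intro r
    have := ProbabilityTheory.strong_law_ae_real (fun k : ℕ => f ∘ (regen S)^[2 * k + r])
      (hintr _) (hpair r) (fun i => hid _ _)
    rwa [hE] at this
  filter_upwards [hlaw 0, hlaw 1] with y h0 h1
  have h := h0.add h1
  rw [← two_mul] at h
  refine h.congr fun k => ?_
  rw [← add_div]
  congr 1
  -- The even and the odd sums interleave to a sum of `2 * k` terms; division by `k` explains the
  -- factor 2 in the limit.
  induction k with
  | zero => simp
  | succ k ih =>
    rw [Finset.sum_range_succ, Finset.sum_range_succ, mul_add, mul_one, Finset.sum_range_succ,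
      Finset.sum_range_succ, ← ih]
    simp only [Function.comp, hf, add_zero]
    ring

/-- The area under the age curve over a cycle, in terms of the block of the update that precedes
the cycle and the block of the cycle. -/
def areaReward (d t : E → ℝ) (b : (ℝ × E) × (ℝ × E)) : ℝ :=
  d b.1.2 * (b.2.1 + t b.2.2) + (b.2.1 ^ 2 / 2 + b.2.1 * t b.2.2 + d b.2.2 ^ 2 / 2)

/-- The length of a cycle in terms of its block. -/
def lengthReward (d : E → ℝ) (b : (ℝ × E) × (ℝ × E)) : ℝ := b.2.1 + d b.2.2

theorem integral_firstVal (hS : MeasurableSet S) (hρ : ρ S ≠ 0) {f : E → ℝ} (hf : Measurable f) :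
    ∫ y, f (firstVal S y) ∂(seqLaw ρ) = ∫ e, f e ∂(ProbabilityTheory.cond ρ S) := by
  rw [← (measurePreserving_firstVal ρ hS hρ).map_eq,
    integral_map (measurable_firstVal hS).aemeasurable hf.aestronglyMeasurable]

theorem memLp_firstVal (hS : MeasurableSet S) (hρ : ρ S ≠ 0) {f : E → ℝ} {p : ENNReal}
    (hf : MemLp f p (ρ.restrict S)) : MemLp (fun y => f (firstVal S y)) p (seqLaw ρ) :=
  (hf.smul_measure (ENNReal.inv_ne_top.2 hρ)).comp_measurePreserving (measurePreserving_firstVal ρ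
      hS hρ)

/-- The expectations of the area under the age curve over a cycle and of the length of a cycle. -/
theorem integral_rewards (hS : MeasurableSet S) (hρ : ρ S ≠ 0) (hdm : Measurable d)
    (hd : MemLp d 2 ρ) (hd0 : ∀ᵐ e ∂ρ, 0 ≤ d e) (htm : Measurable t) (ht : IntegrableOn t S ρ) :
    Integrable (fun y => areaReward d t (block S d y, block S d (regen S y))) (seqLaw ρ) ∧
    Integrable (fun y => lengthReward d (block S d y, block S d (regen S y))) (seqLaw ρ) ∧
    ∫ y, areaReward d t (block S d y, block S d (regen S y)) ∂(seqLaw ρ)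
      = (∫ y, d (firstVal S y) ∂(seqLaw ρ))
          * ((∫ y, preSum S d y ∂(seqLaw ρ)) + ∫ y, t (firstVal S y) ∂(seqLaw ρ))
        + ((∫ y, preSum S d y ^ 2 ∂(seqLaw ρ)) / 2
          + (∫ y, preSum S d y ∂(seqLaw ρ)) * (∫ y, t (firstVal S y) ∂(seqLaw ρ))
          + (∫ y, d (firstVal S y) ^ 2 ∂(seqLaw ρ)) / 2) ∧
    ∫ y, lengthReward d (block S d y, block S d (regen S y)) ∂(seqLaw ρ)
      = (∫ y, preSum S d y ∂(seqLaw ρ)) + ∫ y, d (firstVal S y) ∂(seqLaw ρ) := by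
  have hmp := measurePreserving_regen ρ hS hρ
  have hR := measurable_regen hS
  have hV := measurable_firstVal hS
  have hWm := measurable_preSum hS hdm
  have hX := memLp_firstVal ρ hS hρ (hd.restrict S)
  have hX1 := hX.integrable one_le_two
  have hX2 := hX.integrable_sq
  have hW := (moments_preSum ρ hS hρ hdm hd hd0).1
  have hW1 := hW.integrable one_le_two
  have hW2 := hW.integrable_sq
  have hT1 : Integrable (fun y => t (firstVal S y)) (seqLaw ρ) :=
    memLp_one_iff_integrable.1 (memLp_firstVal ρ hS hρ (memLp_one_iff_integrable.2 ht))
  -- Failures and success within one block are independent, which factorises the product of W and T.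
  have hWT : ProbabilityTheory.IndepFun (preSum S d) (fun y => t (firstVal S y)) (seqLaw ρ) :=
    (indepFun_preSum_firstVal ρ hS hρ hdm).comp measurable_id htm
  have iWT : Integrable (fun y => preSum S d y * t (firstVal S y)) (seqLaw ρ) :=
    hWT.integrable_mul hW1 hT1
  have eWT : ∫ y, preSum S d y * t (firstVal S y) ∂(seqLaw ρ)
      = (∫ y, preSum S d y ∂(seqLaw ρ)) * ∫ y, t (firstVal S y) ∂(seqLaw ρ) :=
    hWT.integral_fun_mul_eq_mul_integral hW1.aestronglyMeasurable hT1.aestronglyMeasurable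
  have hWTs := hW1.add hT1
  -- The success preceding a cycle belongs to the earlier block and is independent of the data of
  -- the cycle.
  have hXZ : ProbabilityTheory.IndepFun (fun y => d (firstVal S y))
      ((fun y => preSum S d y + t (firstVal S y)) ∘ regen S) (seqLaw ρ) :=
    (indepFun_block_regen ρ hS hρ hdm).comp (φ := fun b : ℝ × E => d b.2)
      (ψ := fun y => preSum S d y + t (firstVal S y)) (hdm.comp measurable_snd)
      (hWm.add (htm.comp hV))
  have hWTr : Integrable ((fun y => preSum S d y + t (firstVal S y)) ∘ regen S) (seqLaw ρ) :=
    hmp.integrable_comp_of_integrable hWTs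
  have iXZ : Integrable (fun y => d (firstVal S y)
      * (preSum S d (regen S y) + t (firstVal S (regen S y)))) (seqLaw ρ) :=
    hXZ.integrable_mul hX1 hWTr
  have hcomp : ∀ {g : (ℕ → E) → ℝ}, Measurable g →
      ∫ y, g (regen S y) ∂(seqLaw ρ) = ∫ y, g y ∂(seqLaw ρ) := by
    intro g hg
    have := integral_map (μ := seqLaw ρ) hR.aemeasurable (f := g)
      (by rw [hmp.map_eq]; exact hg.aestronglyMeasurable)
    rw [hmp.map_eq] at this
    exact this.symm
  have eXZ : ∫ y, d (firstVal S y)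
      * (preSum S d (regen S y) + t (firstVal S (regen S y))) ∂(seqLaw ρ)
      = (∫ y, d (firstVal S y) ∂(seqLaw ρ))
          * ((∫ y, preSum S d y ∂(seqLaw ρ)) + ∫ y, t (firstVal S y) ∂(seqLaw ρ)) := by
    have h := hXZ.integral_fun_mul_eq_mul_integral hX1.aestronglyMeasurable
      hWTr.aestronglyMeasurable
    have h2 := hcomp (g := fun y => preSum S d y + t (firstVal S y)) (hWm.add (htm.comp hV))
    rw [← integral_add hW1 hT1, ← h2]
    exact h
  set Z : (ℕ → E) → ℝ := fun y =>
    preSum S d y ^ 2 / 2 + preSum S d y * t (firstVal S y) + d (firstVal S y) ^ 2 / 2 with hZ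
  have hZm : Measurable Z := (((hWm.pow_const 2).div_const 2).add (hWm.mul (htm.comp hV))).add
    (((hdm.comp hV).pow_const 2).div_const 2)
  have iZ0 : Integrable (fun y => preSum S d y ^ 2 / 2 + preSum S d y * t (firstVal S y))
      (seqLaw ρ) := (hW2.div_const 2).add iWT
  have iZ : Integrable Z (seqLaw ρ) := iZ0.add (hX2.div_const 2)
  have iZr : Integrable (fun y => Z (regen S y)) (seqLaw ρ) := hmp.integrable_comp_of_integrable iZ
  have iL : Integrable (fun y => preSum S d y + d (firstVal S y)) (seqLaw ρ) := hW1.add hX1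
  refine ⟨iXZ.add iZr, hmp.integrable_comp_of_integrable iL, ?_, ?_⟩
  · refine (integral_add iXZ iZr).trans ?_
    rw [eXZ, hcomp hZm, hZ, integral_add iZ0 (hX2.div_const 2),
      integral_add (hW2.div_const 2) iWT, eWT, integral_div, integral_div]
  · refine (hcomp (g := fun y => preSum S d y + d (firstVal S y))
      (hWm.add (hdm.comp hV))).trans ?_
    exact integral_add hW1 hX1

end Cycles

/-! ### The times of the successes and the iterates of `regen` -/

section Successes

variable {E : Type*} {S : Set E}

/-- There is exactly one success up to and including `firstIdx`, so counting successes identifies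
the index on the right as number `q + 1`. -/
theorem nth_succ_eq_add {y : ℕ → E} (hy : {j : ℕ | y j ∈ S}.Infinite) (q : ℕ) :
    Nat.nth (fun j => y j ∈ S) (q + 1)
      = firstIdx S y + 1 + Nat.nth (fun j => regen S y j ∈ S) q := by
  classical
  have hs : {j : ℕ | regen S y j ∈ S}.Infinite := infinite_shift hy _
  have hm := Nat.nth_mem_of_infinite hs q
  set m := Nat.nth (fun j => regen S y j ∈ S) q with hmdef
  have hR : y (firstIdx S y) ∈ S := Nat.nth_mem_of_infinite hy 0
  have hc0 : Nat.count (fun j => y j ∈ S) (firstIdx S y) = 0 := Nat.count_nth_of_infinite hy 0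
  have hc1 : Nat.count (fun j => regen S y j ∈ S) m = q := Nat.count_nth_of_infinite hs q
  have hc : Nat.count (fun j => y j ∈ S) (firstIdx S y + 1 + m) = q + 1 := by
    rw [Nat.count_add, Nat.count_succ, hc0, if_pos hR]
    change 0 + 1 + Nat.count (fun j => regen S y j ∈ S) m = q + 1
    omega
  rw [← hc]
  exact Nat.nth_count (p := fun j => y j ∈ S) hm

/-- Successes are counted from 0, so `q + 1` regenerations discard everything up to and including
success number `q`. -/
theorem iterate_regen_succ {y : ℕ → E} (hy : {j : ℕ | y j ∈ S}.Infinite) (q : ℕ) :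
    (regen S)^[q + 1] y = shift (Nat.nth (fun j => y j ∈ S) q + 1) y := by
  induction q generalizing y with
  | zero => rfl
  | succ q ih =>
    rw [Function.iterate_succ_apply, ih (y := regen S y) (infinite_shift hy _), nth_succ_eq_add hy]
    funext j
    simp only [regen, shift]
    congr 1
    omega

theorem nth_succ_eq_add_firstIdx {y : ℕ → E} (hy : {j : ℕ | y j ∈ S}.Infinite) (q : ℕ) :
    Nat.nth (fun j => y j ∈ S) (q + 1)
      = Nat.nth (fun j => y j ∈ S) q + 1 + firstIdx S ((regen S)^[q + 1] y) := by
  induction q generalizing y with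
  | zero => rw [nth_succ_eq_add hy]; rfl
  | succ q ih =>
    rw [nth_succ_eq_add hy, ih (y := regen S y) (infinite_shift hy _), nth_succ_eq_add hy q,
      Function.iterate_succ_apply (regen S) (q + 1) y]
    omega

theorem firstVal_iterate_regen {y : ℕ → E} (hy : {j : ℕ | y j ∈ S}.Infinite) (q : ℕ) :
    firstVal S ((regen S)^[q] y) = y (Nat.nth (fun j => y j ∈ S) q) := by
  cases q with
  | zero => rfl
  | succ q =>
    rw [nth_succ_eq_add_firstIdx hy, firstVal, iterate_regen_succ hy]
    rfl

theorem preSum_iterate_regen_succ {y : ℕ → E} (hy : {j : ℕ | y j ∈ S}.Infinite) (d : E → ℝ)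
    (q : ℕ) : preSum S d ((regen S)^[q + 1] y) = ∑ i ∈ Finset.Ioo (Nat.nth (fun j => y j ∈ S) q)
      (Nat.nth (fun j => y j ∈ S) (q + 1)), d (y i) := by
  have e : Finset.Ioo (Nat.nth (fun j => y j ∈ S) q) (Nat.nth (fun j => y j ∈ S) (q + 1))
      = Finset.Ico (Nat.nth (fun j => y j ∈ S) q + 1) (Nat.nth (fun j => y j ∈ S) (q + 1)) := by
    ext; simp
  rw [e, Finset.sum_Ico_eq_sum_range, nth_succ_eq_add_firstIdx hy, Nat.add_sub_cancel_left, preSum,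
    iterate_regen_succ hy]
  rfl

end Successes

/-! ### The age process along a path -/

section Path

variable {N K : ℕ} {TD : EReal} {n : Fin N} {x : Fin N → ℕ → ℝ}

/-- The service time vectors that make device `n` receive the update. -/
def receivedSet (N K : ℕ) (TD : EReal) (n : Fin N) : Set (Fin N → ℝ) := {y | Received K TD n y}

theorem successGap_eq (h : {j : ℕ | Received K TD n fun m => x m j}.Infinite) (q : ℕ) :
    successGap K TD n x q
      = duration K TD (firstVal (receivedSet N K TD n)
          ((regen (receivedSet N K TD n))^[q] fun j m => x m j)) := by
  rw [firstVal_iterate_regen (S := receivedSet N K TD n) h]; rfl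

theorem serviceTime_eq (h : {j : ℕ | Received K TD n fun m => x m j}.Infinite) (q : ℕ) :
    serviceTime K TD n x q
      = firstVal (receivedSet N K TD n)
          ((regen (receivedSet N K TD n))^[q + 1] fun j m => x m j) n := by
  rw [firstVal_iterate_regen (S := receivedSet N K TD n) h]; rfl

theorem failureSum_eq (h : {j : ℕ | Received K TD n fun m => x m j}.Infinite) (q : ℕ) :
    failureSum K TD n x q
      = preSum (receivedSet N K TD n) (duration K TD)
          ((regen (receivedSet N K TD n))^[q + 1] fun j m => x m j) := by
  rw [preSum_iterate_regen_succ (S := receivedSet N K TD n) h]; rfl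

theorem genTime_receivedIdx_succ (h : {j : ℕ | Received K TD n fun m => x m j}.Infinite) (q : ℕ) :
    genTime K TD x (receivedIdx K TD n x (q + 1)) = termTime K TD n x q + failureSum K TD n x q :=
        by
  have hlt : receivedIdx K TD n x q < receivedIdx K TD n x (q + 1) :=
    Nat.nth_strictMono h (Nat.lt_succ_self q)
  have e : Finset.Ioo (receivedIdx K TD n x q) (receivedIdx K TD n x (q + 1))
      = Finset.Ico (receivedIdx K TD n x q + 1) (receivedIdx K TD n x (q + 1)) := by
    ext; simp
  rw [termTime, failureSum, e, genTime, genTime, Finset.sum_range_add_sum_Ico _ hlt]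

theorem termTime_eq (q : ℕ) : termTime K TD n x q
    = genTime K TD x (receivedIdx K TD n x q) + successGap K TD n x q :=
  Finset.sum_range_succ _ _

/-- A cycle consists of its failures followed by the transmission of the next received update, whose
gap has index `q + 1`. -/
theorem cycleLength_eq (h : {j : ℕ | Received K TD n fun m => x m j}.Infinite) (q : ℕ) :
    cycleLength K TD n x q = failureSum K TD n x q + successGap K TD n x (q + 1) := by
  rw [cycleLength, termTime_eq (q + 1), genTime_receivedIdx_succ h]; ring

theorem genTime_le_genTime (hd : ∀ j, 0 < interGen K TD x j) {i j : ℕ} (hij : i ≤ j) :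
    genTime K TD x i ≤ genTime K TD x j :=
  Finset.sum_le_sum_of_subset_of_nonneg (Finset.range_mono hij) fun k _ _ => (hd k).le

theorem genTime_nonneg (hd : ∀ j, 0 < interGen K TD x j) (j : ℕ) : 0 ≤ genTime K TD x j :=
  Finset.sum_nonneg fun k _ => (hd k).le

/-- An update delivered by time `t` was generated before `t`. The bound makes the supremum in
`lastGen` genuine and the age nonnegative. -/
theorem mem_upperBounds_lastGen {a : ℝ} (ha : 0 ≤ a) (hx : ∀ m j, 0 < x m j) {t s : ℝ}
    (hs0 : 0 ≤ s) (hst : t ≤ s) :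
    s ∈ upperBounds ({-a} ∪ {s : ℝ | ∃ j : ℕ, (Received K TD n fun m => x m j) ∧
      genTime K TD x j + x n j ≤ t ∧ s = genTime K TD x j}) := by
  rintro u (hu | ⟨j, -, hj, hu⟩)
  · rw [Set.mem_singleton_iff.1 hu]; linarith
  · linarith [hx n j]

/-- Later times only enlarge the set of delivered updates. Monotonicity supplies the interval
integrability of the age. -/
theorem monotone_lastGen {a : ℝ} (ha : 0 ≤ a) (hx : ∀ m j, 0 < x m j) :
    Monotone (lastGen K TD a n x) := by
  intro t t' htt
  refine csSup_le_csSup ⟨_, mem_upperBounds_lastGen ha hx (le_max_left 0 t') (le_max_right 0 t')⟩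
    ⟨-a, Or.inl rfl⟩ ?_
  refine Set.union_subset_union_right _ ?_
  rintro u ⟨j, hj, hj', hu⟩
  exact ⟨j, hj, hj'.trans htt, hu⟩

theorem intervalIntegrable_age {a : ℝ} (ha : 0 ≤ a) (hx : ∀ m j, 0 < x m j) (s t : ℝ) :
    IntervalIntegrable (age K TD a n x) volume s t :=
  intervalIntegral.intervalIntegrable_id.sub (monotone_lastGen ha hx).intervalIntegrable

theorem age_nonneg {a : ℝ} (ha : 0 ≤ a) (hx : ∀ m j, 0 < x m j) {t : ℝ} (ht : 0 ≤ t) :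
    0 ≤ age K TD a n x t :=
  sub_nonneg.2 (csSup_le ⟨-a, Or.inl rfl⟩ fun _ hu => mem_upperBounds_lastGen ha hx ht le_rfl hu)

theorem lastGen_eq (hTD : ⊥ < TD) {a : ℝ} (ha : 0 ≤ a) (hx : ∀ m j, 0 < x m j)
    (hd : ∀ j, 0 < interGen K TD x j)
    (h : {j : ℕ | Received K TD n fun m => x m j}.Infinite) {q : ℕ} {t : ℝ}
    (h1 : genTime K TD x (receivedIdx K TD n x q) + x n (receivedIdx K TD n x q) ≤ t)
    (h2 : t < genTime K TD x (receivedIdx K TD n x (q + 1)) + x n (receivedIdx K TD n x (q + 1))) :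
    lastGen K TD a n x t = genTime K TD x (receivedIdx K TD n x q) := by
  classical
  have hrec : ∀ q, Received K TD n fun m => x m (receivedIdx K TD n x q) :=
    fun q => Nat.nth_mem_of_infinite h q
  refine IsGreatest.csSup_eq ⟨Or.inr ⟨_, hrec q, h1, rfl⟩, ?_⟩
  rintro u (hu | ⟨j, hj, hj', rfl⟩)
  · rw [Set.mem_singleton_iff.1 hu]
    linarith [genTime_nonneg (K := K) (TD := TD) hd (receivedIdx K TD n x q)]
  -- A received update later than number `q` is number `q + 1`, which is not yet delivered at `t`,
  -- or comes after it; in the second case it is generated only after number `q + 1` has been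
  -- delivered.
  · refine genTime_le_genTime hd (not_lt.1 fun hlt => ?_)
    have hc := (Nat.lt_nth_iff_count_lt h).2 hlt
    have hle : receivedIdx K TD n x (q + 1) ≤ j := by
      rw [← Nat.nth_count (p := fun j => Received K TD n fun m => x m j) hj]
      exact (Nat.nth_strictMono h).monotone hc
    rcases hle.eq_or_lt with heq | hlt
    · rw [heq] at h2; linarith
    · have g1 := genTime_le_genTime (K := K) (TD := TD) hd (Nat.succ_le_of_lt hlt)
      have g2 : genTime K TD x (receivedIdx K TD n x (q + 1) + 1) = _ := Finset.sum_range_succ _ _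
      have g3 := (received_iff_le_duration hTD).1 (hrec (q + 1))
      have g4 := hx n j
      change _ ≤ interGen K TD x _ at g3
      simp only [Nat.succ_eq_add_one] at g1
      rw [g2] at g1
      unfold genTime at *
      linarith

theorem cycleArea_eq (hTD : ⊥ < TD) {a : ℝ} (ha : 0 ≤ a) (hx : ∀ m j, 0 < x m j)
    (hd : ∀ j, 0 < interGen K TD x j)
    (h : {j : ℕ | Received K TD n fun m => x m j}.Infinite) (q : ℕ) :
    cycleArea K TD a n x q = successGap K TD n x q * (failureSum K TD n x q + serviceTime K TD n x
        q)
      + (failureSum K TD n x q ^ 2 / 2 + failureSum K TD n x q * serviceTime K TD n x q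
        + successGap K TD n x (q + 1) ^ 2 / 2) := by
  have hrec : ∀ q, x n (receivedIdx K TD n x q) ≤ successGap K TD n x q :=
    fun q => (received_iff_le_duration hTD).1 (Nat.nth_mem_of_infinite h q)
  have hW : ∀ q, 0 ≤ failureSum K TD n x q := fun q => Finset.sum_nonneg fun i _ => (hd i).le
  have e1 := termTime_eq (K := K) (TD := TD) (n := n) (x := x) q
  have e2 := genTime_receivedIdx_succ h q
  have e3 := termTime_eq (K := K) (TD := TD) (n := n) (x := x) (q + 1)
  have e4 := genTime_receivedIdx_succ h (q + 1)
  set g := genTime K TD x (receivedIdx K TD n x q) with hg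
  set g' := genTime K TD x (receivedIdx K TD n x (q + 1)) with hg'
  -- The age drops at the delivery instant `mid`; before it the reference generation time is `g`,
  -- from it on `g'`.
  set mid := g' + serviceTime K TD n x q with hmid
  have hs : 0 < serviceTime K TD n x q := hx _ _
  have hsd : serviceTime K TD n x q ≤ successGap K TD n x (q + 1) := hrec (q + 1)
  have l1 : termTime K TD n x q ≤ mid := by linarith [hW q]
  have l2 : mid ≤ termTime K TD n x (q + 1) := by linarith
  have c1 : ∫ t in (termTime K TD n x q)..mid, age K TD a n x t
      = ∫ t in (termTime K TD n x q)..mid, (t - g) := by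
    refine intervalIntegral.integral_congr_ae' ?_ ?_
    -- At `mid` itself the age has already dropped, so this null point is removed.
    · filter_upwards [compl_mem_ae_iff.2 (measure_singleton mid)] with t ht hmem
      rw [age, lastGen_eq hTD ha hx hd h (q := q)]
      · linarith [hmem.1, hrec q]
      · exact lt_of_le_of_ne hmem.2 ht
    · rw [Set.Ioc_eq_empty (not_lt.2 l1)]; simp
  have c2 : ∫ t in mid..(termTime K TD n x (q + 1)), age K TD a n x t
      = ∫ t in mid..(termTime K TD n x (q + 1)), (t - g') := by
    refine intervalIntegral.integral_congr_ae' ?_ ?_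
    · refine Eventually.of_forall fun t hmem => ?_
      rw [age, lastGen_eq hTD ha hx hd h (q := q + 1)]
      · exact hmem.1.le
      -- The following received update is generated no earlier than the end of the cycle, so its
      -- delivery comes strictly later.
      · rw [e4]; linarith [hmem.2, hW (q + 1), hx n (receivedIdx K TD n x (q + 1 + 1))]
    · rw [Set.Ioc_eq_empty (not_lt.2 l2)]; simp
  rw [cycleArea, ← intervalIntegral.integral_add_adjacent_intervals
    (intervalIntegrable_age ha hx _ _) (intervalIntegrable_age ha hx _ _), c1, c2,
    intervalIntegral.integral_sub intervalIntegral.intervalIntegrable_id intervalIntegrable_const,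
    intervalIntegral.integral_sub intervalIntegral.intervalIntegrable_id intervalIntegrable_const]
  simp only [integral_id, intervalIntegral.integral_const, smul_eq_mul]
  rw [e3, hmid, e2, e1]
  ring

theorem termTime_eq_sum (k : ℕ) : termTime K TD n x k
    = termTime K TD n x 0 + ∑ i ∈ Finset.range k, cycleLength K TD n x i := by
  rw [show ∑ i ∈ Finset.range k, cycleLength K TD n x i = _ from Finset.sum_range_sub _ k]
  ring

theorem integral_age_termTime {a : ℝ} (ha : 0 ≤ a) (hx : ∀ m j, 0 < x m j) (k : ℕ) :
    ∫ t in (0 : ℝ)..(termTime K TD n x k), age K TD a n x t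
      = (∫ t in (0 : ℝ)..(termTime K TD n x 0), age K TD a n x t)
        + ∑ i ∈ Finset.range k, cycleArea K TD a n x i := by
  rw [show ∑ i ∈ Finset.range k, cycleArea K TD a n x i = _ from
    intervalIntegral.sum_integral_adjacent_intervals fun i _ => intervalIntegrable_age ha hx _ _,
    intervalIntegral.integral_add_adjacent_intervals
    (intervalIntegrable_age ha hx _ _) (intervalIntegrable_age ha hx _ _)]

theorem termTime_nonneg (hd : ∀ j, 0 < interGen K TD x j) (k : ℕ) : 0 ≤ termTime K TD n x k :=
  genTime_nonneg hd _

theorem monotone_termTime (hd : ∀ j, 0 < interGen K TD x j)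
    (h : {j : ℕ | Received K TD n fun m => x m j}.Infinite) : Monotone (termTime K TD n x) :=
  fun _ _ hij => genTime_le_genTime hd (Nat.succ_le_succ ((Nat.nth_strictMono h).monotone hij))

end Path

/-! ### From renewal averages to time averages -/

/-- For `s k ≤ τ < s (k + 1)` the average at `τ` lies between the integral to `s k` divided by `s (k
+ 1)` and the integral to `s (k + 1)` divided by `s k`, because `g` is nonnegative. Both bounds tend
to `B / L`. -/
theorem tendsto_timeAverage {g : ℝ → ℝ} {s : ℕ → ℝ} {L B : ℝ}
    (hg : ∀ u v, IntervalIntegrable g volume u v) (hg0 : ∀ t, 0 ≤ t → 0 ≤ g t)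
    (hs0 : ∀ k, 0 ≤ s k) (hs : Monotone s) (hL : 0 < L)
    (hsL : Tendsto (fun k : ℕ => s k / k) atTop (𝓝 L))
    (hB : Tendsto (fun k : ℕ => (∫ t in (0 : ℝ)..(s k), g t) / k) atTop (𝓝 B)) :
    Tendsto (fun τ : ℝ => 1 / τ * ∫ t in (0 : ℝ)..τ, g t) atTop (𝓝 (B / L)) := by
  have hmono : ∀ {u v : ℝ}, 0 ≤ u → u ≤ v → ∫ t in (0 : ℝ)..u, g t ≤ ∫ t in (0 : ℝ)..v, g t := by
    intro u v hu huv
    refine intervalIntegral.integral_mono_interval le_rfl hu huv ?_ (hg 0 v)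
    exact (ae_restrict_iff' measurableSet_Ioc).2 (Eventually.of_forall fun t ht => hg0 t ht.1.le)
  have hnn : ∀ {u : ℝ}, 0 ≤ u → 0 ≤ ∫ t in (0 : ℝ)..u, g t := fun {u} hu => by
    simpa using hmono le_rfl hu
  have hk : Tendsto (fun k : ℕ => (k : ℝ)) atTop atTop := tendsto_natCast_atTop_atTop
  have hsT : Tendsto s atTop atTop := by
    refine (hsL.pos_mul_atTop hL hk).congr' ?_
    filter_upwards [eventually_ne_atTop 0] with k h0
    have : (k : ℝ) ≠ 0 := by exact_mod_cast h0
    field_simp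
  have hr : Tendsto (fun k : ℕ => ((k + 1 : ℕ) : ℝ) / k) atTop (𝓝 1) := by
    have h1 : Tendsto (fun k : ℕ => 1 + 1 / (k : ℝ)) atTop (𝓝 (1 + 0)) :=
      tendsto_const_nhds.add tendsto_one_div_atTop_nhds_zero_nat
    rw [add_zero] at h1
    refine h1.congr' ?_
    filter_upwards [eventually_ne_atTop 0] with k h0
    have : (k : ℝ) ≠ 0 := by exact_mod_cast h0
    push_cast
    field_simp
  have hup : Tendsto (fun k : ℕ => (∫ t in (0 : ℝ)..(s (k + 1)), g t) / s k) atTop (𝓝 (B / L)) := by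
    have h1 := (((tendsto_add_atTop_iff_nat 1).2 hB).mul hr).div hsL hL.ne'
    rw [mul_one] at h1
    refine h1.congr' ?_
    filter_upwards [eventually_ne_atTop 0] with k h0
    have : (k : ℝ) ≠ 0 := by exact_mod_cast h0
    have h2 : ((k + 1 : ℕ) : ℝ) ≠ 0 := by positivity
    simp only [Pi.div_apply]
    field_simp
  have hlo : Tendsto (fun k : ℕ => (∫ t in (0 : ℝ)..(s k), g t) / s (k + 1)) atTop
      (𝓝 (B / L)) := by
    have h1 := hB.div (((tendsto_add_atTop_iff_nat 1).2 hsL).mul hr) (by rw [mul_one]; exact hL.ne')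
    rw [mul_one] at h1
    refine h1.congr' ?_
    filter_upwards [eventually_ne_atTop 0] with k h0
    have : (k : ℝ) ≠ 0 := by exact_mod_cast h0
    have h2 : ((k + 1 : ℕ) : ℝ) ≠ 0 := by positivity
    simp only [Pi.div_apply]
    field_simp
  have hbr : ∀ k0 τ, s k0 ≤ τ → ∃ k, k0 ≤ k ∧ s k ≤ τ ∧ τ < s (k + 1) := by
    intro k0 τ hτ
    classical
    have hex : ∃ k, τ < s k := (hsT.eventually_gt_atTop τ).exists
    have h0 : k0 < Nat.find hex := by
      by_contra hle
      exact absurd ((Nat.find_spec hex).trans_le (hs (not_lt.1 hle))) (not_lt.2 hτ)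
    refine ⟨Nat.find hex - 1, by omega, not_lt.1 (Nat.find_min hex (by omega)), ?_⟩
    rw [Nat.sub_add_cancel (by omega)]
    exact Nat.find_spec hex
  have hev : ∀ {P : ℝ → Prop}, (∀ᶠ k : ℕ in atTop, ∀ τ, 0 < s k → s k ≤ τ → τ < s (k + 1) → P τ) →
      ∀ᶠ τ in atTop, P τ := by
    intro P hP
    obtain ⟨k0, hk0⟩ := eventually_atTop.1 (hP.and (hsT.eventually_gt_atTop 0))
    filter_upwards [eventually_ge_atTop (s k0)] with τ hτ
    obtain ⟨k, hk, h1, h2⟩ := hbr k0 τ hτ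
    exact (hk0 k hk).1 τ (hk0 k hk).2 h1 h2
  rw [tendsto_order]
  constructor
  · intro b hb
    refine hev ?_
    filter_upwards [hlo.eventually_const_lt hb] with k hk τ h0 h1 h2
    refine hk.trans_le ?_
    rw [one_div, inv_mul_eq_div]
    exact div_le_div₀ (hnn (h0.le.trans h1)) (hmono h0.le h1) (h0.trans_le h1) h2.le
  · intro b hb
    refine hev ?_
    filter_upwards [hup.eventually_lt_const hb] with k hk τ h0 h1 h2
    refine lt_of_le_of_lt ?_ hk
    rw [one_div, inv_mul_eq_div]
    exact div_le_div₀ (hnn (hs0 _)) (hmono (h0.le.trans h1) h2.le) h0 h1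

/-! ### Transfer along measure preserving maps -/

section Transfer

variable {Ω E : Type*} [MeasurableSpace Ω] [MeasurableSpace E] {μ : Measure Ω} {ρ : Measure E}
  {φ : Ω → E}

theorem integral_cond_preimage (hφ : MeasurePreserving φ μ ρ) {S : Set E} (hS : MeasurableSet S)
    {f : E → ℝ} (hf : Measurable f) :
    ∫ ω, f (φ ω) ∂(ProbabilityTheory.cond μ (φ ⁻¹' S)) = (ρ.real S)⁻¹ * ∫ e in S, f e ∂ρ := by
  have h := hφ.restrict_preimage hS
  rw [ProbabilityTheory.cond, integral_smul_measure, hφ.measure_preimage hS.nullMeasurableSet,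
    ← h.map_eq, integral_map h.measurable.aemeasurable hf.aestronglyMeasurable,
    ENNReal.toReal_inv, smul_eq_mul, Measure.real]

theorem cond_real_preimage (hφ : MeasurePreserving φ μ ρ) {S A : Set E}
    (hS : MeasurableSet S) (hA : MeasurableSet A) :
    (ProbabilityTheory.cond μ (φ ⁻¹' S)).real (φ ⁻¹' A) = (ρ.real S)⁻¹ * ρ.real (S ∩ A) := by
  rw [Measure.real, ProbabilityTheory.cond_apply (hφ.measurable hS), ← Set.preimage_inter,
    hφ.measure_preimage hS.nullMeasurableSet,
    hφ.measure_preimage (hS.inter hA).nullMeasurableSet, ENNReal.toReal_mul, ENNReal.toReal_inv]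
  rfl

end Transfer

/-! ### Moments of the cycle variables on the path space -/

section PathSpace

variable {N K : ℕ} {lam c : ℝ} {TD : EReal}

theorem measurableSet_receivedSet (h1 : 1 ≤ K) (hN : K ≤ N) (TD : EReal) (n : Fin N) :
    MeasurableSet (receivedSet N K TD n) := measurableSet_received h1 hN TD n

theorem serviceLaw_receivedSet_ne_zero (h1 : 1 ≤ K) (hN : K ≤ N) (hlam : 0 < lam)
    (hTD : (c : EReal) < TD) (n : Fin N) : serviceLaw N lam c (receivedSet N K TD n) ≠ 0 := by
  intro h0
  have h : (serviceLaw N lam c).real (receivedSet N K TD n) = probS N K lam c TD :=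
    real_received h1 hN hlam hTD n
  rw [Measure.real, h0, ENNReal.toReal_zero] at h
  exact (probS_pos h1 hN hlam hTD).ne h

theorem ae_lt_duration (h1 : 1 ≤ K) (hN : K ≤ N) (hlam : 0 < lam) (hTD : (c : EReal) < TD) :
    ∀ᵐ y ∂(serviceLaw N lam c), c < duration K TD y := by
  filter_upwards [ae_lt_apply hlam N] with y hy using lt_duration h1 hN hTD hy

/-- Solving the identities of `moments_preSum` for the two moments gives the compound geometric
formulas, with `M - 1` failures per cycle. -/
theorem moments_failures (h1 : 1 ≤ K) (hN : K ≤ N) (hlam : 0 < lam) (hc : 0 < c)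
    (hTD : (c : EReal) < TD) (n : Fin N) :
    MemLp (preSum (receivedSet N K TD n) (duration K TD)) 2 (seqLaw (serviceLaw N lam c)) ∧
    ∫ y, preSum (receivedSet N K TD n) (duration K TD) y ∂(seqLaw (serviceLaw N lam c))
      = meanW N K lam c TD ∧
    ∫ y, preSum (receivedSet N K TD n) (duration K TD) y ^ 2 ∂(seqLaw (serviceLaw N lam c))
      = meanWsq N K lam c TD := by
  have := isProbabilityMeasure_serviceLaw (N := N) (c := c) hlam
  have hp := probS_pos h1 hN hlam hTD
  obtain ⟨hL, e1, e2⟩ := moments_preSum (serviceLaw N lam c)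
    (measurableSet_receivedSet h1 hN TD n) (serviceLaw_receivedSet_ne_zero h1 hN hlam hTD n)
    (measurable_duration h1 hN TD) (memLp_duration h1 hN hlam hc hTD)
    (by filter_upwards [ae_lt_duration h1 hN hlam hTD] with y hy using hc.le.trans hy.le)
  obtain ⟨a1, a2⟩ := setIntegral_not_received_duration h1 hN hlam hc hTD n
  have hS : (serviceLaw N lam c).real (receivedSet N K TD n) = probS N K lam c TD :=
    real_received h1 hN hlam hTD n
  change _ = ∫ y in {y | ¬ Received K TD n y}, duration K TD y ∂(serviceLaw N lam c) at e1
  change _ = ∫ y in {y | ¬ Received K TD n y}, duration K TD y ^ 2 ∂(serviceLaw N lam c)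
    + 2 * (∫ y in {y | ¬ Received K TD n y}, duration K TD y ∂(serviceLaw N lam c)) * _ at e2
  rw [hS, a1] at e1
  rw [hS, a1, a2] at e2
  have hW : ∫ y, preSum (receivedSet N K TD n) (duration K TD) y ∂(seqLaw (serviceLaw N lam c))
      = meanW N K lam c TD := by
    refine mul_left_cancel₀ hp.ne' (e1.trans ?_)
    rw [meanW, meanM]
    field_simp
  refine ⟨hL, hW, mul_left_cancel₀ hp.ne' (e2.trans ?_)⟩
  rw [hW, meanWsq, varW, meanW, meanM, meanMsq]
  field_simp
  ring

theorem moments_success (h1 : 1 ≤ K) (hN : K ≤ N) (hlam : 0 < lam) (hc : 0 < c)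
    (hTD : (c : EReal) < TD) (n : Fin N) :
    ∫ y, duration K TD (firstVal (receivedSet N K TD n) y) ∂(seqLaw (serviceLaw N lam c))
      = meanXS N K lam c TD ∧
    ∫ y, duration K TD (firstVal (receivedSet N K TD n) y) ^ 2 ∂(seqLaw (serviceLaw N lam c))
      = meanXSsq N K lam c TD ∧
    ∫ y, firstVal (receivedSet N K TD n) y n ∂(seqLaw (serviceLaw N lam c))
      = meanT N K lam c TD := by
  have := isProbabilityMeasure_serviceLaw (N := N) (c := c) hlam
  have hp := (probS_pos h1 hN hlam hTD).ne'
  have hS := measurableSet_receivedSet h1 hN TD n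
  have hρ := serviceLaw_receivedSet_ne_zero h1 hN hlam hTD n
  have hd := measurable_duration h1 hN TD
  have hr : (serviceLaw N lam c).real (receivedSet N K TD n) = probS N K lam c TD :=
    real_received h1 hN hlam hTD n
  have key : ∀ {f : (Fin N → ℝ) → ℝ} {v : ℝ}, Measurable f →
      ∫ y in receivedSet N K TD n, f y ∂(serviceLaw N lam c) = probS N K lam c TD * v →
      ∫ y, f (firstVal (receivedSet N K TD n) y) ∂(seqLaw (serviceLaw N lam c)) = v := by
    intro f v hf h
    rw [integral_firstVal _ hS hρ hf]
    refine (integral_cond_preimage (MeasurePreserving.id (serviceLaw N lam c)) hS hf).trans ?_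
    rw [h, hr]
    field_simp
  obtain ⟨a1, a2⟩ := setIntegral_received_duration h1 hN hlam hc hTD n
  exact ⟨key hd a1, key (hd.pow_const 2) a2,
    key (measurable_pi_apply n) (setIntegral_received_apply h1 hN hlam hc hTD n).2⟩

end PathSpace

/-! ### The cycles of a device on the probability space -/

section Model

variable {Ω : Type*} [MeasurableSpace Ω] {μ : Measure Ω}
  {N K : ℕ} {lam c : ℝ} {TD : EReal} {T : Fin N → ℕ → Ω → ℝ} {a : Ω → ℝ} {n : Fin N}

/-- The independent family is reindexed with the update first and the device second, then curried,
so that the path becomes an i.i.d. sequence of service time vectors. -/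
theorem measurePreserving_path [IsProbabilityMeasure μ] (hlam : 0 < lam)
    (hmeas : ∀ m j, Measurable (T m j))
    (hindep : ProbabilityTheory.iIndepFun (fun p : Fin N × ℕ => T p.1 p.2) μ)
    (hlaw : ∀ m j, μ.map (T m j) = shiftedExp lam c) :
    MeasurePreserving (fun ω j m => T m j ω) μ (seqLaw (serviceLaw N lam c)) := by
  have := isProbabilityMeasure_shiftedExp (c := c) hlam
  have hi : ProbabilityTheory.iIndepFun (fun p : ℕ × Fin N => T p.2 p.1) μ :=
    hindep.precomp (g := Prod.swap) Prod.swap_injective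
  have h1 := (ProbabilityTheory.iIndepFun_iff_map_fun_eq_infinitePi_map
    (fun p : ℕ × Fin N => hmeas p.2 p.1)).1 hi
  simp only [hlaw] at h1
  refine ⟨measurable_pi_lambda _ fun j => measurable_pi_lambda _ fun m => hmeas m j, ?_⟩
  have h2 := congrArg (fun ν => ν.map (MeasurableEquiv.curry ℕ (Fin N) ℝ)) h1
  rw [Measure.map_map (MeasurableEquiv.measurable _)
    (measurable_pi_lambda _ fun p : ℕ × Fin N => hmeas p.2 p.1),
    Measure.infinitePi_map_curry (fun _ _ => shiftedExp lam c)] at h2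
  simp only [Measure.infinitePi_eq_pi] at h2
  exact h2

theorem measurePreserving_column
    (hlam : 0 < lam) (hY : MeasurePreserving (fun ω j m => T m j ω) μ
      (seqLaw (serviceLaw N lam c))) (j : ℕ) :
    MeasurePreserving (fun ω m => T m j ω) μ (serviceLaw N lam c) := by
  have := isProbabilityMeasure_serviceLaw (N := N) (c := c) hlam
  exact (measurePreserving_eval (serviceLaw N lam c) j).comp hY

theorem measurePreserving_iterate_regen_path (h1 : 1 ≤ K) (hN : K ≤ N) (hlam : 0 < lam)
    (hTD : (c : EReal) < TD) (n : Fin N)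
    (hY : MeasurePreserving (fun ω j m => T m j ω) μ (seqLaw (serviceLaw N lam c))) (q : ℕ) :
    MeasurePreserving (fun ω => (regen (receivedSet N K TD n))^[q] fun j m => T m j ω) μ
      (seqLaw (serviceLaw N lam c)) := by
  have := isProbabilityMeasure_serviceLaw (N := N) (c := c) hlam
  exact ((measurePreserving_regen _ (measurableSet_receivedSet h1 hN TD n)
    (serviceLaw_receivedSet_ne_zero h1 hN hlam hTD n)).iterate q).comp hY

theorem ae_infinite_received (h1 : 1 ≤ K) (hN : K ≤ N) (hlam : 0 < lam)
    (hTD : (c : EReal) < TD) (n : Fin N)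
    (hY : MeasurePreserving (fun ω j m => T m j ω) μ (seqLaw (serviceLaw N lam c))) :
    ∀ᵐ ω ∂μ, {j : ℕ | Received K TD n fun m => T m j ω}.Infinite := by
  have := isProbabilityMeasure_serviceLaw (N := N) (c := c) hlam
  exact hY.quasiMeasurePreserving.ae (ae_infinite _ (measurableSet_receivedSet h1 hN TD n)
    (serviceLaw_receivedSet_ne_zero h1 hN hlam hTD n))

theorem ae_lt_service (hlam : 0 < lam)
    (hY : MeasurePreserving (fun ω j m => T m j ω) μ (seqLaw (serviceLaw N lam c))) :
    ∀ᵐ ω ∂μ, ∀ m j, c < T m j ω := by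
  have : ∀ᵐ ω ∂μ, ∀ j m, c < T m j ω := ae_all_iff.2 fun j =>
    (measurePreserving_column hlam hY j).quasiMeasurePreserving.ae (ae_lt_apply hlam N)
  filter_upwards [this] with ω h m j using h j m

theorem lt_interGen (h1 : 1 ≤ K) (hN : K ≤ N) (hTD : (c : EReal) < TD) {x : Fin N → ℕ → ℝ}
    (hx : ∀ m j, c < x m j) (j : ℕ) : c < interGen K TD x j :=
  lt_duration h1 hN hTD fun m => hx m j

/-- Cycle `q` uses the success of block `q` and all of block `q + 1`; the block before the first
reception supplies only its success. -/
theorem cycleArea_ae_eq (h1 : 1 ≤ K) (hN : K ≤ N) (hlam : 0 < lam) (hc : 0 < c)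
    (hTD : (c : EReal) < TD) (ha : ∀ ω, 0 ≤ a ω)
    (hY : MeasurePreserving (fun ω j m => T m j ω) μ (seqLaw (serviceLaw N lam c))) :
    ∀ᵐ ω ∂μ, ∀ q, cycleArea K TD (a ω) n (fun m j => T m j ω) q
      = areaReward (duration K TD) (fun y => y n)
        (block (receivedSet N K TD n) (duration K TD)
            ((regen (receivedSet N K TD n))^[q] fun j m => T m j ω),
          block (receivedSet N K TD n) (duration K TD) (regen (receivedSet N K TD n)
            ((regen (receivedSet N K TD n))^[q] fun j m => T m j ω))) := by
  filter_upwards [ae_infinite_received h1 hN hlam hTD n hY, ae_lt_service hlam hY] with ω hω hx q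
  rw [cycleArea_eq (bot_le.trans_lt hTD) (ha ω) (fun m j => hc.trans (hx m j))
    (fun j => hc.trans (lt_interGen h1 hN hTD hx j)) hω, successGap_eq hω, successGap_eq hω,
    failureSum_eq hω, serviceTime_eq hω, Function.iterate_succ_apply']
  rfl

theorem cycleLength_ae_eq (h1 : 1 ≤ K) (hN : K ≤ N) (hlam : 0 < lam) (hTD : (c : EReal) < TD)
    (hY : MeasurePreserving (fun ω j m => T m j ω) μ (seqLaw (serviceLaw N lam c))) :
    ∀ᵐ ω ∂μ, ∀ q, cycleLength K TD n (fun m j => T m j ω) q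
      = lengthReward (duration K TD)
        (block (receivedSet N K TD n) (duration K TD)
            ((regen (receivedSet N K TD n))^[q] fun j m => T m j ω),
          block (receivedSet N K TD n) (duration K TD) (regen (receivedSet N K TD n)
            ((regen (receivedSet N K TD n))^[q] fun j m => T m j ω))) := by
  filter_upwards [ae_infinite_received h1 hN hlam hTD n hY] with ω hω q
  rw [cycleLength_eq hω, successGap_eq hω, failureSum_eq hω, Function.iterate_succ_apply']
  rfl

theorem measurable_areaReward {E : Type*} [MeasurableSpace E] {d t : E → ℝ} (hd : Measurable d)
    (ht : Measurable t) : Measurable (areaReward d t) := by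
  unfold areaReward
  fun_prop

theorem measurable_lengthReward {E : Type*} [MeasurableSpace E] {d : E → ℝ} (hd : Measurable d) :
    Measurable (lengthReward d) := by
  unfold lengthReward
  fun_prop

/-- The mean cycle area and the mean cycle length in terms of the moments of the cycle variables. -/
theorem integral_cycle (h1 : 1 ≤ K) (hN : K ≤ N) (hlam : 0 < lam) (hc : 0 < c)
    (hTD : (c : EReal) < TD) (ha : ∀ ω, 0 ≤ a ω)
    (hY : MeasurePreserving (fun ω j m => T m j ω) μ (seqLaw (serviceLaw N lam c))) (q : ℕ) :
    Integrable (fun ω => cycleArea K TD (a ω) n (fun m j => T m j ω) q) μ ∧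
    Integrable (fun ω => cycleLength K TD n (fun m j => T m j ω) q) μ ∧
    ∫ ω, cycleArea K TD (a ω) n (fun m j => T m j ω) q ∂μ
      = meanXS N K lam c TD * (meanW N K lam c TD + meanT N K lam c TD)
        + (meanWsq N K lam c TD / 2 + meanW N K lam c TD * meanT N K lam c TD
          + meanXSsq N K lam c TD / 2) ∧
    ∫ ω, cycleLength K TD n (fun m j => T m j ω) q ∂μ
      = meanW N K lam c TD + meanXS N K lam c TD := by
  have := isProbabilityMeasure_serviceLaw (N := N) (c := c) hlam
  have hS := measurableSet_receivedSet h1 hN TD n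
  have hd := measurable_duration h1 hN TD
  have hB := measurable_block hS hd
  have hBB := hB.prodMk (hB.comp (measurable_regen hS))
  have hA := (measurable_areaReward hd (measurable_pi_apply n)).comp hBB
  have hL := (measurable_lengthReward hd).comp hBB
  obtain ⟨i1, i2, e1, e2⟩ := integral_rewards (serviceLaw N lam c) hS
    (serviceLaw_receivedSet_ne_zero h1 hN hlam hTD n) hd (memLp_duration h1 hN hlam hc hTD)
    (by filter_upwards [ae_lt_duration h1 hN hlam hTD] with y hy using hc.le.trans hy.le)
    (measurable_pi_apply n) (setIntegral_received_apply h1 hN hlam hc hTD n).1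
  obtain ⟨-, w1, w2⟩ := moments_failures h1 hN hlam hc hTD n
  obtain ⟨x1, x2, t1⟩ := moments_success h1 hN hlam hc hTD n
  rw [w1, w2, x1, x2, t1] at e1
  rw [w1, x1] at e2
  have hG := measurePreserving_iterate_regen_path h1 hN hlam hTD n hY q
  have cA := (cycleArea_ae_eq (n := n) h1 hN hlam hc hTD ha hY).mono fun ω h => h q
  have cL := (cycleLength_ae_eq (n := n) h1 hN hlam hTD hY).mono fun ω h => h q
  refine ⟨(hG.integrable_comp_of_integrable i1).congr (cA.mono fun ω h => h.symm),
    (hG.integrable_comp_of_integrable i2).congr (cL.mono fun ω h => h.symm), ?_, ?_⟩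
  · rw [integral_congr_ae cA, ← e1, ← hG.map_eq]
    exact (integral_map hG.measurable.aemeasurable hA.aestronglyMeasurable).symm
  · rw [integral_congr_ae cL, ← e2, ← hG.map_eq]
    exact (integral_map hG.measurable.aemeasurable hL.aestronglyMeasurable).symm

/-- Each cycle contains the transmission of a received update, which lasts longer than `c`. -/
theorem integral_cycleLength_pos [IsProbabilityMeasure μ] (h1 : 1 ≤ K) (hN : K ≤ N) (hlam : 0 <
    lam) (hc : 0 < c)
    (hTD : (c : EReal) < TD)
    (hY : MeasurePreserving (fun ω j m => T m j ω) μ (seqLaw (serviceLaw N lam c))) (q : ℕ) :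
    0 < ∫ ω, cycleLength K TD n (fun m j => T m j ω) q ∂μ := by
  have hi := (integral_cycle (n := n) (a := fun _ => 0) h1 hN hlam hc hTD (fun _ => le_rfl) hY
      q).2.1
  have h : ∫ _, c ∂μ ≤ ∫ ω, cycleLength K TD n (fun m j => T m j ω) q ∂μ := by
    refine integral_mono_ae (integrable_const c) hi ?_
    filter_upwards [ae_infinite_received h1 hN hlam hTD n hY, ae_lt_service hlam hY] with ω hω hx
    have hd := lt_interGen h1 hN hTD hx
    have hW : 0 ≤ failureSum K TD n (fun m j => T m j ω) q :=
      Finset.sum_nonneg fun i _ => hc.le.trans (hd i).le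
    have hX : c < successGap K TD n (fun m j => T m j ω) (q + 1) := hd _
    simp only [cycleLength_eq hω]
    linarith
  simp only [integral_const, probReal_univ, one_smul] at h
  exact hc.trans_le h

theorem moments_cycle (h1 : 1 ≤ K) (hN : K ≤ N) (hlam : 0 < lam) (hc : 0 < c)
    (hTD : (c : EReal) < TD)
    (hY : MeasurePreserving (fun ω j m => T m j ω) μ (seqLaw (serviceLaw N lam c))) (q : ℕ) :
    (MemLp (fun ω => failureSum K TD n (fun m j => T m j ω) q) 2 μ ∧
      MemLp (fun ω => successGap K TD n (fun m j => T m j ω) q) 2 μ ∧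
      Integrable (fun ω => serviceTime K TD n (fun m j => T m j ω) q) μ) ∧
    ∫ ω, failureSum K TD n (fun m j => T m j ω) q ∂μ = meanW N K lam c TD ∧
    ∫ ω, failureSum K TD n (fun m j => T m j ω) q ^ 2 ∂μ = meanWsq N K lam c TD ∧
    ∫ ω, successGap K TD n (fun m j => T m j ω) q ∂μ = meanXS N K lam c TD ∧
    ∫ ω, successGap K TD n (fun m j => T m j ω) q ^ 2 ∂μ = meanXSsq N K lam c TD ∧
    ∫ ω, serviceTime K TD n (fun m j => T m j ω) q ∂μ = meanT N K lam c TD := by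
  have := isProbabilityMeasure_serviceLaw (N := N) (c := c) hlam
  have hS := measurableSet_receivedSet h1 hN TD n
  have hρ := serviceLaw_receivedSet_ne_zero h1 hN hlam hTD n
  have hd := measurable_duration h1 hN TD
  have hV := measurable_firstVal hS
  obtain ⟨wL, w1, w2⟩ := moments_failures h1 hN hlam hc hTD n
  obtain ⟨x1, x2, t1⟩ := moments_success h1 hN hlam hc hTD n
  have xL := memLp_firstVal (serviceLaw N lam c) hS hρ
    ((memLp_duration h1 hN hlam hc hTD).restrict (receivedSet N K TD n))
  have tL : Integrable (fun y => firstVal (receivedSet N K TD n) y n)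
      (seqLaw (serviceLaw N lam c)) := memLp_one_iff_integrable.1
    (memLp_firstVal (serviceLaw N lam c) (f := fun y => y n) hS hρ
      (memLp_one_iff_integrable.2 (setIntegral_received_apply h1 hN hlam hc hTD n).1))
  have hG := measurePreserving_iterate_regen_path h1 hN hlam hTD n hY
  have hinf := ae_infinite_received h1 hN hlam hTD n hY
  have cW := hinf.mono fun ω h => failureSum_eq h q
  have cX := hinf.mono fun ω h => successGap_eq h q
  have cT := hinf.mono fun ω h => serviceTime_eq h q
  have key : ∀ {f : Ω → ℝ} {g : (ℕ → Fin N → ℝ) → ℝ} {r : ℕ}, Measurable g →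
      (∀ᵐ ω ∂μ, f ω = g ((regen (receivedSet N K TD n))^[r] fun j m => T m j ω)) →
      ∫ ω, f ω ∂μ = ∫ y, g y ∂(seqLaw (serviceLaw N lam c)) := by
    intro f g r hg h
    rw [integral_congr_ae h, ← (hG r).map_eq]
    exact (integral_map (hG r).measurable.aemeasurable hg.aestronglyMeasurable).symm
  have hW := measurable_preSum hS hd
  refine ⟨⟨?_, ?_, ?_⟩, ?_, ?_, ?_, ?_, ?_⟩
  · exact (memLp_congr_ae cW).2 (wL.comp_measurePreserving (hG (q + 1)))
  · exact (memLp_congr_ae cX).2 (xL.comp_measurePreserving (hG q))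
  · exact (integrable_congr cT).2 ((hG (q + 1)).integrable_comp_of_integrable tL)
  · rw [key hW cW, w1]
  · rw [key (hW.pow_const 2) (cW.mono fun ω h => congrArg (· ^ 2) h), w2]
  · rw [key (hd.comp hV) cX]; exact x1
  · rw [key ((hd.comp hV).pow_const 2) (cX.mono fun ω h => congrArg (· ^ 2) h)]; exact x2
  · rw [key ((measurable_pi_apply n).comp hV) cT]; exact t1

theorem ratio_eq_averageAge [IsProbabilityMeasure μ] (h1 : 1 ≤ K) (hN : K ≤ N) (hlam : 0 < lam)
    (hc : 0 < c)
    (hTD : (c : EReal) < TD) (ha : ∀ ω, 0 ≤ a ω)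
    (hY : MeasurePreserving (fun ω j m => T m j ω) μ (seqLaw (serviceLaw N lam c))) (q : ℕ) :
    (∫ ω, cycleArea K TD (a ω) n (fun m j => T m j ω) q ∂μ) /
      (∫ ω, cycleLength K TD n (fun m j => T m j ω) q ∂μ) = averageAge N K lam c TD := by
  have hpos := integral_cycleLength_pos (n := n) h1 hN hlam hc hTD hY q
  obtain ⟨-, -, eA, eL⟩ := integral_cycle (n := n) h1 hN hlam hc hTD ha hY q
  rw [eL] at hpos
  rw [eA, eL, averageAge, ageOfMoments, ← mul_add, div_eq_div_iff hpos.ne' (by positivity)]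
  ring

/-- The renewal reward theorem for the age process. -/
theorem ae_tendsto_age [IsProbabilityMeasure μ] (h1 : 1 ≤ K) (hN : K ≤ N) (hlam : 0 < lam) (hc : 0
    < c)
    (hTD : (c : EReal) < TD) (ha : ∀ ω, 0 ≤ a ω)
    (hY : MeasurePreserving (fun ω j m => T m j ω) μ (seqLaw (serviceLaw N lam c))) :
    ∀ᵐ ω ∂μ, Tendsto
      (fun τ : ℝ => 1 / τ * ∫ t in (0 : ℝ)..τ, age K TD (a ω) n (fun m j => T m j ω) t)
      atTop (𝓝 (averageAge N K lam c TD)) := by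
  have := isProbabilityMeasure_serviceLaw (N := N) (c := c) hlam
  have hS := measurableSet_receivedSet h1 hN TD n
  have hρ := serviceLaw_receivedSet_ne_zero h1 hN hlam hTD n
  have hd := measurable_duration h1 hN TD
  obtain ⟨i1, i2, -, -⟩ := integral_rewards (serviceLaw N lam c) hS hρ hd
    (memLp_duration h1 hN hlam hc hTD)
    (by filter_upwards [ae_lt_duration h1 hN hlam hTD] with y hy using hc.le.trans hy.le)
    (measurable_pi_apply n) (setIntegral_received_apply h1 hN hlam hc hTD n).1
  have lA := hY.quasiMeasurePreserving.ae
    (strong_law_blocks _ hS hρ hd (measurable_areaReward hd (measurable_pi_apply n)) i1)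
  have lL := hY.quasiMeasurePreserving.ae
    (strong_law_blocks _ hS hρ hd (measurable_lengthReward hd) i2)
  have hB := measurable_block hS hd
  have hBB := hB.prodMk (hB.comp (measurable_regen hS))
  have cA := cycleArea_ae_eq (n := n) h1 hN hlam hc hTD ha hY
  have cL := cycleLength_ae_eq (n := n) h1 hN hlam hTD hY
  have eA : ∫ ω, cycleArea K TD (a ω) n (fun m j => T m j ω) 0 ∂μ = _ :=
    (integral_congr_ae (cA.mono fun ω h => h 0)).trans
      (integral_map hY.measurable.aemeasurable ((measurable_areaReward hd
        (measurable_pi_apply n)).comp hBB).aestronglyMeasurable).symm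
  have eL : ∫ ω, cycleLength K TD n (fun m j => T m j ω) 0 ∂μ = _ :=
    (integral_congr_ae (cL.mono fun ω h => h 0)).trans
      (integral_map hY.measurable.aemeasurable
        ((measurable_lengthReward hd).comp hBB).aestronglyMeasurable).symm
  rw [hY.map_eq] at eA eL
  have hpos := integral_cycleLength_pos (n := n) h1 hN hlam hc hTD hY 0
  rw [← ratio_eq_averageAge (n := n) h1 hN hlam hc hTD ha hY 0]
  filter_upwards [lA, lL, cA, cL, ae_infinite_received h1 hN hlam hTD n hY,
    ae_lt_service hlam hY] with ω hA hL hcA hcL hinf hx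
  have hx0 : ∀ m j, 0 < T m j ω := fun m j => hc.trans (hx m j)
  have hg0 : ∀ j, 0 < interGen K TD (fun m j => T m j ω) j :=
    fun j => hc.trans (lt_interGen h1 hN hTD hx j)
  -- Times are sampled at the ends of pairs of cycles, so both limits are doubled and the ratio is
  -- unchanged.
  rw [← mul_div_mul_left _ _ (two_ne_zero : (2 : ℝ) ≠ 0)]
  -- The time and the area up to the first received update's termination, including the influence of
  -- the initial age, are constants that vanish after division by `k`.
  have hconst : ∀ b : ℝ, Tendsto (fun k : ℕ => b / k) atTop (𝓝 0) := fun b =>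
    tendsto_const_div_atTop_nhds_zero_nat b
  refine tendsto_timeAverage (s := fun k => termTime K TD n (fun m j => T m j ω) (2 * k))
    (intervalIntegrable_age (ha ω) hx0) (fun t => age_nonneg (ha ω) hx0)
    (fun k => termTime_nonneg hg0 _)
    (fun i j hij => monotone_termTime hg0 hinf (Nat.mul_le_mul_left 2 hij))
    (mul_pos two_pos hpos) ?_ ?_
  · rw [eL, ← zero_add (2 * _)]
    refine ((hconst (termTime K TD n (fun m j => T m j ω) 0)).add hL).congr fun k => ?_
    rw [termTime_eq_sum (2 * k), add_div]
    simp only [hcL]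
  · rw [eA, ← zero_add (2 * _)]
    refine ((hconst (∫ t in (0 : ℝ)..(termTime K TD n (fun m j => T m j ω) 0),
      age K TD (a ω) n (fun m j => T m j ω) t)).add hA).congr fun k => ?_
    rw [integral_age_termTime (ha ω) hx0 (2 * k), add_div]
    simp only [hcA]

end Model

/-! ### A single update on the probability space -/

section SingleUpdate

variable {Ω : Type*} [MeasurableSpace Ω] {μ : Measure Ω} {N K : ℕ} {lam c : ℝ} {TD : EReal}
  {φ : Ω → Fin N → ℝ}

theorem cond_received_moments (h1 : 1 ≤ K) (hN : K ≤ N) (hlam : 0 < lam) (hc : 0 < c)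
    (hTD : (c : EReal) < TD) (hφ : MeasurePreserving φ μ (serviceLaw N lam c)) (n : Fin N) :
    ∫ ω, duration K TD (φ ω) ∂(ProbabilityTheory.cond μ {ω | Received K TD n (φ ω)})
      = meanXS N K lam c TD ∧
    ∫ ω, duration K TD (φ ω) ^ 2 ∂(ProbabilityTheory.cond μ {ω | Received K TD n (φ ω)})
      = meanXSsq N K lam c TD ∧
    ∫ ω, φ ω n ∂(ProbabilityTheory.cond μ {ω | Received K TD n (φ ω)})
      = meanT N K lam c TD := by
  have hp := (probS_pos h1 hN hlam hTD).ne'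
  have hd := measurable_duration h1 hN TD
  obtain ⟨a1, a2⟩ := setIntegral_received_duration h1 hN hlam hc hTD n
  have key : ∀ {f : (Fin N → ℝ) → ℝ} {v : ℝ}, Measurable f →
      ∫ y in {y | Received K TD n y}, f y ∂(serviceLaw N lam c) = probS N K lam c TD * v →
      ∫ ω, f (φ ω) ∂(ProbabilityTheory.cond μ {ω | Received K TD n (φ ω)}) = v := by
    intro f v hf h
    refine (integral_cond_preimage hφ (measurableSet_received h1 hN TD n) hf).trans ?_
    rw [h, real_received h1 hN hlam hTD n, inv_mul_cancel_left₀ hp]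
  exact ⟨key hd a1, key (hd.pow_const 2) a2,
    key (measurable_pi_apply n) (setIntegral_received_apply h1 hN hlam hc hTD n).2⟩

theorem measure_pos_of_real_pos {ρ : Measure (Fin N → ℝ)} (hφ : MeasurePreserving φ μ ρ)
    {S : Set (Fin N → ℝ)} (hS : MeasurableSet S) (h : 0 < ρ.real S) : 0 < μ (φ ⁻¹' S) := by
  rw [hφ.measure_preimage hS.nullMeasurableSet]
  exact (ENNReal.toReal_pos_iff.1 h).1

/-- Restricting to reception multiplies both the integrals and the mass by `K / N`; the factor
cancels in the conditional moments. -/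
theorem cond_received_lt (h1 : 1 ≤ K) (hN : K ≤ N) (hlam : 0 < lam) (hc : 0 < c)
    (hTD : (c : EReal) < TD) (hφ : MeasurePreserving φ μ (serviceLaw N lam c)) (n : Fin N) :
    (ProbabilityTheory.cond μ {ω | Received K TD n (φ ω)}).real
        {ω | Received K TD n (φ ω) ∧ ((orderStat K (φ ω) : ℝ) : EReal) < TD}
      = probS1 N K lam c TD ∧
    0 < μ {ω | Received K TD n (φ ω) ∧ ((orderStat K (φ ω) : ℝ) : EReal) < TD} ∧
    ∫ ω, orderStat K (φ ω) ∂(ProbabilityTheory.cond μ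
        {ω | Received K TD n (φ ω) ∧ ((orderStat K (φ ω) : ℝ) : EReal) < TD})
      = condMoment1 N K lam c TD ∧
    ∫ ω, orderStat K (φ ω) ^ 2 ∂(ProbabilityTheory.cond μ
        {ω | Received K TD n (φ ω) ∧ ((orderStat K (φ ω) : ℝ) : EReal) < TD})
      = condMoment2 N K lam c TD := by
  have hKpos : (0 : ℝ) < K := by exact_mod_cast h1
  have hNpos : (0 : ℝ) < N := by exact_mod_cast lt_of_lt_of_le h1 hN
  have hp := probS_pos h1 hN hlam hTD
  have hZ := one_sub_coeffZ_pos h1 hN hlam hTD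
  have hR := measurableSet_received h1 hN TD n
  have hS := measurableSet_received_lt h1 hN TD n
  have ho := measurable_orderStat h1 hN
  have hL := memLp_orderStat (c := c) h1 hN hlam
  have := isProbabilityMeasure_serviceLaw (N := N) (c := c) hlam
  have hr := real_received_lt h1 hN hlam hTD n
  have hpos : 0 < (K : ℝ) / N * (1 - coeffZ N lam c TD K) := by positivity
  refine ⟨?_, measure_pos_of_real_pos hφ hS (hr ▸ hpos), ?_, ?_⟩
  · refine (cond_real_preimage hφ hR hS).trans ?_
    rw [Set.inter_eq_right.2 fun y hy => hy.1, hr, real_received h1 hN hlam hTD n, probS1]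
    field_simp
  · refine (integral_cond_preimage hφ hS ho).trans ?_
    rw [setIntegral_received_lt h1 hN hlam n (f := fun u => u) measurable_id (hL.integrable
        one_le_two),
      hr]
    rw [← one_sub_coeffZ_mul_condMoment1 h1 hN hlam hc hTD]
    field_simp
  · refine (integral_cond_preimage hφ hS (ho.pow_const 2)).trans ?_
    rw [setIntegral_received_lt h1 hN hlam n (f := fun u => u ^ 2) (measurable_id.pow_const 2)
      hL.integrable_sq, hr, ← one_sub_coeffZ_mul_condMoment2 h1 hN hlam hc hTD]
    field_simp

theorem cond_not_received_lt (h1 : 1 ≤ K) (hKN : K < N) (hlam : 0 < lam) (hc : 0 < c)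
    (hTD : (c : EReal) < TD) (hφ : MeasurePreserving φ μ (serviceLaw N lam c)) (n : Fin N) :
    0 < μ {ω | ¬ Received K TD n (φ ω) ∧ ((orderStat K (φ ω) : ℝ) : EReal) < TD} ∧
    ∫ ω, orderStat K (φ ω) ∂(ProbabilityTheory.cond μ
        {ω | ¬ Received K TD n (φ ω) ∧ ((orderStat K (φ ω) : ℝ) : EReal) < TD})
      = condMoment1 N K lam c TD ∧
    ∫ ω, orderStat K (φ ω) ^ 2 ∂(ProbabilityTheory.cond μ
        {ω | ¬ Received K TD n (φ ω) ∧ ((orderStat K (φ ω) : ℝ) : EReal) < TD})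
      = condMoment2 N K lam c TD := by
  have hN := hKN.le
  have hNpos : (0 : ℝ) < N := by exact_mod_cast lt_of_lt_of_le h1 hN
  have hsub : (0 : ℝ) < N - K := sub_pos.2 (by exact_mod_cast hKN)
  have hZ := one_sub_coeffZ_pos h1 hN hlam hTD
  have hS : MeasurableSet {y : Fin N → ℝ | ¬ Received K TD n y ∧
      ((orderStat K y : ℝ) : EReal) < TD} :=
    (measurableSet_received h1 hN TD n).compl.inter (measurableSet_orderStat_lt h1 hN TD)
  have ho := measurable_orderStat h1 hN
  have hL := memLp_orderStat (c := c) h1 hN hlam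
  have := isProbabilityMeasure_serviceLaw (N := N) (c := c) hlam
  have hr := real_not_received_lt h1 hN hlam hTD n
  have hpos : 0 < ((N : ℝ) - K) / N * (1 - coeffZ N lam c TD K) := by positivity
  refine ⟨measure_pos_of_real_pos hφ hS (hr ▸ hpos), ?_, ?_⟩
  · refine (integral_cond_preimage hφ hS ho).trans ?_
    rw [setIntegral_not_received_lt h1 hN hlam n (f := fun u => u) measurable_id
      (hL.integrable one_le_two), hr]
    rw [← one_sub_coeffZ_mul_condMoment1 h1 hN hlam hc hTD]
    field_simp
  · refine (integral_cond_preimage hφ hS (ho.pow_const 2)).trans ?_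
    rw [setIntegral_not_received_lt h1 hN hlam n (f := fun u => u ^ 2) (measurable_id.pow_const 2)
      hL.integrable_sq, hr, ← one_sub_coeffZ_mul_condMoment2 h1 hN hlam hc hTD]
    field_simp

/-- The alternative `K < N ∨ TD ≠ ⊤` excludes precisely the case in which failures have probability
zero. -/
theorem cond_not_received (h1 : 1 ≤ K) (hN : K ≤ N) (hlam : 0 < lam) (hc : 0 < c)
    (hTD : (c : EReal) < TD) (hφ : MeasurePreserving φ μ (serviceLaw N lam c)) (n : Fin N)
    (h : K < N ∨ TD ≠ ⊤) :
    0 < μ {ω | ¬ Received K TD n (φ ω)} ∧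
    (ProbabilityTheory.cond μ {ω | ¬ Received K TD n (φ ω)}).real
        {ω | TD < ((orderStat K (φ ω) : ℝ) : EReal)} = probF2 N K lam c TD ∧
    ∫ ω, duration K TD (φ ω) ∂(ProbabilityTheory.cond μ {ω | ¬ Received K TD n (φ ω)})
      = meanXF N K lam c TD ∧
    ∫ ω, duration K TD (φ ω) ^ 2 ∂(ProbabilityTheory.cond μ {ω | ¬ Received K TD n (φ ω)})
      = meanXFsq N K lam c TD := by
  have hp := one_sub_probS_pos h1 hN hlam hTD h
  have hd := measurable_duration h1 hN TD
  have hS : MeasurableSet {y : Fin N → ℝ | ¬ Received K TD n y} :=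
    (measurableSet_received h1 hN TD n).compl
  have hr := real_not_received h1 hN hlam hTD n
  obtain ⟨a1, a2⟩ := setIntegral_not_received_duration h1 hN hlam hc hTD n
  refine ⟨measure_pos_of_real_pos hφ hS (hr ▸ hp), ?_, ?_, ?_⟩
  · refine (cond_real_preimage hφ hS (measurableSet_lt_orderStat h1 hN TD)).trans ?_
    rw [hr, inv_mul_eq_iff_eq_mul₀ hp.ne', one_sub_probS_mul_probF2 h1 hN hlam hTD hp.ne' n]
    rfl
  · refine (integral_cond_preimage hφ hS hd).trans ?_
    rw [hr, a1, inv_mul_cancel_left₀ hp.ne']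
  · refine (integral_cond_preimage hφ hS (hd.pow_const 2)).trans ?_
    rw [hr, a2, inv_mul_cancel_left₀ hp.ne']

end SingleUpdate

end MulticastAoI

end

open MulticastAoI in
theorem mainTheorem1 {Ω : Type*} [MeasurableSpace Ω] (μ : Measure Ω) [IsProbabilityMeasure μ]
    (N K : ℕ) (hK : 1 ≤ K) (hKN : K ≤ N)
    (lam c : ℝ) (hlam : 0 < lam) (hc : 0 < c) (TD : EReal) (hTD : (c : EReal) < TD)
    (T : Fin N → ℕ → Ω → ℝ) (hmeas : ∀ m j, Measurable (T m j))
    (hindep : ProbabilityTheory.iIndepFun (fun p : Fin N × ℕ => T p.1 p.2) μ)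
    (hlaw : ∀ m j, μ.map (T m j) = shiftedExp lam c)
    (a : Ω → ℝ) (ha : ∀ ω, 0 ≤ a ω) (n : Fin N) :
    -- the time average of the age exists almost surely and equals the ratio of `E[A]` and `E[Y]`
    (∀ᵐ ω ∂μ, {j : ℕ | Received K TD n fun m => T m j ω}.Infinite) ∧
    (∀ q, Integrable (fun ω => cycleArea K TD (a ω) n (fun m j => T m j ω) q) μ ∧
      Integrable (fun ω => cycleLength K TD n (fun m j => T m j ω) q) μ ∧
      0 < ∫ ω, cycleLength K TD n (fun m j => T m j ω) q ∂μ) ∧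
    (∀ᵐ ω ∂μ, ∀ τ, IntervalIntegrable (age K TD (a ω) n fun m j => T m j ω) volume 0 τ) ∧
    (∀ q, ∀ᵐ ω ∂μ,
      Tendsto (fun τ : ℝ => 1 / τ * ∫ t in (0 : ℝ)..τ, age K TD (a ω) n (fun m j => T m j ω) t)
        atTop (𝓝 ((∫ ω', cycleArea K TD (a ω') n (fun m j => T m j ω') q ∂μ) /
          ∫ ω', cycleLength K TD n (fun m j => T m j ω') q ∂μ))) ∧
    -- the ratio in terms of the moments of `W`, `X^S` and `T̂`, and in closed form
    (∀ q, MemLp (fun ω => failureSum K TD n (fun m j => T m j ω) q) 2 μ ∧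
      MemLp (fun ω => successGap K TD n (fun m j => T m j ω) q) 2 μ ∧
      Integrable (fun ω => serviceTime K TD n (fun m j => T m j ω) q) μ) ∧
    (∀ q, (∫ ω, cycleArea K TD (a ω) n (fun m j => T m j ω) q ∂μ) /
        (∫ ω, cycleLength K TD n (fun m j => T m j ω) q ∂μ) =
      ageOfMoments
        (∫ ω, failureSum K TD n (fun m j => T m j ω) q ∂μ)
        (∫ ω, failureSum K TD n (fun m j => T m j ω) q ^ 2 ∂μ)
        (∫ ω, successGap K TD n (fun m j => T m j ω) q ∂μ)
        (∫ ω, successGap K TD n (fun m j => T m j ω) q ^ 2 ∂μ)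
        (∫ ω, serviceTime K TD n (fun m j => T m j ω) q ∂μ)) ∧
    (∀ q, (∫ ω, cycleArea K TD (a ω) n (fun m j => T m j ω) q ∂μ) /
        (∫ ω, cycleLength K TD n (fun m j => T m j ω) q ∂μ) = averageAge N K lam c TD) ∧
    -- the moments of `W`, `X^S` and `T̂`
    (∀ q, ∫ ω, failureSum K TD n (fun m j => T m j ω) q ∂μ = meanW N K lam c TD ∧
      ∫ ω, failureSum K TD n (fun m j => T m j ω) q ^ 2 ∂μ = meanWsq N K lam c TD ∧
      ∫ ω, successGap K TD n (fun m j => T m j ω) q ∂μ = meanXS N K lam c TD ∧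
      ∫ ω, successGap K TD n (fun m j => T m j ω) q ^ 2 ∂μ = meanXSsq N K lam c TD ∧
      ∫ ω, serviceTime K TD n (fun m j => T m j ω) q ∂μ = meanT N K lam c TD) ∧
    -- the probabilities and conditional moments of a single update `j`
    (∀ j, MemLp (fun ω => orderStat K fun m => T m j ω) 2 μ ∧
      (∀ h, 1 ≤ h → h ≤ N →
        μ.real {ω | TD < ((orderStat h fun m => T m j ω : ℝ) : EReal)} = coeffZ N lam c TD h) ∧
      μ.real {ω | Received K TD n fun m => T m j ω} = probS N K lam c TD ∧
      0 < probS N K lam c TD ∧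
      (∀ S : Set Ω, S = {ω | Received K TD n fun m => T m j ω} →
        ∫ ω, interGen K TD (fun m i => T m i ω) j ∂(ProbabilityTheory.cond μ S)
          = meanXS N K lam c TD ∧
        ∫ ω, interGen K TD (fun m i => T m i ω) j ^ 2 ∂(ProbabilityTheory.cond μ S)
          = meanXSsq N K lam c TD ∧
        ∫ ω, T n j ω ∂(ProbabilityTheory.cond μ S) = meanT N K lam c TD) ∧
      (∀ S1 : Set Ω, S1 = {ω | (Received K TD n fun m => T m j ω) ∧
          ((orderStat K fun m => T m j ω : ℝ) : EReal) < TD} →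
        (ProbabilityTheory.cond μ {ω | Received K TD n fun m => T m j ω}).real S1
            = probS1 N K lam c TD ∧
        0 < μ S1 ∧
        ∫ ω, (orderStat K fun m => T m j ω) ∂(ProbabilityTheory.cond μ S1)
          = condMoment1 N K lam c TD ∧
        ∫ ω, (orderStat K fun m => T m j ω) ^ 2 ∂(ProbabilityTheory.cond μ S1)
          = condMoment2 N K lam c TD) ∧
      (∀ F1 : Set Ω, F1 = {ω | ¬ (Received K TD n fun m => T m j ω) ∧
          ((orderStat K fun m => T m j ω : ℝ) : EReal) < TD} → K < N →
        0 < μ F1 ∧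
        ∫ ω, (orderStat K fun m => T m j ω) ∂(ProbabilityTheory.cond μ F1)
          = condMoment1 N K lam c TD ∧
        ∫ ω, (orderStat K fun m => T m j ω) ^ 2 ∂(ProbabilityTheory.cond μ F1)
          = condMoment2 N K lam c TD) ∧
      (∀ F : Set Ω, F = {ω | ¬ Received K TD n fun m => T m j ω} → (K < N ∨ TD ≠ ⊤) →
        0 < μ F ∧
        (ProbabilityTheory.cond μ F).real
            {ω | TD < ((orderStat K fun m => T m j ω : ℝ) : EReal)} = probF2 N K lam c TD ∧
        ∫ ω, interGen K TD (fun m i => T m i ω) j ∂(ProbabilityTheory.cond μ F)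
          = meanXF N K lam c TD ∧
        ∫ ω, interGen K TD (fun m i => T m i ω) j ^ 2 ∂(ProbabilityTheory.cond μ F)
          = meanXFsq N K lam c TD)) := by
  have hY := measurePreserving_path hlam hmeas hindep hlaw
  have hinf := ae_infinite_received hK hKN hlam hTD n hY
  refine ⟨hinf, fun q => ?_, ?_, fun q => ?_, fun q => (moments_cycle hK hKN hlam hc hTD hY q).1,
    fun q => ?_, fun q => ratio_eq_averageAge hK hKN hlam hc hTD ha hY q,
    fun q => (moments_cycle hK hKN hlam hc hTD hY q).2, fun j => ?_⟩
  · obtain ⟨iA, iL, -, -⟩ := integral_cycle (n := n) hK hKN hlam hc hTD ha hY q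
    exact ⟨iA, iL, integral_cycleLength_pos hK hKN hlam hc hTD hY q⟩
  · filter_upwards [ae_lt_service hlam hY] with ω hx τ
    exact intervalIntegrable_age (ha ω) (fun m j => hc.trans (hx m j)) 0 τ
  -- The closed form does not involve `q`, so a single almost sure limit serves every cycle index.
  · rw [ratio_eq_averageAge hK hKN hlam hc hTD ha hY q]
    exact ae_tendsto_age hK hKN hlam hc hTD ha hY
  · obtain ⟨-, e1, e2, e3, e4, e5⟩ := moments_cycle (n := n) hK hKN hlam hc hTD hY q
    rw [e1, e2, e3, e4, e5]
    exact ratio_eq_averageAge hK hKN hlam hc hTD ha hY q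
  · have hφ := measurePreserving_column hlam hY j
    have hR := measurableSet_received hK hKN TD n
    refine ⟨(memLp_orderStat hK hKN hlam).comp_measurePreserving hφ, fun h h1 hN => ?_, ?_,
      probS_pos hK hKN hlam hTD, ?_, ?_, ?_, ?_⟩
    · rw [← serviceLaw_real_lt_orderStat h1 hN hlam hTD]
      exact hφ.measureReal_preimage (measurableSet_lt_orderStat h1 hN TD).nullMeasurableSet
    · rw [← real_received hK hKN hlam hTD n]
      exact hφ.measureReal_preimage hR.nullMeasurableSet
    · rintro S rfl
      exact cond_received_moments hK hKN hlam hc hTD hφ n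
    · rintro S rfl
      exact cond_received_lt hK hKN hlam hc hTD hφ n
    · rintro S rfl h
      exact cond_not_received_lt hK h hlam hc hTD hφ n
    · rintro S rfl h
      exact cond_not_received hK hKN hlam hc hTD hφ n h
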